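/- Let $p\ge 0$, $q>0$, $p+q=1$, $\tau=p/q$. Consider the asymmetric simple exclusion process on $\mathbb Z$ with $N$ particles: each particle independently waits an exponential time of rate $1$, then tries to jump one step to the right with probability $p$, or one step to the left with probability $q$; the jump is carried out if the target site is unoccupied, otherwise the particle stays put. Let $Y=\{y_1<\cdots<y_N\}$ be the initial configuration, let $x_1(t)<\cdots<x_N(t)$ be the positions at time $t\ge0$, and let $\mathbb P_Y$ be the law of the process. For indices in $[1,N]$ put $$f(\xi,\xi')=p+q\xi\xi'-\xi,\qquad \varepsilon(\xi)=p\,\xi^{-1}+q\,\xi-1,$$ $$\sigma(U,V)=\#\{(i,j): i\in U,\ j\in V,\ i\ge j\},\qquad \sigma(U)=\sigma(U,[1,N]).$$ For a tuple $\Lambda=(\ell_1,\ldots,\ell_{m-1})$ of distinct indices let $\operatorname{sgn}\Lambda$ be $(-1)$ to the number of its inversions, and write $\Lambda$ also for the set of its entries. **Theorem.** Let $1\le m\le N$, $t\ge0$, let $x_1<\cdots<x_m$ be integers, and let $R>0$ be so large that $qR^2>R+p$ (then the zeros of all denominators below lie inside the circle of radius $R$). Then $$\mathbb P_Y\big(x_i(t)=x_i,\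 i=1,\ldots,m\big)=\sum_{\Lambda,\ S\subset\Lambda^c}(-1)^{\sigma(S,\Lambda)-(m-1)k}\ \operatorname{sgn}\Lambda\ \ \tau^{\sum_{i<m}(\ell_i-i)+\sigma(S)-mk}\ q^{k(k-1)/2}\ I_{\Lambda,S},$$ where $k=|S|$, the sum is over all $(m-1)$-tuples $\Lambda$ of distinct elements of $[1,N]$ and all sets $S\subset[1,N]$ disjoint from $\Lambda$, and $$I_{\Lambda,S}=\int_{\mathcal C_R}\!\!\cdots\int_{\mathcal C_R}\frac{\prod_{i\in\Lambda,\,j\in S}f(\xi_i,\xi_j)\ \prod_{i<j}f(\xi_{\ell_i},\xi_{\ell_j})}{\prod_{i<j;\ i,j\in S\cup\Lambda}f(\xi_i,\xi_j)}\Big(1-\prod_{j\in S}\xi_j\Big)\frac{\prod_{i<j;\ i,j\in S}(\xi_j-\xi_i)}{\prod_{j\in S}(1-\xi_j)}$$ $$\times\ \prod_{i<m}\xi_{\ell_i}^{x_i}\ \prod_{j\in S}\xi_j^{x_m}\prod_{i\in S\cup\Lambda}\xi_i^{-y_i-1}\ e^{\sum_{i\in S\cup\Lambda}\varepsilon(\xi_i)t}\prod_{i\in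 S\cup\Lambda}d\xi_i .$$ Here $\mathcal C_R$ is the positively oriented circle with center $0$ and radius $R$, and each contour integral carries a factor $1/(2\pi i)$. The convention $0^0=1$ is used when $p=0$ (the exponent of $\tau$ is never negative). -/

import Mathlib

open MeasureTheory Finset Filter Topology
open scoped NNReal BoundedContinuousFunction BigOperators

noncomputable section

namespace ASEP

/-- Configurations of `N` particles on `ℤ`: the positions `x 0 < x 1 < ⋯ < x (N - 1)`, labelled
from left to right. -/
abbrev Config (N : ℕ) : Type := {x : Fin N → ℤ // StrictMono x}

/-- Moving one particle by one step to an unoccupied site keeps the order of the particles. -/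
theorem strictMono_update {N : ℕ} (X : Config N) (i : Fin N) (d : ℤˣ)
    (h : ∀ j, X.1 j ≠ X.1 i + d) : StrictMono (Function.update X.1 i (X.1 i + d)) := by
  have hd : (d : ℤ) = 1 ∨ (d : ℤ) = -1 := by
    rcases Int.units_eq_one_or d with rfl | rfl <;> simp
  intro a b hab
  have hX := X.2 hab
  by_cases ha : a = i
  · subst ha
    have hb : b ≠ a := ne_of_gt hab
    have := h b
    simp only [Function.update_self, Function.update_of_ne hb]
    rcases hd with hd | hd <;> rw [hd] at this ⊢ <;> omega
  · by_cases hb : b = i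
    · subst hb
      have := h a
      simp only [Function.update_self, Function.update_of_ne ha]
      rcases hd with hd | hd <;> rw [hd] at this ⊢ <;> omega
    · simpa only [Function.update_of_ne ha, Function.update_of_ne hb] using hX

open Classical in
/-- Particle `i` tries to jump by `d = ±1`: it moves if the target site is unoccupied, otherwise
it stays put. -/
def jump {N : ℕ} (i : Fin N) (d : ℤˣ) (X : Config N) : Config N :=
  if h : ∀ j, X.1 j ≠ X.1 i + d then
    ⟨Function.update X.1 i (X.1 i + d), strictMono_update X i d h⟩
  else X

/-- The operator `g ↦ g ∘ jump i d` on bounded functions of the configuration (the space of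
configurations is discrete, so every bounded function is a bounded continuous one). -/
def jumpOp {N : ℕ} (i : Fin N) (d : ℤˣ) : (Config N →ᵇ ℝ) →L[ℝ] (Config N →ᵇ ℝ) :=
  BoundedContinuousFunction.compContinuousCLM ℝ ℝ ⟨jump i d, continuous_of_discreteTopology⟩

/-- The generator of the `N`-particle asymmetric simple exclusion process, with jumps to the right
at rate `p` and jumps to the left at rate `q`:
`(L g)(X) = ∑ i, (p * (g (jump i 1 X) - g X) + q * (g (jump i (-1) X) - g X))`. -/
def generator (N : ℕ) (p q : ℝ) : (Config N →ᵇ ℝ) →L[ℝ] (Config N →ᵇ ℝ) :=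
  ∑ i : Fin N, (p • (jumpOp i 1 - ContinuousLinearMap.id ℝ (Config N →ᵇ ℝ)) +
    q • (jumpOp i (-1) - ContinuousLinearMap.id ℝ (Config N →ᵇ ℝ)))

theorem generator_apply (N : ℕ) (p q : ℝ) (g : Config N →ᵇ ℝ) (X : Config N) :
    generator N p q g X =
      ∑ i : Fin N, (p * (g (jump i 1 X) - g X) + q * (g (jump i (-1) X) - g X)) := by
  simp [generator, jumpOp]

/-- The exponential `∑ n, A ^ n / n!` of a bounded operator on a normed space. -/
def operatorExp {E : Type*} [NormedAddCommGroup E] [NormedSpace ℝ E] (A : E →L[ℝ] E) : E →L[ℝ] E :=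
  NormedSpace.exp A

/-- The Markov semigroup `exp (t L)` of the process. -/
def semigroup (N : ℕ) (p q : ℝ) (t : ℝ≥0) : (Config N →ᵇ ℝ) →L[ℝ] (Config N →ᵇ ℝ) :=
  operatorExp ((t : ℝ) • generator N p q)

/-- `X` is an `N`-particle asymmetric simple exclusion process on the probability space `(Ω, μ)`
with jump rates `p` (right) and `q` (left), started from the configuration `Y`: a càdlàg Markov
process with the semigroup generated by `generator N p q`. -/
structure IsASEP {Ω : Type*} [MeasurableSpace Ω] (μ : Measure Ω) {N : ℕ} (p q : ℝ)
    (Y : Config N) (X : ℝ≥0 → Ω → Config N) : Prop where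
  measurable : ∀ t, Measurable (X t)
  start : ∀ᵐ ω ∂μ, X 0 ω = Y
  right_continuous : ∀ᵐ ω ∂μ, ∀ t, ContinuousWithinAt (fun s => X s ω) (Set.Ici t) t
  left_limits : ∀ᵐ ω ∂μ, ∀ t, ∃ Z, Tendsto (fun s => X s ω) (𝓝[<] t) (𝓝 Z)
  markov : ∀ (s t : ℝ≥0) (g : Config N →ᵇ ℝ),
    μ[fun ω => g (X (s + t) ω) | ⨆ u : Set.Iic s, MeasurableSpace.comap (X u) inferInstance]
      =ᵐ[μ] fun ω => semigroup N p q t g (X s ω)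

/-- `f(ξ, ξ') = p + q ξ ξ' - ξ`. -/
def f (p q : ℝ) (ξ ξ' : ℂ) : ℂ := p + q * ξ * ξ' - ξ

/-- `ε(ξ) = p ξ⁻¹ + q ξ - 1`. -/
def ε (p q : ℝ) (ξ : ℂ) : ℂ := p * ξ⁻¹ + q * ξ - 1

/-- `σ(U, V) = #{(i, j) : i ∈ U, j ∈ V, i ≥ j}`. -/
def σ {N : ℕ} (U V : Finset (Fin N)) : ℕ := #{x ∈ U ×ˢ V | x.2 ≤ x.1}

/-- The number of inversions of a tuple. -/
def inversions {l N : ℕ} (Λ : Fin l ↪ Fin N) : ℕ :=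
  #{x : Fin l × Fin l | x.1 < x.2 ∧ Λ x.2 < Λ x.1}

/-- The sign of a tuple of distinct indices. -/
def sgn {l N : ℕ} (Λ : Fin l ↪ Fin N) : ℂ := (-1) ^ inversions Λ

/-- Extend variables `z`, listed in increasing order of the indices in `U`, to a vector indexed by
`Fin N`, with the irrelevant value `0` off `U`. -/
def extendVars {N : ℕ} (U : Finset (Fin N)) (z : Fin #U → ℂ) : Fin N → ℂ :=
  fun i => if h : i ∈ U then z ((U.orderIsoOfFin rfl).symm ⟨i, h⟩) else 0

/-- `∫_{C_R} ⋯ ∫_{C_R} F(ξ) ∏_{i ∈ U} dξ_i`, where `C_R` is the circle with center zero and radius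
`R`, positively oriented, each integral carries a factor `1 / (2 π i)`, and `F` depends only on the
variables `ξ_i` with `i ∈ U`. -/
def contourIntegral {N : ℕ} (U : Finset (Fin N)) (R : ℝ) (F : (Fin N → ℂ) → ℂ) : ℂ :=
  ((2 * Real.pi * Complex.I)⁻¹) ^ #U *
    torusIntegral (fun z : Fin #U → ℂ => F (extendVars U z)) 0 (fun _ => R)

/-- The set of entries of a tuple. -/
def entries {l N : ℕ} (Λ : Fin l ↪ Fin N) : Finset (Fin N) := univ.map Λ

/-- The integrand of the term belonging to `Λ` and `S`, for the event that the first `l + 1`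
particles are at the sites `x 0, …, x l`. -/
def integrand {l N : ℕ} (p q : ℝ) (t : ℝ) (y : Fin N → ℤ) (x : Fin (l + 1) → ℤ)
    (Λ : Fin l ↪ Fin N) (S : Finset (Fin N)) (ξ : Fin N → ℂ) : ℂ :=
  ((∏ i ∈ entries Λ, ∏ j ∈ S, f p q (ξ i) (ξ j)) *
      (∏ i : Fin l, ∏ j ∈ Ioi i, f p q (ξ (Λ i)) (ξ (Λ j))) /
    ∏ i ∈ S ∪ entries Λ, ∏ j ∈ S ∪ entries Λ with i < j, f p q (ξ i) (ξ j)) *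
  (1 - ∏ j ∈ S, ξ j) *
  ((∏ i ∈ S, ∏ j ∈ S with i < j, (ξ j - ξ i)) / ∏ j ∈ S, (1 - ξ j)) *
  (∏ i : Fin l, ξ (Λ i) ^ x i.castSucc) *
  (∏ j ∈ S, ξ j ^ x (Fin.last l)) *
  (∏ i ∈ S ∪ entries Λ, ξ i ^ (-y i - 1)) *
  Complex.exp (∑ i ∈ S ∪ entries Λ, ε p q (ξ i) * t)

/-- The coefficient of the term belonging to `Λ` and `S`, with `m = l + 1`, `k = #S`, `τ = p / q`:
`(-1)^(σ(S, Λ) - (m - 1) k) * sgn Λ * τ^(∑_{i < m} (Λ_i - i) + σ(S) - m k) * q^(k (k - 1) / 2)`,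
where `σ(S) = σ(S, [1, N])`. -/
def coeff {l N : ℕ} (p q : ℝ) (Λ : Fin l ↪ Fin N) (S : Finset (Fin N)) : ℂ :=
  (-1 : ℂ) ^ ((σ S (entries Λ) : ℤ) - l * #S) * sgn Λ *
  ((p / q : ℝ) : ℂ) ^ (∑ i : Fin l, (((Λ i : ℕ) : ℤ) - ((i : ℕ) : ℤ)) + (σ S univ : ℤ)
    - (l + 1) * #S) *
  (q : ℂ) ^ (#S * (#S - 1) / 2)

end ASEP

end

/-! The factor $1-\prod_{j\in S}\xi_j$ comes from a difference in $x_m$. With $l=m-1$, it therefore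
suffices to find the probability that the first $l$ particles are at given sites and the next one is
at a given site or to its right; the wanted event is a difference of two such events
(`IsASEP.measureReal_eq`). As a function of time and of the initial configuration $y$, this tail
probability solves the backward equation, and the proof exhibits a Bethe ansatz solution in $y$.

A pair $(\Lambda,S)$ is encoded as a ranking of all $N$ indices: the entries of $\Lambda$ get the
ranks $0,\dots,l-1$, the elements of $S$ the rank $l$, and the absent indices the rank $l+1$
(`sum_rankOf`). The coefficient times the integrand then becomes a product of weights of pairs and
of single indices (`coeff_mul_integrand`). Absent indices still carry weights: an absent index to
the left of a present one costs $\tau=p/q$.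

Two properties give the evolution. Each `term` is an eigenfunction of the free generator, with the
energy as eigenvalue. Exchanging both the ranks and the variables of two neighbours changes the sign
of the boundary expression, so that it cancels in the sum over all rankings (`rankSum_boundary`); on
ordered configurations the free generator may then replace that of the exclusion process
(`generatorFun_eq_free`). The sum grows at most exponentially in $y$, and in this class the backward
equation has only one solution with given initial values (`eq_zero_of_hasDerivAt_generatorFun`).

The main work is the initial condition (`sum_term_initial`). Indices are settled from left to right.
Suppose every index before $o$ has itself as rank. The rankings that give $o$ a rank strictly
between $o$ and $l$ contribute zero in total, and those with $o$ in $S$ cancel those with $o$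
absent, provided $y_o<X_l$. Only the rank $o$ survives (`sum_stageSet_of_lt`), until a single
trivial integral is left.

The cancellation rests on `torusAvg_div_prod_f_eq_zero`. Expand $\prod_b f(\xi_o,\xi_b)^{-1}$ in
partial fractions; in the summand of $b$, integrate over $\xi_b$ with $\xi_o\xi_b$ fixed and push
the contour to infinity. Along this curve $f(\xi_o,\xi_b)$ has no zero outside the contour. The pole
at $\xi_o=1$ is removable because its residue has been subtracted, and for $o$ in $S$ this residue
is what the absent term supplies. The poles at $\xi_b=\xi_c$ are removable because the sum over
rankings is antisymmetric there. The decay comes from $y_o<y_b$. -/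

noncomputable section

namespace ASEP

/-! ### Products over unordered pairs -/

/-- The product of `g i j` over the pairs `i < j` of elements of `s`. -/
def pairProd {ι : Type*} [LinearOrder ι] (s : Finset ι) (g : ι → ι → ℂ) : ℂ :=
  ∏ i ∈ s, ∏ j ∈ s with i < j, g i j

theorem pairProd_congr {ι : Type*} [LinearOrder ι] {s : Finset ι} {g h : ι → ι → ℂ}
    (H : ∀ i ∈ s, ∀ j ∈ s, i < j → g i j = h i j) : pairProd s g = pairProd s h :=
  prod_congr rfl fun i hi => prod_congr rfl fun j hj =>
    H i hi j (mem_filter.1 hj).1 (mem_filter.1 hj).2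

theorem pairProd_mul {ι : Type*} [LinearOrder ι] (s : Finset ι) (g h : ι → ι → ℂ) :
    pairProd s (fun i j => g i j * h i j) = pairProd s g * pairProd s h := by
  simp only [pairProd, prod_mul_distrib]

theorem pairProd_div {ι : Type*} [LinearOrder ι] (s : Finset ι) (g h : ι → ι → ℂ) :
    pairProd s (fun i j => g i j / h i j) = pairProd s g / pairProd s h := by
  simp only [pairProd, prod_div_distrib]

/-- For symmetric `g` the order of the indices is immaterial, so any index can be split off, not
only an extreme one. This is why `edgeWeight` below is made symmetric. -/
theorem pairProd_insert {ι : Type*} [LinearOrder ι] {s : Finset ι} {b : ι} (hb : b ∉ s)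
    {g : ι → ι → ℂ} (hg : ∀ i j, g i j = g j i) :
    pairProd (insert b s) g = (∏ d ∈ s, g b d) * pairProd s g := by
  have h1 : ∀ i ∈ s, ∏ j ∈ insert b s with i < j, g i j =
      (if i < b then g i b else 1) * ∏ j ∈ s with i < j, g i j := by
    intro i hi
    rw [filter_insert]
    split_ifs with h
    · rw [prod_insert (by simp [hb])]
    · rw [one_mul]
  have h2 : ∏ j ∈ insert b s with b < j, g b j = ∏ d ∈ s, if b < d then g b d else 1 := by
    rw [filter_insert, if_neg (lt_irrefl b), prod_filter]
  rw [pairProd, prod_insert hb, prod_congr rfl h1, h2, prod_mul_distrib, ← mul_assoc,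
    ← prod_mul_distrib, pairProd]
  congr 1
  refine prod_congr rfl fun d hd => ?_
  have hne : b ≠ d := fun h => hb (h ▸ hd)
  rcases lt_or_gt_of_ne hne with h | h
  · rw [if_pos h, if_neg h.not_gt, mul_one]
  · rw [if_neg h.not_gt, if_pos h, one_mul, hg]

theorem pairProd_erase {ι : Type*} [LinearOrder ι] {s : Finset ι} {b : ι} (hb : b ∈ s)
    {g : ι → ι → ℂ} (hg : ∀ i j, g i j = g j i) :
    pairProd s g = (∏ d ∈ s.erase b, g b d) * pairProd (s.erase b) g := by
  rw [← pairProd_insert (notMem_erase b s) hg, insert_erase hb]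

theorem pairProd_map {ι κ : Type*} [LinearOrder ι] [LinearOrder κ] (e : ι ↪ κ) (s : Finset ι)
    {g : κ → κ → ℂ} (hg : ∀ i j, g i j = g j i) :
    pairProd (s.map e) g = pairProd s fun i j => g (e i) (e j) := by
  induction s using Finset.induction_on with
  | empty => simp [pairProd]
  | insert b s hb ih =>
    rw [map_insert, pairProd_insert (by simpa using hb) hg, ih,
      pairProd_insert hb fun i j => hg _ _, prod_map]

theorem pairProd_union {ι : Type*} [LinearOrder ι] {s t : Finset ι} (hst : Disjoint s t)
    {g : ι → ι → ℂ} (hg : ∀ i j, g i j = g j i) :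
    pairProd (s ∪ t) g = pairProd s g * pairProd t g * ∏ i ∈ s, ∏ j ∈ t, g i j := by
  induction s using Finset.induction_on with
  | empty => simp [pairProd]
  | insert b s hb ih =>
    rw [disjoint_insert_left] at hst
    rw [insert_union, pairProd_insert (by simp [hb, hst.1]) hg, ih hst.2, pairProd_insert hb hg,
      prod_insert hb, prod_union hst.2]
    ring

theorem pairProd_two {ι : Type*} [LinearOrder ι] {s : Finset ι} {b c : ι} (hb : b ∈ s) (hc : c ∈ s)
    (hbc : b ≠ c) {g : ι → ι → ℂ} (hg : ∀ i j, g i j = g j i) :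
    pairProd s g = g b c * (∏ d ∈ (s.erase b).erase c, g b d * g c d) *
      pairProd ((s.erase b).erase c) g := by
  have hc' : c ∈ s.erase b := mem_erase.2 ⟨hbc.symm, hc⟩
  rw [pairProd_erase hb hg, pairProd_erase hc' hg, ← mul_prod_erase _ _ hc', prod_mul_distrib]
  ring

/-! ### Rankings and their weights -/

/-- The weight of a pair of variables with ranks `a`, `b`, the left one first: rank `a < l` is the
`a`-th entry of the tuple, rank `l` stands for the set, rank `l + 1` for all other indices. -/
def pairWeight (p q : ℝ) (l a b : ℕ) (ξ ξ' : ℂ) : ℂ :=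
  if l < b then 1 else if l < a then (p / q : ℂ) else
  if a < b then 1 else if b < a then -f p q ξ' ξ / f p q ξ ξ' else p * (ξ' - ξ) / f p q ξ ξ'

/-- The weight of the unordered pair `{i, j}`. -/
def edgeWeight {N : ℕ} (p q : ℝ) {l : ℕ} (κ : Fin N → Fin (l + 2)) (ξ : Fin N → ℂ) (i j : Fin N) :
    ℂ :=
  if i < j then pairWeight p q l (κ i) (κ j) (ξ i) (ξ j)
  else pairWeight p q l (κ j) (κ i) (ξ j) (ξ i)

theorem edgeWeight_comm {N : ℕ} (p q : ℝ) {l : ℕ} (κ : Fin N → Fin (l + 2)) (ξ : Fin N → ℂ)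
    (i j : Fin N) : edgeWeight p q κ ξ i j = edgeWeight p q κ ξ j i := by
  unfold edgeWeight
  rcases lt_trichotomy i j with h | rfl | h
  · rw [if_pos h, if_neg h.not_gt]
  · rfl
  · rw [if_neg h.not_gt, if_pos h]

/-- The weight of one variable of rank `a` at site `y`. -/
def siteWeight (p q : ℝ) (l : ℕ) (X : ℕ → ℤ) (a : ℕ) (ξ : ℂ) (y : ℤ) (t : ℝ) : ℂ :=
  if l < a then 1 else
    ξ ^ (X a - y) * (if a = l then (1 - ξ)⁻¹ else 1) * Complex.exp (ε p q ξ * t)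

/-- The contribution of an assignment `κ` of ranks. -/
def term {N : ℕ} (p q : ℝ) {l : ℕ} (X : ℕ → ℤ) (κ : Fin N → Fin (l + 2)) (y : Fin N → ℤ) (t : ℝ)
    (ξ : Fin N → ℂ) : ℂ :=
  pairProd univ (edgeWeight p q κ ξ) * ∏ i, siteWeight p q l X (κ i) (ξ i) (y i) t

/-- Every rank below `l` is taken exactly once. -/
def IsRanking {N l : ℕ} (κ : Fin N → Fin (l + 2)) : Prop :=
  ∀ a : Fin (l + 2), (a : ℕ) < l → ∃! i, κ i = a

theorem IsRanking.comp_perm {N l : ℕ} {κ : Fin N → Fin (l + 2)} (h : IsRanking κ)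
    (π : Equiv.Perm (Fin N)) : IsRanking (κ ∘ π) := by
  intro a ha
  obtain ⟨i, hi, hu⟩ := h a ha
  refine ⟨π.symm i, by simpa using hi, fun j hj => ?_⟩
  rw [← hu (π j) hj, Equiv.symm_apply_apply]

theorem IsRanking.injOn {N l : ℕ} {κ : Fin N → Fin (l + 2)} (h : IsRanking κ) {i j : Fin N}
    (hi : (κ i : ℕ) < l) (hij : κ i = κ j) : i = j :=
  (h (κ i) hi).unique rfl hij.symm

/-! ### Identities for the weights of one pair -/

section weights

variable {p q : ℝ} {l : ℕ}

/-- An index of rank `d` standing between two indices with the same variable `ζ` cannot tell which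
of the two has rank `a` and which `a'`. -/
theorem pairWeight_around {a a' d : ℕ} (ha : a ≤ l) (ha' : a' ≤ l) {ζ ξ : ℂ}
    (h : f p q ζ ξ ≠ 0) (h' : f p q ξ ζ ≠ 0) :
    pairWeight p q l a d ζ ξ * pairWeight p q l d a' ξ ζ =
      pairWeight p q l a' d ζ ξ * pairWeight p q l d a ξ ζ := by
  by_cases hd : l < d
  · simp [pairWeight, hd, ha.not_gt, ha'.not_gt]
  · simp only [pairWeight, hd, ha.not_gt, ha'.not_gt, if_false]
    rcases lt_trichotomy a d with h1 | h1 | h1 <;> rcases lt_trichotomy a' d with h2 | h2 | h2 <;>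
      simp [h1, h2, h1.not_gt, h2.not_gt] <;> field_simp <;> ring

/-- At coinciding variables the weight is `1`, `-1` or `0` according to the order of the two ranks.
-/
theorem pairWeight_swap_of_eq {a b : ℕ} (ha : a ≤ l) (hb : b ≤ l) {ζ : ℂ} (h : f p q ζ ζ ≠ 0) :
    pairWeight p q l b a ζ ζ = -pairWeight p q l a b ζ ζ := by
  simp only [pairWeight, ha.not_gt, hb.not_gt, if_false]
  rcases lt_trichotomy a b with h1 | h1 | h1 <;> simp [h1, h1.not_gt, h]

theorem siteWeight_succ (X : ℕ → ℤ) (a : ℕ) {ξ : ℂ} (hξ : ξ ≠ 0) (y : ℤ) (t : ℝ) :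
    siteWeight p q l X a ξ (y + 1) t =
      siteWeight p q l X a ξ y t * (if l < a then 1 else ξ⁻¹) := by
  unfold siteWeight
  split_ifs
  · simp
  all_goals
    rw [show X a - (y + 1) = X a - y - 1 by ring, zpow_sub_one₀ hξ]
    ring

/-- If both indices are present, the boundary expression produces the factor `f p q ξ ξ' * (ξ⁻¹ *
ξ'⁻¹)`, and the weights are designed so that weight times `f` is antisymmetric. If one is absent,
the expression is a multiple of `1 - ξ⁻¹` with coefficient `-p` or `q` depending on the side, which
the weight `p / q` balances. If both are absent it is `p + q - 1 = 0`. -/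
theorem pairWeight_boundary (hq : (q : ℂ) ≠ 0) (hpq : (p : ℂ) + q = 1) (X : ℕ → ℤ) (a b : ℕ)
    {ξ ξ' : ℂ} (hξ : ξ ≠ 0) (hξ' : ξ' ≠ 0) (h : f p q ξ ξ' ≠ 0) (h' : f p q ξ' ξ ≠ 0)
    (y : ℤ) (t : ℝ) :
    pairWeight p q l a b ξ ξ' *
      (p * (siteWeight p q l X a ξ (y + 1) t * siteWeight p q l X b ξ' (y + 1) t) +
        q * (siteWeight p q l X a ξ y t * siteWeight p q l X b ξ' y t) -
        siteWeight p q l X a ξ y t * siteWeight p q l X b ξ' (y + 1) t) =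
    -(pairWeight p q l b a ξ' ξ *
      (p * (siteWeight p q l X b ξ' (y + 1) t * siteWeight p q l X a ξ (y + 1) t) +
        q * (siteWeight p q l X b ξ' y t * siteWeight p q l X a ξ y t) -
        siteWeight p q l X b ξ' y t * siteWeight p q l X a ξ (y + 1) t)) := by
  rw [siteWeight_succ X a hξ, siteWeight_succ X b hξ']
  generalize siteWeight p q l X a ξ y t = u
  generalize siteWeight p q l X b ξ' y t = v
  have e1 : (p : ℂ) * (ξ⁻¹ * ξ'⁻¹) + q - ξ'⁻¹ = f p q ξ ξ' * (ξ⁻¹ * ξ'⁻¹) := by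
    unfold f; field_simp
  have e2 : (p : ℂ) * (ξ'⁻¹ * ξ⁻¹) + q - ξ⁻¹ = f p q ξ' ξ * (ξ⁻¹ * ξ'⁻¹) := by
    unfold f; field_simp
  have hp : (p : ℂ) = 1 - q := by rw [← hpq]; ring
  by_cases ha : l < a <;> by_cases hb : l < b
  · simp only [ha, hb, if_true]
    linear_combination (pairWeight p q l a b ξ ξ' + pairWeight p q l b a ξ' ξ) * u * v * hpq
  · have w1 : pairWeight p q l a b ξ ξ' = p / q := by simp [pairWeight, ha, hb]
    have w2 : pairWeight p q l b a ξ' ξ = 1 := by simp [pairWeight, ha]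
    simp only [ha, hb, if_true, if_false, w1, w2, hp]
    field_simp
    ring
  · have w1 : pairWeight p q l a b ξ ξ' = 1 := by simp [pairWeight, hb]
    have w2 : pairWeight p q l b a ξ' ξ = p / q := by simp [pairWeight, ha, hb]
    simp only [ha, hb, if_true, if_false, w1, w2, hp]
    field_simp
    ring
  · have key : pairWeight p q l a b ξ ξ' * f p q ξ ξ' =
        -(pairWeight p q l b a ξ' ξ * f p q ξ' ξ) := by
      simp only [pairWeight, ha, hb, if_false]
      rcases lt_trichotomy a b with h1 | h1 | h1
      · simp [h1, h1.not_gt]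
        field_simp
      · simp [h1]
        field_simp
        ring
      · simp [h1, h1.not_gt]
        field_simp
    simp only [ha, hb, if_false]
    linear_combination pairWeight p q l a b ξ ξ' * u * v * e1 +
      pairWeight p q l b a ξ' ξ * u * v * e2 + u * v * (ξ⁻¹ * ξ'⁻¹) * key

end weights

/-! ### Exchanging two indices in a ranking -/

section swap

variable {N l : ℕ} {p q : ℝ}

/-- Only the ranks are exchanged here, at a point where the two variables agree. The pair `{b, c}`
yields the sign; every third index sees the same product before and after, by `pairWeight_around`
when it lies between `b` and `c`. -/
theorem pairProd_edgeWeight_swap {κ : Fin N → Fin (l + 2)} {ξ : Fin N → ℂ} {b c : Fin N}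
    (hbc : b ≠ c) (hb : (κ b : ℕ) ≤ l) (hc : (κ c : ℕ) ≤ l) (hξ : ξ b = ξ c)
    {T : Finset (Fin N)} (hbT : b ∈ T) (hcT : c ∈ T)
    (hf : ∀ i ∈ T, ∀ j ∈ T, f p q (ξ i) (ξ j) ≠ 0) :
    pairProd T (edgeWeight p q (κ ∘ Equiv.swap b c) ξ) = -pairProd T (edgeWeight p q κ ξ) := by
  rw [pairProd_two hbT hcT hbc (edgeWeight_comm p q _ ξ),
    pairProd_two hbT hcT hbc (edgeWeight_comm p q κ ξ), ← neg_mul, ← neg_mul]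
  have hκ : ∀ d, d ≠ b → d ≠ c → (κ ∘ Equiv.swap b c) d = κ d := fun d h1 h2 => by
    simp [Equiv.swap_apply_of_ne_of_ne h1 h2]
  have hκb : (κ ∘ Equiv.swap b c) b = κ c := by simp
  have hκc : (κ ∘ Equiv.swap b c) c = κ b := by simp
  congr 1
  · congr 1
    · have hz := hf c hcT c hcT
      unfold edgeWeight
      rw [hκb, hκc, hξ]
      split_ifs
      · exact pairWeight_swap_of_eq hb hc hz
      · exact pairWeight_swap_of_eq hc hb hz
    · refine prod_congr rfl fun d hd => ?_
      simp only [mem_erase] at hd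
      obtain ⟨hdc, hdb, hdT⟩ := hd
      have h1 := hf c hcT d hdT
      have h2 := hf d hdT c hcT
      unfold edgeWeight
      rw [hκb, hκc, hκ d hdb hdc, hξ]
      split_ifs
      · ring
      · rw [pairWeight_around hc hb h1 h2]
      · rw [mul_comm, pairWeight_around hb hc h1 h2, mul_comm]
      · ring
  · refine pairProd_congr fun i hi j hj _ => ?_
    simp only [mem_erase] at hi hj
    unfold edgeWeight
    rw [hκ i hi.2.1 hi.1, hκ j hj.2.1 hj.1]

/-- No third index lies between neighbours, so moving rank and variable together from `i'` to `i`
does not change the order relative to `d`. -/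
theorem edgeWeight_adjacent {κ : Fin N → Fin (l + 2)} {ξ : Fin N → ℂ} {i i' d : Fin N}
    (hi : (i' : ℕ) = i + 1) (h1 : d ≠ i) (h2 : d ≠ i') :
    edgeWeight p q (κ ∘ Equiv.swap i i') (ξ ∘ Equiv.swap i i') i d = edgeWeight p q κ ξ i' d := by
  have hd : Equiv.swap i i' d = d := Equiv.swap_apply_of_ne_of_ne h1 h2
  have : i < d ↔ i' < d := by
    rw [Fin.lt_def, Fin.lt_def]
    have := Fin.val_ne_of_ne h2
    omega
  simp only [edgeWeight, Function.comp_apply, Equiv.swap_apply_left, hd, this]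

theorem edgeWeight_adjacent' {κ : Fin N → Fin (l + 2)} {ξ : Fin N → ℂ} {i i' d : Fin N}
    (hi : (i' : ℕ) = i + 1) (h1 : d ≠ i) (h2 : d ≠ i') :
    edgeWeight p q (κ ∘ Equiv.swap i i') (ξ ∘ Equiv.swap i i') i' d = edgeWeight p q κ ξ i d := by
  have h := edgeWeight_adjacent (p := p) (q := q) (κ := κ ∘ Equiv.swap i i')
    (ξ := ξ ∘ Equiv.swap i i') hi h1 h2
  rw [← h, Function.comp_assoc, Function.comp_assoc]
  simp [← Equiv.coe_trans]

/-- The boundary condition of the Bethe ansatz, before integration. -/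
theorem term_boundary (hq : (q : ℂ) ≠ 0) (hpq : (p : ℂ) + q = 1) (X : ℕ → ℤ)
    (κ : Fin N → Fin (l + 2)) {ξ : Fin N → ℂ} {i i' : Fin N} (hi : (i' : ℕ) = i + 1)
    (hξ : ∀ j, ξ j ≠ 0) (hf : ∀ j k, f p q (ξ j) (ξ k) ≠ 0) (y : Fin N → ℤ) (hy : y i' = y i + 1)
    (t : ℝ) :
    p * term p q X (κ ∘ Equiv.swap i i') (Function.update y i (y i + 1)) t (ξ ∘ Equiv.swap i i') +
      q * term p q X (κ ∘ Equiv.swap i i') (Function.update y i' (y i' - 1)) t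
        (ξ ∘ Equiv.swap i i') -
      term p q X (κ ∘ Equiv.swap i i') y t (ξ ∘ Equiv.swap i i') =
    -(p * term p q X κ (Function.update y i (y i + 1)) t ξ +
      q * term p q X κ (Function.update y i' (y i' - 1)) t ξ - term p q X κ y t ξ) := by
  have hne : i ≠ i' := fun h => by rw [← h] at hi; omega
  have hlt : i < i' := by rw [Fin.lt_def]; omega
  have hi' : i' ∈ univ.erase i := mem_erase.2 ⟨hne.symm, mem_univ _⟩
  -- Isolates the pair of neighbours. The remaining factor is shared by all six terms, which reduces
  -- the claim to `pairWeight_boundary`.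
  have split : ∀ (κ : Fin N → Fin (l + 2)) (ξ : Fin N → ℂ) (y : Fin N → ℤ),
      term p q X κ y t ξ =
      (pairWeight p q l (κ i) (κ i') (ξ i) (ξ i') *
        (siteWeight p q l X (κ i) (ξ i) (y i) t * siteWeight p q l X (κ i') (ξ i') (y i') t)) *
      (((∏ d ∈ (univ.erase i).erase i', edgeWeight p q κ ξ i d * edgeWeight p q κ ξ i' d) *
        pairProd ((univ.erase i).erase i') (edgeWeight p q κ ξ)) *
        ∏ d ∈ (univ.erase i).erase i', siteWeight p q l X (κ d) (ξ d) (y d) t) := by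
    intro κ ξ y
    rw [term, pairProd_two (mem_univ i) (mem_univ i') hne (edgeWeight_comm p q κ ξ),
      ← mul_prod_erase _ _ (mem_univ i), ← mul_prod_erase _ _ hi']
    rw [show edgeWeight p q κ ξ i i' = pairWeight p q l (κ i) (κ i') (ξ i) (ξ i') by
      rw [edgeWeight, if_pos hlt]]
    ring
  have rest : ∀ y' : Fin N → ℤ, (∀ d, d ≠ i → d ≠ i' → y' d = y d) →
      ∀ (κ : Fin N → Fin (l + 2)) (ξ : Fin N → ℂ),
      ∏ d ∈ (univ.erase i).erase i', siteWeight p q l X (κ d) (ξ d) (y' d) t =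
      ∏ d ∈ (univ.erase i).erase i', siteWeight p q l X (κ d) (ξ d) (y d) t := by
    intro y' h κ ξ
    refine prod_congr rfl fun d hd => ?_
    simp only [mem_erase] at hd
    rw [h d hd.2.1 hd.1]
  have common :
      (((∏ d ∈ (univ.erase i).erase i',
          edgeWeight p q (κ ∘ Equiv.swap i i') (ξ ∘ Equiv.swap i i') i d *
          edgeWeight p q (κ ∘ Equiv.swap i i') (ξ ∘ Equiv.swap i i') i' d) *
        pairProd ((univ.erase i).erase i')
          (edgeWeight p q (κ ∘ Equiv.swap i i') (ξ ∘ Equiv.swap i i'))) *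
        ∏ d ∈ (univ.erase i).erase i', siteWeight p q l X ((κ ∘ Equiv.swap i i') d)
          ((ξ ∘ Equiv.swap i i') d) (y d) t) =
      (((∏ d ∈ (univ.erase i).erase i', edgeWeight p q κ ξ i d * edgeWeight p q κ ξ i' d) *
        pairProd ((univ.erase i).erase i') (edgeWeight p q κ ξ)) *
        ∏ d ∈ (univ.erase i).erase i', siteWeight p q l X (κ d) (ξ d) (y d) t) := by
    congr 1
    · congr 1
      · refine prod_congr rfl fun d hd => ?_
        simp only [mem_erase] at hd
        rw [edgeWeight_adjacent hi hd.2.1 hd.1, edgeWeight_adjacent' hi hd.2.1 hd.1, mul_comm]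
      · refine pairProd_congr fun j hj k hk _ => ?_
        simp only [mem_erase] at hj hk
        simp only [edgeWeight, Function.comp_apply, Equiv.swap_apply_of_ne_of_ne hj.2.1 hj.1,
          Equiv.swap_apply_of_ne_of_ne hk.2.1 hk.1]
    · refine prod_congr rfl fun d hd => ?_
      simp only [mem_erase] at hd
      simp only [Function.comp_apply, Equiv.swap_apply_of_ne_of_ne hd.2.1 hd.1]
  have r1 := rest (Function.update y i (y i + 1)) fun d h1 _ => by simp [h1]
  have r2 := rest (Function.update y i' (y i' - 1)) fun d _ h2 => by simp [h2]
  simp only [split, r1, r2, common]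
  have key := pairWeight_boundary (l := l) hq hpq X (κ i') (κ i) (hξ i') (hξ i) (hf i' i) (hf i i')
    (y i) t
  simp only [Function.comp_apply, Equiv.swap_apply_left, Equiv.swap_apply_right,
    Function.update_self, Function.update_of_ne hne, Function.update_of_ne hne.symm, hy,
    add_sub_cancel_right]
  linear_combination (((∏ d ∈ (univ.erase i).erase i',
    edgeWeight p q κ ξ i d * edgeWeight p q κ ξ i' d) *
        pairProd ((univ.erase i).erase i') (edgeWeight p q κ ξ)) *
        ∏ d ∈ (univ.erase i).erase i', siteWeight p q l X (κ d) (ξ d) (y d) t) * key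

end swap

/-! ### Averages over tori -/

instance fact_two_pi_pos : Fact (0 < 2 * Real.pi) := ⟨Real.two_pi_pos⟩

/-- The circle of angles. -/
abbrev Angle : Type := AddCircle (2 * Real.pi)

/-- The uniform probability measure on tuples of angles. -/
abbrev angleMeasure (N : ℕ) : Measure (Fin N → Angle) :=
  Measure.pi fun _ => AddCircle.haarAddCircle

/-- The point with given radii and angles. -/
def torusPoint {N : ℕ} (ρ : Fin N → ℝ) (θ : Fin N → Angle) : Fin N → ℂ :=
  fun i => ρ i * (AddCircle.toCircle (θ i) : ℂ)

/-- The average of a function over the torus with radii `ρ`. -/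
def torusAvg {N : ℕ} (ρ : Fin N → ℝ) (F : (Fin N → ℂ) → ℂ) : ℂ :=
  ∫ θ, F (torusPoint ρ θ) ∂angleMeasure N

/-- The polydomain outside the circle of radius `r` in every variable. -/
def outer (N : ℕ) (r : ℝ) : Set (Fin N → ℂ) := {ξ | ∀ i, r < ‖ξ i‖}

theorem coe_toCircle_mk (x : ℝ) :
    (AddCircle.toCircle (x : Angle) : ℂ) = Complex.exp (x * Complex.I) := by
  rw [AddCircle.toCircle_apply_mk, Circle.coe_exp, div_self Real.two_pi_pos.ne', one_mul]

theorem integral_angle_eq_circleAverage (ψ : ℂ → ℂ) (ρ : ℝ) :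
    ∫ u : Angle, ψ (ρ * (AddCircle.toCircle u : ℂ)) ∂AddCircle.haarAddCircle =
      Real.circleAverage ψ 0 ρ := by
  have h1 := AddCircle.intervalIntegral_preimage (2 * Real.pi) 0
    (fun u : Angle => ψ (ρ * (AddCircle.toCircle u : ℂ)))
  rw [AddCircle.volume_eq_smul_haarAddCircle, integral_smul_measure,
    ENNReal.toReal_ofReal Real.two_pi_pos.le, zero_add] at h1
  rw [Real.circleAverage_def, eq_inv_smul_iff₀ Real.two_pi_pos.ne', ← h1]
  refine intervalIntegral.integral_congr fun x _ => ?_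
  simp only [coe_toCircle_mk, circleMap, zero_add]

theorem norm_torusPoint {N : ℕ} (ρ : Fin N → ℝ) (θ : Fin N → Angle) (i : Fin N) :
    ‖torusPoint ρ θ i‖ = |ρ i| := by
  rw [torusPoint, norm_mul, Circle.norm_coe, mul_one, Complex.norm_real, Real.norm_eq_abs]

theorem torusPoint_mem_outer {N : ℕ} {ρ : Fin N → ℝ} {r : ℝ} (hρ : ∀ i, r < ρ i)
    (θ : Fin N → Angle) : torusPoint ρ θ ∈ outer N r := fun i => by
  rw [norm_torusPoint]
  exact (hρ i).trans_le (le_abs_self _)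

theorem continuous_torusPoint {N : ℕ} (ρ : Fin N → ℝ) : Continuous (torusPoint ρ) := by
  unfold torusPoint
  refine continuous_pi fun i => ?_
  exact continuous_const.mul
    (continuous_subtype_val.comp (AddCircle.continuous_toCircle.comp (continuous_apply i)))

theorem continuous_comp_torusPoint {N : ℕ} {ρ : Fin N → ℝ} {r : ℝ} (hρ : ∀ i, r < ρ i)
    {F : (Fin N → ℂ) → ℂ} (hF : ContinuousOn F (outer N r)) :
    Continuous fun θ => F (torusPoint ρ θ) :=
  hF.comp_continuous (continuous_torusPoint ρ) (torusPoint_mem_outer hρ)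

theorem integrable_angle {N : ℕ} {G : (Fin N → Angle) → ℂ} (hG : Continuous G) :
    Integrable G (angleMeasure N) :=
  hG.integrable_of_hasCompactSupport (HasCompactSupport.of_compactSpace _)

/-- Resampling one coordinate of a product measure leaves its law unchanged. This makes Fubini in a
single variable available without splitting the index set: the old value of that coordinate is
simply integrated out. -/
theorem measurePreserving_update {N : ℕ} (i : Fin N) :
    MeasurePreserving (fun x : (Fin N → Angle) × Angle => Function.update x.1 i x.2)
      ((angleMeasure N).prod AddCircle.haarAddCircle) (angleMeasure N) := by
  have hm : Measurable fun x : (Fin N → Angle) × Angle => Function.update x.1 i x.2 := by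
    refine measurable_pi_lambda _ fun j => ?_
    by_cases h : j = i
    · subst h; simpa using measurable_snd
    · simp only [Function.update_of_ne h]
      exact (measurable_pi_apply j).comp measurable_fst
  refine ⟨hm, (Measure.pi_eq fun s hs => ?_).symm⟩
  rw [Measure.map_apply hm (MeasurableSet.univ_pi hs)]
  have : (fun x : (Fin N → Angle) × Angle => Function.update x.1 i x.2) ⁻¹' Set.univ.pi s =
      (Set.univ.pi (Function.update s i Set.univ)) ×ˢ s i := by
    ext ⟨θ, u⟩
    simp only [Set.mem_preimage, Set.mem_univ_pi, Set.mem_prod]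
    constructor
    · intro h
      refine ⟨fun j => ?_, by simpa using h i⟩
      by_cases hj : j = i
      · subst hj; simp
      · simpa [Function.update_of_ne hj] using h j
    · rintro ⟨h, hu⟩ j
      by_cases hj : j = i
      · subst hj; simpa using hu
      · simpa [Function.update_of_ne hj] using h j
  rw [this, Measure.prod_prod, Measure.pi_pi, ← mul_prod_erase _ _ (mem_univ i),
    ← mul_prod_erase univ (fun j => AddCircle.haarAddCircle (s j)) (mem_univ i),
    Function.update_self, measure_univ, one_mul, mul_comm]
  congr 1
  refine prod_congr rfl fun j hj => ?_
  rw [Function.update_of_ne (ne_of_mem_erase hj)]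

theorem integral_angle_update {N : ℕ} (i : Fin N) {G : (Fin N → Angle) → ℂ} (hG : Continuous G) :
    ∫ θ, G θ ∂angleMeasure N =
      ∫ θ, ∫ u, G (Function.update θ i u) ∂AddCircle.haarAddCircle ∂angleMeasure N := by
  have h := measurePreserving_update i
  rw [← h.map_eq, integral_map h.measurable.aemeasurable hG.aestronglyMeasurable, h.map_eq,
    integral_prod]
  have : Continuous fun x : (Fin N → Angle) × Angle => G (Function.update x.1 i x.2) :=
    hG.comp (continuous_fst.update i continuous_snd)
  exact this.integrable_of_hasCompactSupport (HasCompactSupport.of_compactSpace _)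

theorem torusPoint_update {N : ℕ} (ρ : Fin N → ℝ) (θ : Fin N → Angle) (i : Fin N) (u : Angle) :
    torusPoint ρ (Function.update θ i u) =
      Function.update (torusPoint ρ θ) i (ρ i * (AddCircle.toCircle u : ℂ)) := by
  ext j
  by_cases h : j = i
  · subst h; simp [torusPoint]
  · simp [torusPoint, Function.update_of_ne h]

theorem torusAvg_eq_integral_circleAverage {N : ℕ} {ρ : Fin N → ℝ} {r : ℝ} (hρ : ∀ i, r < ρ i)
    {F : (Fin N → ℂ) → ℂ} (hF : ContinuousOn F (outer N r)) (i : Fin N) :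
    torusAvg ρ F = ∫ θ, Real.circleAverage
      (fun z => F (Function.update (torusPoint ρ θ) i z)) 0 (ρ i) ∂angleMeasure N := by
  rw [torusAvg, integral_angle_update i (continuous_comp_torusPoint hρ hF)]
  refine integral_congr_ae (Eventually.of_forall fun θ => ?_)
  simp only [torusPoint_update]
  exact integral_angle_eq_circleAverage (fun z => F (Function.update (torusPoint ρ θ) i z)) (ρ i)

theorem torusAvg_eq_zero {N : ℕ} {ρ : Fin N → ℝ} {r : ℝ} (hρ : ∀ i, r < ρ i)
    {F : (Fin N → ℂ) → ℂ} (hF : ContinuousOn F (outer N r)) (i : Fin N)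
    (h : ∀ ξ ∈ outer N r, Real.circleAverage (fun z => F (Function.update ξ i z)) 0 (ρ i) = 0) :
    torusAvg ρ F = 0 := by
  rw [torusAvg_eq_integral_circleAverage hρ hF i,
    integral_congr_ae (Eventually.of_forall fun θ => h _ (torusPoint_mem_outer hρ θ))]
  simp

/-- Integrating first over one variable while the product of two variables is kept fixed. -/
theorem torusAvg_eq_zero_of_shear {N : ℕ} {ρ : Fin N → ℝ} (hpos : ∀ i, 0 < ρ i)
    {F : (Fin N → ℂ) → ℂ} (hG : Continuous fun θ => F (torusPoint ρ θ)) {o b : Fin N}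
    (hob : o ≠ b)
    (h : ∀ ξ : Fin N → ℂ, (∀ i, ‖ξ i‖ = ρ i) → ∀ s : ℂ, ‖s‖ = ρ o * ρ b →
      Real.circleAverage (fun z => F (Function.update (Function.update ξ b z) o (s / z))) 0 (ρ b)
        = 0) :
    torusAvg ρ F = 0 := by
  -- After this shear the angle of `o` is that of the product of the two variables, so integrating
  -- over `θ b` keeps the product fixed. Translation invariance in `θ o` shows that the shear
  -- preserves the integral.
  have hS : Continuous fun θ : Fin N → Angle => Function.update θ o (θ o - θ b) :=
    continuous_id.update o ((continuous_apply o).sub (continuous_apply b))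
  have hGS : Continuous fun θ => F (torusPoint ρ (Function.update θ o (θ o - θ b))) := hG.comp hS
  have e1 : torusAvg ρ F =
      ∫ θ, F (torusPoint ρ (Function.update θ o (θ o - θ b))) ∂angleMeasure N := by
    rw [torusAvg, integral_angle_update o hG, integral_angle_update o hGS]
    refine integral_congr_ae (Eventually.of_forall fun θ => ?_)
    simp only [Function.update_idem, Function.update_self,
      Function.update_of_ne hob.symm]
    exact (integral_sub_right_eq_self (μ := AddCircle.haarAddCircle)
      (fun u => F (torusPoint ρ (Function.update θ o u))) (θ b)).symm
  rw [e1, integral_angle_update b hGS]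
  refine integral_eq_zero_of_ae (Eventually.of_forall fun θ => ?_)
  have := h (torusPoint ρ θ) (fun i => by rw [norm_torusPoint, abs_of_pos (hpos i)])
    (ρ b * torusPoint ρ θ o) (by
      rw [norm_mul, norm_torusPoint, abs_of_pos (hpos o), Complex.norm_real, Real.norm_eq_abs,
        abs_of_pos (hpos b), mul_comm])
  rw [← integral_angle_eq_circleAverage] at this
  rw [Pi.zero_apply, ← this]
  refine integral_congr_ae (Eventually.of_forall fun u => ?_)
  simp only [Function.update_self, Function.update_of_ne hob, torusPoint_update]
  congr 2
  have hb : (ρ b : ℂ) ≠ 0 := by exact_mod_cast (hpos b).ne'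
  rw [torusPoint, sub_eq_add_neg, AddCircle.toCircle_add, AddCircle.toCircle_neg, Circle.coe_mul,
    Circle.coe_inv]
  field_simp

theorem torusAvg_congr {N : ℕ} {ρ : Fin N → ℝ} {r : ℝ} (hρ : ∀ i, r < ρ i)
    {F G : (Fin N → ℂ) → ℂ} (h : ∀ ξ ∈ outer N r, (∀ i, ‖ξ i‖ = |ρ i|) → F ξ = G ξ) :
    torusAvg ρ F = torusAvg ρ G :=
  integral_congr_ae (Eventually.of_forall fun θ =>
    h _ (torusPoint_mem_outer hρ θ) (norm_torusPoint ρ θ))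

theorem torusAvg_sum {N : ℕ} {ι : Type*} {ρ : Fin N → ℝ} (s : Finset ι)
    {F : ι → (Fin N → ℂ) → ℂ} (hF : ∀ i ∈ s, Continuous fun θ => F i (torusPoint ρ θ)) :
    torusAvg ρ (fun ξ => ∑ i ∈ s, F i ξ) = ∑ i ∈ s, torusAvg ρ (F i) :=
  integral_finsetSum s fun i hi => integrable_angle (hF i hi)

theorem torusAvg_add {N : ℕ} {ρ : Fin N → ℝ} {F G : (Fin N → ℂ) → ℂ}
    (hF : Continuous fun θ => F (torusPoint ρ θ)) (hG : Continuous fun θ => G (torusPoint ρ θ)) :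
    torusAvg ρ (fun ξ => F ξ + G ξ) = torusAvg ρ F + torusAvg ρ G :=
  integral_add (integrable_angle hF) (integrable_angle hG)

theorem torusAvg_sub {N : ℕ} {ρ : Fin N → ℝ} {F G : (Fin N → ℂ) → ℂ}
    (hF : Continuous fun θ => F (torusPoint ρ θ)) (hG : Continuous fun θ => G (torusPoint ρ θ)) :
    torusAvg ρ (fun ξ => F ξ - G ξ) = torusAvg ρ F - torusAvg ρ G :=
  integral_sub (integrable_angle hF) (integrable_angle hG)

theorem torusAvg_const_mul {N : ℕ} (ρ : Fin N → ℝ) (c : ℂ) (F : (Fin N → ℂ) → ℂ) :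
    torusAvg ρ (fun ξ => c * F ξ) = c * torusAvg ρ F := integral_const_mul _ _

theorem torusAvg_neg {N : ℕ} (ρ : Fin N → ℝ) (F : (Fin N → ℂ) → ℂ) :
    torusAvg ρ (fun ξ => -F ξ) = -torusAvg ρ F := integral_neg _

/-- Averages over a torus with equal radii do not depend on the order of the variables. -/
theorem torusAvg_comp_perm {N : ℕ} (R : ℝ) (F : (Fin N → ℂ) → ℂ) (π : Equiv.Perm (Fin N)) :
    torusAvg (fun _ => R) (fun ξ => F (ξ ∘ π)) = torusAvg (fun _ => R) F := by
  have hp : MeasurePreserving (MeasurableEquiv.piCongrLeft (fun _ : Fin N => Angle) π.symm)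
      (angleMeasure N) (angleMeasure N) :=
    measurePreserving_piCongrLeft (fun _ : Fin N => (AddCircle.haarAddCircle : Measure Angle)) π.symm
  have h2 := hp.integral_comp (MeasurableEquiv.measurableEmbedding _)
    (fun θ => F (torusPoint (fun _ => R) θ))
  rw [torusAvg, torusAvg, ← h2]
  refine integral_congr_ae (Eventually.of_forall fun θ => ?_)
  simp only
  congr 1
  ext i
  simp only [torusPoint, Function.comp_apply]
  congr 3
  have := MeasurableEquiv.piCongrLeft_apply_apply (β := fun _ => Angle) π.symm θ (π i)
  simpa using this.symm

/-! ### Moving contours, also to infinity -/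

theorem circleAverage_eq_of_differentiableOn {ψ : ℂ → ℂ} {r ρ ρ' : ℝ} (hr : 0 ≤ r) (hρ : r < ρ)
    (hρ' : r < ρ') (hψ : DifferentiableOn ℂ ψ {z | r < ‖z‖}) :
    Real.circleAverage ψ 0 ρ = Real.circleAverage ψ 0 ρ' := by
  wlog h : ρ' ≤ ρ generalizing ρ ρ'
  · exact (this hρ' hρ (le_of_not_ge h)).symm
  have hop : IsOpen {z : ℂ | r < ‖z‖} := isOpen_lt continuous_const continuous_norm
  rw [Real.circleAverage_eq_circleIntegral (hr.trans_lt hρ).ne',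
    Real.circleAverage_eq_circleIntegral (hr.trans_lt hρ').ne']
  congr 1
  refine Complex.circleIntegral_sub_center_inv_smul_eq_of_differentiable_on_annulus_off_countable
    (hr.trans_lt hρ') h Set.countable_empty (hψ.continuousOn.mono ?_) ?_
  · intro z hz
    have := hz.2
    simp only [Metric.mem_ball, dist_zero_right, not_lt] at this
    exact hρ'.trans_le this
  · intro z hz
    have := hz.1.2
    simp only [Metric.mem_closedBall, dist_zero_right, not_le] at this
    exact hψ.differentiableAt (hop.mem_nhds (hρ'.trans this))

theorem differentiableOn_update {N : ℕ} {r : ℝ} {F : (Fin N → ℂ) → ℂ}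
    (hF : DifferentiableOn ℂ F (outer N r)) {ξ : Fin N → ℂ} {i : Fin N}
    (hξ : ∀ j, j ≠ i → r < ‖ξ j‖) :
    DifferentiableOn ℂ (fun z => F (Function.update ξ i z)) {z | r < ‖z‖} := by
  refine hF.comp (fun z _ => ?_) fun z hz j => ?_
  · exact (hasDerivAt_update ξ i z).differentiableAt.differentiableWithinAt
  · by_cases h : j = i
    · subst h; simpa using hz
    · simpa [Function.update_of_ne h] using hξ j h

theorem torusAvg_update_radius {N : ℕ} {ρ : Fin N → ℝ} {r : ℝ} (hr : 0 ≤ r) (hρ : ∀ i, r < ρ i)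
    {F : (Fin N → ℂ) → ℂ} (hF : DifferentiableOn ℂ F (outer N r)) (i : Fin N) {s : ℝ}
    (hs : r < s) : torusAvg (Function.update ρ i s) F = torusAvg ρ F := by
  have hρ' : ∀ j, r < Function.update ρ i s j := fun j => by
    by_cases h : j = i
    · subst h; simpa using hs
    · simpa [Function.update_of_ne h] using hρ j
  rw [torusAvg_eq_integral_circleAverage hρ hF.continuousOn i,
    torusAvg_eq_integral_circleAverage hρ' hF.continuousOn i]
  refine integral_congr_ae (Eventually.of_forall fun θ => ?_)
  have : ∀ z, Function.update (torusPoint (Function.update ρ i s) θ) i z =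
      Function.update (torusPoint ρ θ) i z := by
    intro z
    ext j
    by_cases h : j = i
    · subst h; simp
    · simp [Function.update_of_ne h, torusPoint]
  simp only [this, Function.update_self]
  exact circleAverage_eq_of_differentiableOn hr hs (hρ i)
    (differentiableOn_update hF fun j _ => torusPoint_mem_outer hρ θ j)

/-- The average of a function that is holomorphic outside does not depend on the radii. -/
theorem torusAvg_eq_of_differentiableOn {N : ℕ} {ρ ρ' : Fin N → ℝ} {r : ℝ} (hr : 0 ≤ r)
    (hρ : ∀ i, r < ρ i) (hρ' : ∀ i, r < ρ' i) {F : (Fin N → ℂ) → ℂ}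
    (hF : DifferentiableOn ℂ F (outer N r)) : torusAvg ρ F = torusAvg ρ' F := by
  have key : ∀ s : Finset (Fin N), torusAvg (fun i => if i ∈ s then ρ' i else ρ i) F =
      torusAvg ρ F := by
    intro s
    induction s using Finset.induction_on with
    | empty => simp
    | insert b s hb ih =>
      rw [← ih, ← torusAvg_update_radius (ρ := fun i => if i ∈ s then ρ' i else ρ i) hr
        (fun i => by split_ifs <;> simp [hρ, hρ']) hF b (hρ' b)]
      congr 1
      ext i
      by_cases h : i = b
      · subst h; simp
      · simp [h]
  rw [← key univ]
  simp

/-- The average does not depend on the radius, and on large circles it is small. An average already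
contains the factor $1/z$ of the contour integral, so mere convergence to zero is enough. -/
theorem tendsto_circleAverage_zero {ψ : ℂ → ℂ} {r ρ : ℝ} (hr : 0 ≤ r) (hρ : r < ρ)
    (hψ : DifferentiableOn ℂ ψ {z | r < ‖z‖}) (h0 : Tendsto ψ (Bornology.cobounded ℂ) (𝓝 0)) :
    Real.circleAverage ψ 0 ρ = 0 := by
  by_contra hne
  have hpos : 0 < ‖Real.circleAverage ψ 0 ρ‖ / 2 := by positivity
  have h1 := (Metric.tendsto_nhds.1 h0) _ hpos
  rw [← comap_norm_atTop, eventually_comap] at h1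
  obtain ⟨A, hA⟩ := eventually_atTop.1 h1
  have hB : r < max A ρ := hρ.trans_le (le_max_right _ _)
  rw [circleAverage_eq_of_differentiableOn hr hρ hB hψ] at hne hA hpos
  have hB0 : 0 < max A ρ := hr.trans_lt hB
  have hle : ‖Real.circleAverage ψ 0 (max A ρ)‖ ≤ ‖Real.circleAverage ψ 0 (max A ρ)‖ / 2 := by
    conv_lhs => rw [← integral_angle_eq_circleAverage]
    refine (norm_integral_le_of_norm_le_const (C := ‖Real.circleAverage ψ 0 (max A ρ)‖ / 2)
      (Eventually.of_forall fun u => ?_)).trans_eq (by simp)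
    have := hA (max A ρ) (le_max_left _ _) (↑(max A ρ) * (AddCircle.toCircle u : ℂ)) (by
      rw [norm_mul, Circle.norm_coe, mul_one, Complex.norm_real, Real.norm_eq_abs,
        abs_of_pos hB0])
    rw [dist_zero_right] at this
    exact this.le
  linarith

theorem isBigO_inv_sub (c : ℂ) :
    (fun z : ℂ => (z - c)⁻¹) =O[Bornology.cobounded ℂ] fun z => z⁻¹ := by
  refine Asymptotics.IsBigO.of_bound 2 ?_
  have h : ∀ᶠ z : ℂ in Bornology.cobounded ℂ, 2 * ‖c‖ + 1 ≤ ‖z‖ := by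
    rw [← comap_norm_atTop]
    exact tendsto_comap.eventually (eventually_ge_atTop _)
  filter_upwards [h] with z hz
  have h1 : ‖z‖ - ‖c‖ ≤ ‖z - c‖ := norm_sub_norm_le z c
  have h2 := norm_nonneg c
  rw [norm_inv, norm_inv, ← div_eq_mul_inv, inv_eq_one_div,
    div_le_div_iff₀ (by linarith) (by linarith)]
  linarith

/-- A contour integral vanishes if the integrand has only removable singularities outside the
contour and decays there fast enough. -/
theorem circleAverage_div_prod_eq_zero {r ρ : ℝ} (hr : 0 ≤ r) (hρ : r < ρ) (C : Finset ℂ)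
    (hC : ∀ c ∈ C, ‖c‖ ≠ ρ) {g : ℂ → ℂ} (hg : DifferentiableOn ℂ g {z | r < ‖z‖})
    (h0 : ∀ c ∈ C, r < ‖c‖ → g c = 0)
    (hO : g =o[Bornology.cobounded ℂ] fun z => z ^ #C) :
    Real.circleAverage (fun z => g z / ∏ c ∈ C, (z - c)) 0 ρ = 0 := by
  induction C using Finset.induction_on generalizing g with
  | empty =>
    simp only [prod_empty, div_one]
    refine tendsto_circleAverage_zero hr hρ hg ?_
    simpa [Asymptotics.isLittleO_one_iff] using hO
  | insert c C hc ih =>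
    have hop : IsOpen {z : ℂ | r < ‖z‖} := isOpen_lt continuous_const continuous_norm
    -- A zero of `g` outside the circle of radius `r` is divided out by `dslope`; a point `c` not
    -- outside that circle makes ordinary division harmless.
    obtain ⟨g', hg', hgg'⟩ : ∃ g' : ℂ → ℂ, DifferentiableOn ℂ g' {z | r < ‖z‖} ∧
        ∀ z, z ≠ c → g' z = g z / (z - c) := by
      by_cases hcr : r < ‖c‖
      · refine ⟨dslope g c, (Complex.differentiableOn_dslope (hop.mem_nhds hcr)).2 hg,
          fun z hz => ?_⟩
        rw [dslope_of_ne _ hz, slope_def_field, h0 c (mem_insert_self _ _) hcr, sub_zero]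
      · refine ⟨fun z => g z / (z - c), hg.div (by fun_prop) fun z hz => ?_, fun _ _ => rfl⟩
        rw [sub_ne_zero]
        rintro rfl
        exact hcr hz
    have hcob : ∀ᶠ z : ℂ in Bornology.cobounded ℂ, z ≠ c :=
      Bornology.eventually_ne_cobounded _
    have hz0 : ∀ᶠ z : ℂ in Bornology.cobounded ℂ, z ≠ 0 :=
      Bornology.eventually_ne_cobounded _
    have hO' : g' =o[Bornology.cobounded ℂ] fun z => z ^ #C := by
      refine Asymptotics.IsLittleO.congr' (hO.mul_isBigO (isBigO_inv_sub c)) ?_ ?_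
      · filter_upwards [hcob] with z hz
        rw [hgg' z hz, div_eq_mul_inv]
      · filter_upwards [hz0] with z hz
        rw [card_insert_of_notMem hc, pow_succ, mul_assoc, mul_inv_cancel₀ hz, mul_one]
    refine Eq.trans ?_ (ih (fun d hd => hC d (mem_insert_of_mem hd)) hg' (fun d hd hdr => ?_) hO')
    · refine Real.circleAverage_congr_sphere fun z hz => ?_
      have hzc : z ≠ c := by
        rintro rfl
        refine hC z (mem_insert_self _ _) ?_
        simpa [abs_of_pos (hr.trans_lt hρ)] using hz
      rw [hgg' z hzc, prod_insert hc, div_div]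
    · have hdc : d ≠ c := fun h => hc (h ▸ hd)
      rw [hgg' d hdc, h0 d (mem_insert_of_mem hd) hdr, zero_div]

/-! ### Partial fractions and the basic vanishing theorem -/

/-- Lagrange interpolation of the constant `1` at the nodes `v b`, evaluated at `0`. -/
theorem prod_inv_eq_sum {ι : Type*} [DecidableEq ι] {B : Finset ι} (hB : B.Nonempty) {v : ι → ℂ}
    (hv : Set.InjOn v B) (h0 : ∀ b ∈ B, v b ≠ 0) :
    (∏ b ∈ B, v b)⁻¹ = ∑ b ∈ B, (v b)⁻¹ * ∏ c ∈ B.erase b, (v c - v b)⁻¹ := by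
  have h := congrArg (Polynomial.eval 0) (Lagrange.sum_basis hv hB)
  rw [Polynomial.eval_finsetSum, Polynomial.eval_one] at h
  rw [← mul_one (∏ b ∈ B, v b)⁻¹, ← h, mul_sum]
  refine sum_congr rfl fun b hb => ?_
  rw [← mul_prod_erase B v hb, mul_inv, mul_assoc]
  congr 1
  rw [Lagrange.basis, Polynomial.eval_prod, ← prod_inv_distrib, ← prod_mul_distrib]
  refine prod_congr rfl fun c hc => ?_
  have hc0 := h0 c (mem_of_mem_erase hc)
  have hcb : v c - v b ≠ 0 := sub_ne_zero.2 fun h =>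
    ne_of_mem_erase hc (hv (mem_of_mem_erase hc) hb h)
  have hbc : v b - v c ≠ 0 := by rwa [← neg_sub, neg_ne_zero]
  simp only [Lagrange.basisDivisor, Polynomial.eval_mul, Polynomial.eval_C, Polynomial.eval_sub,
    Polynomial.eval_X]
  field_simp
  ring

theorem one_lt_of_radius {p q r : ℝ} (hp : 0 ≤ p) (hpq : p + q = 1) (hr0 : 0 < r)
    (hr : p + r < q * r ^ 2) : 1 < r := by
  by_contra h
  push Not at h
  nlinarith [mul_nonneg hp (sq_nonneg r)]

theorem one_lt_mul_radius {p q r : ℝ} (hp : 0 ≤ p) (hr0 : 0 < r) (hr : p + r < q * r ^ 2) :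
    1 < q * r := by
  by_contra h
  push Not at h
  nlinarith

/-- A zero would mean `ξ * (q * ξ' - 1) = -p`, but the left side has modulus at least `r * (q * r -
1) > p`. -/
theorem f_ne_zero {p q r : ℝ} (hp : 0 ≤ p) (hq : 0 < q) (hr0 : 0 < r) (hr : p + r < q * r ^ 2)
    {ξ ξ' : ℂ} (hξ : r ≤ ‖ξ‖) (hξ' : r ≤ ‖ξ'‖) : f p q ξ ξ' ≠ 0 := by
  intro h
  have h1 : ξ * (q * ξ' - 1) = -p := by
    unfold f at h
    linear_combination h
  have h2 : ‖ξ‖ * ‖q * ξ' - 1‖ = p := by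
    rw [← norm_mul, h1, norm_neg, Complex.norm_real, Real.norm_eq_abs, abs_of_nonneg hp]
  have h3 : q * r - 1 ≤ ‖q * ξ' - 1‖ := by
    have := norm_sub_norm_le (q * ξ') 1
    rw [norm_mul, Complex.norm_real, Real.norm_eq_abs, abs_of_pos hq, norm_one] at this
    nlinarith
  have h4 := one_lt_mul_radius hp hr0 hr
  have h5 : r * (q * r - 1) ≤ ‖ξ‖ * ‖q * ξ' - 1‖ :=
    mul_le_mul hξ h3 (by linarith) (by linarith)
  nlinarith

/-- The vanishing of integrals with the denominators `f (ξ o) (ξ b)`, `b ∈ B`. -/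
theorem torusAvg_div_prod_f_eq_zero {N : ℕ} {p q r : ℝ} (hp : 0 ≤ p) (hq : 0 < q)
    (hpq : p + q = 1) (hr0 : 0 < r) (hr : p + r < q * r ^ 2) {ρ : Fin N → ℝ} (hρ : ∀ i, r < ρ i)
    (hinj : Function.Injective ρ) (hρ2 : ∀ i j k, ρ i * ρ j ≠ ρ k) {o : Fin N}
    {B : Finset (Fin N)} (hoB : o ∉ B) (hB : B.Nonempty) {Θ : (Fin N → ℂ) → ℂ}
    (hΘ : DifferentiableOn ℂ Θ {ξ | ξ o ≠ 0 ∧ ∀ i, i ≠ o → r < ‖ξ i‖})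
    (h1 : ∀ ξ : Fin N → ℂ, (∀ i, i ≠ o → r < ‖ξ i‖) → ξ o = 1 → Θ ξ = 0)
    (h2 : ∀ ξ : Fin N → ℂ, (∀ i, i ≠ o → r < ‖ξ i‖) → ∀ b ∈ B, ∀ c ∈ B, b ≠ c → ξ b = ξ c →
      Θ ξ = 0)
    (h3 : ∀ ξ ∈ outer N r, ∀ b ∈ B, ∀ s : ℂ, s ≠ 0 →
      (fun z => Θ (Function.update (Function.update ξ b z) o (s / z)))
        =O[Bornology.cobounded ℂ] fun z => z⁻¹) :
    torusAvg ρ (fun ξ => Θ ξ / ((1 - ξ o) * ∏ b ∈ B, f p q (ξ o) (ξ b))) = 0 := by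
  have hr1 := one_lt_of_radius hp hpq hr0 hr
  have hpos : ∀ i, 0 < ρ i := fun i => hr0.trans (hρ i)
  have hq' : (q : ℂ) ≠ 0 := by exact_mod_cast hq.ne'
  -- The partial fractions: the differences of the values `f p q (ξ o) (ξ b)` are `q * ξ o * (ξ c -
  -- ξ b)`. Distinct radii keep these away from zero on the torus.
  set t : Fin N → (Fin N → ℂ) → ℂ := fun b ξ => Θ ξ / (1 - ξ o) *
    ((f p q (ξ o) (ξ b))⁻¹ * ∏ c ∈ B.erase b, (q * ξ o * (ξ c - ξ b))⁻¹) with ht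
  have hnorm : ∀ θ i, ‖torusPoint ρ θ i‖ = ρ i := fun θ i => by
    rw [norm_torusPoint, abs_of_pos (hpos i)]
  have hne : ∀ {ξ : Fin N → ℂ}, (∀ i, ‖ξ i‖ = ρ i) → ∀ i j, i ≠ j → ξ i ≠ ξ j := by
    intro ξ hξ i j hij h
    exact hij (hinj (by rw [← hξ i, ← hξ j, h]))
  have hne1 : ∀ {ξ : Fin N → ℂ}, (∀ i, ‖ξ i‖ = ρ i) → ∀ i, 1 - ξ i ≠ 0 := by
    intro ξ hξ i h
    have := hξ i
    rw [← sub_eq_zero.1 h, norm_one] at this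
    linarith [hρ i]
  have hne0 : ∀ {ξ : Fin N → ℂ}, (∀ i, ‖ξ i‖ = ρ i) → ∀ i, ξ i ≠ 0 := by
    intro ξ hξ i h
    have := hξ i
    rw [h, norm_zero] at this
    linarith [hpos i]
  have hfne : ∀ {ξ : Fin N → ℂ}, (∀ i, ‖ξ i‖ = ρ i) → ∀ i j, f p q (ξ i) (ξ j) ≠ 0 :=
    fun hξ i j => f_ne_zero hp hq hr0 hr (by rw [hξ]; exact (hρ i).le)
      (by rw [hξ]; exact (hρ j).le)
  have htc : ∀ b ∈ B, Continuous fun θ => t b (torusPoint ρ θ) := by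
    intro b hb
    have hc := continuous_torusPoint ρ
    have hci : ∀ i, Continuous fun θ => torusPoint ρ θ i := fun i =>
      (continuous_apply i).comp hc
    refine (Continuous.div (hΘ.continuousOn.comp_continuous hc fun θ => ?_)
      (continuous_const.sub (hci o)) fun θ => hne1 (hnorm θ) o).mul
      (((Continuous.inv₀ ?_ fun θ => hfne (hnorm θ) o b)).mul
      (continuous_finsetProd _ fun c hc' => Continuous.inv₀ ?_ fun θ => ?_))
    · exact ⟨hne0 (hnorm θ) o, fun i _ => by rw [hnorm]; exact hρ i⟩
    · unfold f
      exact (continuous_const.add ((continuous_const.mul (hci o)).mul (hci b))).sub (hci o)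
    · exact (continuous_const.mul (hci o)).mul ((hci c).sub (hci b))
    · exact mul_ne_zero (mul_ne_zero hq' (hne0 (hnorm θ) o))
        (sub_ne_zero.2 (hne (hnorm θ) c b (ne_of_mem_erase hc')))
  have hsum : torusAvg ρ (fun ξ => Θ ξ / ((1 - ξ o) * ∏ b ∈ B, f p q (ξ o) (ξ b))) =
      torusAvg ρ fun ξ => ∑ b ∈ B, t b ξ := by
    refine torusAvg_congr hρ fun ξ _ hξ => ?_
    replace hξ : ∀ i, ‖ξ i‖ = ρ i := fun i => by rw [hξ, abs_of_pos (hpos i)]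
    have hd : ∀ b c, f p q (ξ o) (ξ c) - f p q (ξ o) (ξ b) = q * ξ o * (ξ c - ξ b) := by
      intro b c; unfold f; ring
    rw [← div_div, div_eq_mul_inv (Θ ξ / _), prod_inv_eq_sum hB (v := fun b => f p q (ξ o) (ξ b))
      (fun b hb c hc h => ?_) (fun b _ => hfne hξ o b), mul_sum]
    · simp only [hd, ht]
    · by_contra hbc
      have := hd c b
      rw [show f p q (ξ o) (ξ b) = f p q (ξ o) (ξ c) from h, sub_self] at this
      exact mul_ne_zero (mul_ne_zero hq' (hne0 hξ o)) (sub_ne_zero.2 (hne hξ b c hbc)) this.symm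
  rw [hsum, torusAvg_sum B htc]
  refine sum_eq_zero fun b hb => ?_
  have hob : o ≠ b := fun h => hoB (h ▸ hb)
  refine torusAvg_eq_zero_of_shear hpos (htc b hb) hob fun ξ hξ s hs => ?_
  have hs0 : s ≠ 0 := by
    rw [← norm_pos_iff, hs]; exact mul_pos (hpos o) (hpos b)
  have hξr : ∀ i, r < ‖ξ i‖ := fun i => by rw [hξ]; exact hρ i
  have hsn : ∀ c ∈ B.erase b, s ≠ ξ c := by
    intro c _ h
    exact hρ2 o b c (by rw [← hs, h, hξ])
  have hinjξ : Set.InjOn ξ (B.erase b) := fun i _ j _ h => by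
    by_contra hij
    exact hne hξ i j hij h
  -- The possible poles in `z = ξ b` when `ξ o = s / z`: at `z = s`, where `ξ o = 1`, and at the
  -- other variables. No product of two radii is a radius, so these points are distinct and off the
  -- contour.
  set C : Finset ℂ := insert s ((B.erase b).image ξ) with hCdef
  have hsC : s ∉ (B.erase b).image ξ := by
    rw [mem_image]
    rintro ⟨c, hc, h⟩
    exact hsn c hc h.symm
  have hcard : #C = #B := by
    rw [card_insert_of_notMem hsC, card_image_of_injOn hinjξ, card_erase_add_one hb]
  set L : ℂ → Fin N → ℂ := fun z => Function.update (Function.update ξ b z) o (s / z) with hL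
  have hLo : ∀ z, L z o = s / z := fun z => by simp [hL]
  have hLb : ∀ z, L z b = z := fun z => by simp [hL, Function.update_of_ne hob.symm]
  have hLc : ∀ z c, c ≠ o → c ≠ b → L z c = ξ c := fun z c h h' => by
    simp [hL, Function.update_of_ne h, Function.update_of_ne h']
  have hLd : ∀ z, r < ‖z‖ → ∀ i, i ≠ o → r < ‖L z i‖ := by
    intro z hz i hi
    by_cases hib : i = b
    · rw [hib, hLb]; exact hz
    · rw [hLc z i hi hib]; exact hξr i
  -- This is `f` along the curve. The bound of `f_ne_zero` does not apply, since `s / z` may be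
  -- small; instead the size of `s`, at least `r * r`, makes `q * s` dominate.
  have hden : ∀ z : ℂ, r < ‖z‖ → p + q * s - s / z ≠ 0 := by
    intro z hz h
    have e1 : (p : ℂ) + q * s = s / z := sub_eq_zero.1 h
    have e2 : q * (ρ o * ρ b) - p ≤ ‖(p : ℂ) + q * s‖ := by
      have := norm_sub_le ((p : ℂ) + q * s) p
      rw [add_sub_cancel_left, norm_mul, Complex.norm_real, Complex.norm_real, Real.norm_eq_abs,
        Real.norm_eq_abs, abs_of_pos hq, abs_of_nonneg hp, hs] at this
      linarith
    have e3 : ‖s / z‖ ≤ ρ o * ρ b / r := by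
      rw [norm_div, hs]
      exact div_le_div_of_nonneg_left (mul_pos (hpos o) (hpos b)).le hr0 hz.le
    rw [← e1] at e3
    have e4 : r * r ≤ ρ o * ρ b := mul_le_mul (hρ o).le (hρ b).le hr0.le (hpos o).le
    have e5 : (q * (ρ o * ρ b) - p) * r ≤ ρ o * ρ b := by
      rw [← le_div_iff₀ hr0]; exact e2.trans e3
    have e6 := one_lt_mul_radius hp hr0 hr
    nlinarith [mul_le_mul_of_nonneg_right e4 (sub_nonneg.2 e6.le)]
  set g : ℂ → ℂ := fun z => (-1) ^ #(B.erase b) * Θ (L z) * z * (z / (q * s)) ^ #(B.erase b) *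
    (p + q * s - s / z)⁻¹ with hg
  have hfun : ∀ z ∈ Metric.sphere (0 : ℂ) |ρ b|, t b (L z) = g z / ∏ c ∈ C, (z - c) := by
    intro z hz
    have hz' : ‖z‖ = ρ b := by simpa [abs_of_pos (hpos b)] using hz
    have hz0 : z ≠ 0 := by rw [← norm_pos_iff, hz']; exact hpos b
    have hzs : z - s ≠ 0 := by
      rw [sub_ne_zero]
      rintro rfl
      exact hρ2 o b b (by rw [← hs, hz'])
    have hprod : ∏ c ∈ B.erase b, (q * L z o * (L z c - L z b))⁻¹ =
        (-1) ^ #(B.erase b) * (z / (q * s)) ^ #(B.erase b) / ∏ c ∈ B.erase b, (z - ξ c) := by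
      rw [← mul_pow, ← prod_const, ← prod_div_distrib]
      refine prod_congr rfl fun c hc => ?_
      have hco : c ≠ o := fun h => hoB (h ▸ mem_of_mem_erase hc)
      have hcb := ne_of_mem_erase hc
      rw [hLo, hLb, hLc z c hco hcb]
      have hzc : z - ξ c ≠ 0 := by
        rw [sub_ne_zero]
        rintro rfl
        exact hcb (hinj (by rw [← hξ c, hz']))
      have hcz : ξ c - z ≠ 0 := by rwa [← neg_sub, neg_ne_zero]
      field_simp
      ring
    have hf' : f p q (L z o) (L z b) = p + q * s - s / z := by
      rw [hLo, hLb]; unfold f; field_simp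
    rw [ht]
    simp only
    rw [hprod, hf', hCdef, prod_insert hsC, prod_image hinjξ, hLo, hg]
    have : 1 - s / z = (z - s) / z := by field_simp
    rw [this]
    simp only [div_eq_mul_inv, mul_inv, inv_inv]
    ring
  rw [Real.circleAverage_congr_sphere hfun]
  refine circleAverage_div_prod_eq_zero hr0.le (hρ b) C ?_ ?_ ?_ ?_
  · intro c hc h
    rw [hCdef, mem_insert, mem_image] at hc
    rcases hc with rfl | ⟨c', hc', rfl⟩
    · exact hρ2 o b b (by rw [← hs, h])
    · rw [hξ] at h
      exact ne_of_mem_erase hc' (hinj h)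
  · have hz0 : ∀ z : ℂ, r < ‖z‖ → z ≠ 0 := fun z hz => by
      rw [← norm_pos_iff]; exact hr0.trans hz
    have hdiv : DifferentiableOn ℂ (fun z : ℂ => s / z) {z | r < ‖z‖} :=
      (differentiableOn_const s).div differentiableOn_id hz0
    have hLdiff : DifferentiableOn ℂ L {z | r < ‖z‖} := by
      rw [differentiableOn_pi]
      intro i
      by_cases hio : i = o
      · subst hio; simpa only [hLo] using hdiv
      · by_cases hib : i = b
        · subst hib; simp only [hLb]; exact differentiableOn_id
        · simpa only [hLc _ i hio hib] using differentiableOn_const _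
    have hΘL : DifferentiableOn ℂ (fun z => Θ (L z)) {z | r < ‖z‖} :=
      hΘ.comp hLdiff fun z hz => ⟨by rw [hLo]; exact div_ne_zero hs0 (hz0 z hz), hLd z hz⟩
    exact ((((differentiableOn_const _).mul hΘL).mul differentiableOn_id).mul
      ((differentiableOn_id.div_const _).pow _)).mul
      (((differentiableOn_const _).sub hdiv).inv hden)
  · intro c hc hcr
    have : Θ (L c) = 0 := by
      rw [hCdef, mem_insert, mem_image] at hc
      rcases hc with rfl | ⟨c', hc', rfl⟩
      · exact h1 _ (hLd c hcr) (by rw [hLo, div_self hs0])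
      · have hco : c' ≠ o := fun h => hoB (h ▸ mem_of_mem_erase hc')
        have hcb := ne_of_mem_erase hc'
        exact h2 _ (hLd _ hcr) b hb c' (mem_of_mem_erase hc') hcb.symm
          (by rw [hLb, hLc _ _ hco hcb])
    simp [hg, this]
  · rw [hcard]
    have hcob : ∀ᶠ z : ℂ in Bornology.cobounded ℂ, r < ‖z‖ := by
      rw [← comap_norm_atTop]
      exact tendsto_comap.eventually (eventually_gt_atTop _)
    have hlim : Tendsto (fun z : ℂ => ((p : ℂ) + q * s - s / z)⁻¹) (Bornology.cobounded ℂ)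
        (𝓝 ((p : ℂ) + q * s - s * 0)⁻¹) := by
      refine Tendsto.inv₀ (tendsto_const_nhds.sub ?_) ?_
      · exact tendsto_const_nhds.mul tendsto_inv₀_cobounded
      · rw [mul_zero, sub_zero]
        intro h
        have e : q * (ρ o * ρ b) = p := by
          have : (q : ℂ) * s = -p := by linear_combination h
          have := congrArg norm this
          rwa [norm_mul, norm_neg, Complex.norm_real, Complex.norm_real, Real.norm_eq_abs,
            Real.norm_eq_abs, abs_of_pos hq, abs_of_nonneg hp, hs] at this
        have e4 : r * r ≤ ρ o * ρ b := mul_le_mul (hρ o).le (hρ b).le hr0.le (hpos o).le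
        nlinarith
    have hb1 := h3 ξ (fun i => hξr i) b hb s hs0
    have hb2 : (fun z : ℂ => (z / (q * s)) ^ #(B.erase b)) =O[Bornology.cobounded ℂ]
        fun z => z ^ #(B.erase b) := by
      simp only [div_eq_mul_inv, mul_pow]
      exact (Asymptotics.isBigO_refl _ _).mul (Asymptotics.isBigO_const_const _ one_ne_zero _)
        |>.congr_right fun z => mul_one _
    have hO := ((((Asymptotics.isBigO_refl (fun _ : ℂ => (-1 : ℂ) ^ #(B.erase b))
      (Bornology.cobounded ℂ)).mul hb1).mul (Asymptotics.isBigO_refl (fun z : ℂ => z)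
      (Bornology.cobounded ℂ))).mul hb2).mul (hlim.isBigO_one ℂ)
    refine Asymptotics.IsBigO.trans_isLittleO (g := fun z : ℂ => z ^ #(B.erase b)) ?_ ?_
    · refine (hO.trans (Asymptotics.IsBigO.of_bound 1 ?_))
      filter_upwards [hcob] with z hz
      have hz0 : z ≠ 0 := by rw [← norm_pos_iff]; exact hr0.trans hz
      simp [hz0]
    -- The bound `z⁻¹` of `Θ`, the factor `z` from `1 - s / z`, and `#B - 1` factors `z` from the
    -- differences give order `#B - 1`, one less than the number of points in `C`.
    · rw [← card_erase_add_one hb]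
      refine (Asymptotics.isLittleO_pow_pow_cobounded_of_lt (Nat.lt_succ_self _))

/-! ### Splitting off one index, and holomorphy -/

/-- The part of `term` that belongs to the indices in `T`. -/
def partialTerm {N : ℕ} (p q : ℝ) {l : ℕ} (X : ℕ → ℤ) (κ : Fin N → Fin (l + 2)) (y : Fin N → ℤ)
    (t : ℝ) (T : Finset (Fin N)) (ξ : Fin N → ℂ) : ℂ :=
  pairProd T (edgeWeight p q κ ξ) * ∏ i ∈ T, siteWeight p q l X (κ i) (ξ i) (y i) t

theorem partialTerm_congr {N : ℕ} (p q : ℝ) {l : ℕ} (X : ℕ → ℤ) {κ κ' : Fin N → Fin (l + 2)}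
    (y : Fin N → ℤ) (t : ℝ) {T : Finset (Fin N)} {ξ ξ' : Fin N → ℂ} (hκ : ∀ i ∈ T, κ i = κ' i)
    (hξ : ∀ i ∈ T, ξ i = ξ' i) :
    partialTerm p q X κ y t T ξ = partialTerm p q X κ' y t T ξ' := by
  unfold partialTerm
  congr 1
  · refine pairProd_congr fun i hi j hj _ => ?_
    simp only [edgeWeight, hκ i hi, hκ j hj, hξ i hi, hξ j hj]
  · exact prod_congr rfl fun i hi => by rw [hκ i hi, hξ i hi]

theorem term_eq_mul_partialTerm {N : ℕ} (p q : ℝ) {l : ℕ} (X : ℕ → ℤ) (κ : Fin N → Fin (l + 2))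
    (y : Fin N → ℤ) (t : ℝ) (o : Fin N) (ξ : Fin N → ℂ) :
    term p q X κ y t ξ = (∏ d ∈ univ.erase o, edgeWeight p q κ ξ o d) *
      siteWeight p q l X (κ o) (ξ o) (y o) t * partialTerm p q X κ y t (univ.erase o) ξ := by
  rw [term, partialTerm, pairProd_erase (mem_univ o) (edgeWeight_comm p q κ ξ),
    ← mul_prod_erase _ _ (mem_univ o)]
  ring

section analytic

variable {N l : ℕ} {p q r : ℝ}

theorem differentiableOn_prod {ι E : Type*} [NormedAddCommGroup E] [NormedSpace ℂ E]
    {s : Finset ι} {g : ι → E → ℂ} {S : Set E} (h : ∀ i ∈ s, DifferentiableOn ℂ (g i) S) :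
    DifferentiableOn ℂ (fun ξ => ∏ i ∈ s, g i ξ) S := by
  classical
  induction s using Finset.induction_on with
  | empty => simp
  | insert b s hb ih =>
    simp only [prod_insert hb]
    exact (h b (mem_insert_self _ _)).mul (ih fun i hi => h i (mem_insert_of_mem hi))

theorem differentiable_f (i j : Fin N) :
    Differentiable ℂ fun ξ : Fin N → ℂ => f p q (ξ i) (ξ j) := by
  unfold f; fun_prop

theorem differentiableOn_pairWeight (a b : ℕ) (i j : Fin N) {S : Set (Fin N → ℂ)}
    (hS : ∀ ξ ∈ S, f p q (ξ i) (ξ j) ≠ 0) :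
    DifferentiableOn ℂ (fun ξ : Fin N → ℂ => pairWeight p q l a b (ξ i) (ξ j)) S := by
  unfold pairWeight
  split_ifs
  · exact differentiableOn_const _
  · exact differentiableOn_const _
  · exact differentiableOn_const _
  · simp only [div_eq_mul_inv]
    exact (differentiable_f j i).neg.differentiableOn.mul
      ((differentiable_f i j).differentiableOn.inv hS)
  · simp only [div_eq_mul_inv]
    exact DifferentiableOn.mul (by fun_prop) ((differentiable_f i j).differentiableOn.inv hS)

theorem differentiableAt_ε {ξ : ℂ} (h : ξ ≠ 0) : DifferentiableAt ℂ (ε p q) ξ := by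
  unfold ε
  exact (((differentiableAt_inv h).const_mul _).add (by fun_prop)).sub (by fun_prop)

theorem differentiableAt_siteWeight (X : ℕ → ℤ) (a : ℕ) (y : ℤ) (t : ℝ) {ξ : ℂ} (h0 : ξ ≠ 0)
    (h1 : 1 - ξ ≠ 0) : DifferentiableAt ℂ (fun ξ => siteWeight p q l X a ξ y t) ξ := by
  unfold siteWeight
  have he : DifferentiableAt ℂ (fun ξ => Complex.exp (ε p q ξ * t)) ξ :=
    ((differentiableAt_ε h0).mul_const _).cexp
  have hz : DifferentiableAt ℂ (fun ξ : ℂ => ξ ^ (X a - y)) ξ :=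
    differentiableAt_zpow.2 (Or.inl h0)
  split_ifs
  · exact differentiableAt_const _
  · exact (hz.mul (DifferentiableAt.inv (by fun_prop) h1)).mul he
  · exact (hz.mul (differentiableAt_const _)).mul he

variable (hp : 0 ≤ p) (hq : 0 < q) (hpq : p + q = 1) (hr0 : 0 < r) (hr : p + r < q * r ^ 2)

include hp hq hpq hr0 hr

theorem differentiableOn_partialTerm (X : ℕ → ℤ) (κ : Fin N → Fin (l + 2)) (y : Fin N → ℤ) (t : ℝ)
    (T : Finset (Fin N)) :
    DifferentiableOn ℂ (partialTerm p q X κ y t T) {ξ | ∀ i ∈ T, r < ‖ξ i‖} := by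
  have hr1 := one_lt_of_radius hp hpq hr0 hr
  have hf : ∀ i ∈ T, ∀ j ∈ T, ∀ ξ ∈ {ξ : Fin N → ℂ | ∀ i ∈ T, r < ‖ξ i‖},
      f p q (ξ i) (ξ j) ≠ 0 := fun i hi j hj ξ hξ =>
    f_ne_zero hp hq hr0 hr (hξ i hi).le (hξ j hj).le
  unfold partialTerm pairProd
  refine DifferentiableOn.mul (differentiableOn_prod fun i hi =>
    differentiableOn_prod fun j hj => ?_) (differentiableOn_prod fun i hi => ?_)
  · have hj := mem_filter.1 hj
    simp only [edgeWeight, if_pos hj.2]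
    exact differentiableOn_pairWeight _ _ i j (hf i hi j hj.1)
  · intro ξ hξ
    have h := hξ i hi
    have h0 : ξ i ≠ 0 := by rw [← norm_pos_iff]; linarith
    have h1 : 1 - ξ i ≠ 0 := by
      intro h'
      rw [← sub_eq_zero.1 h', norm_one] at h
      linarith
    have := differentiableAt_siteWeight (p := p) (q := q) (l := l) X (κ i) (y i) t h0 h1
    exact (DifferentiableAt.comp (g := fun w => siteWeight p q l X (κ i) w (y i) t) ξ this
      (differentiableAt_apply i ξ)).differentiableWithinAt

theorem differentiableOn_term (X : ℕ → ℤ) (κ : Fin N → Fin (l + 2)) (y : Fin N → ℤ) (t : ℝ) :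
    DifferentiableOn ℂ (term p q X κ y t) (outer N r) :=
  (differentiableOn_partialTerm hp hq hpq hr0 hr X κ y t univ).mono fun _ h i _ => h i

end analytic

/-! ### Growth in one variable at infinity -/

section growth

theorem eventually_one_le_norm : ∀ᶠ z : ℂ in Bornology.cobounded ℂ, 1 ≤ ‖z‖ := by
  rw [← comap_norm_atTop]
  exact tendsto_comap.eventually (eventually_ge_atTop _)

theorem isBigO_zpow {m n : ℤ} (h : m ≤ n) :
    (fun z : ℂ => z ^ m) =O[Bornology.cobounded ℂ] fun z => z ^ n := by
  refine Asymptotics.IsBigO.of_bound 1 ?_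
  filter_upwards [eventually_one_le_norm] with z hz
  rw [one_mul, norm_zpow, norm_zpow]
  exact zpow_le_zpow_right₀ hz h

theorem isBigO_const_one (c : ℂ) :
    (fun _ : ℂ => c) =O[Bornology.cobounded ℂ] fun _ => (1 : ℂ) :=
  Asymptotics.isBigO_const_const c one_ne_zero _

theorem isBigO_const_id (c : ℂ) : (fun _ : ℂ => c) =O[Bornology.cobounded ℂ] fun z => z := by
  have := (isBigO_const_one c).trans
    ((isBigO_zpow (show (0 : ℤ) ≤ 1 by norm_num)).congr_left fun z => zpow_zero z)
  simpa using this

theorem isBigO_div_one (s : ℂ) :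
    (fun z : ℂ => s / z) =O[Bornology.cobounded ℂ] fun _ => (1 : ℂ) := by
  have : Tendsto (fun z : ℂ => s / z) (Bornology.cobounded ℂ) (𝓝 (s * 0)) := by
    simp only [div_eq_mul_inv]
    exact tendsto_const_nhds.mul tendsto_inv₀_cobounded
  exact this.isBigO_one ℂ

theorem isBigO_affine (α β : ℂ) :
    (fun z : ℂ => α + β * z) =O[Bornology.cobounded ℂ] fun z => z :=
  (isBigO_const_id α).add (Asymptotics.isBigO_const_mul_self β _ _)

theorem isBigO_inv_affine (α : ℂ) {β : ℂ} (hβ : β ≠ 0) :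
    (fun z : ℂ => (α + β * z)⁻¹) =O[Bornology.cobounded ℂ] fun z => z⁻¹ := by
  have h := (isBigO_inv_sub (-α / β)).const_mul_left β⁻¹
  refine h.congr_left fun z => ?_
  rw [← mul_inv]
  congr 1
  field_simp
  ring

theorem isBigO_affine_div (α β α' : ℂ) {β' : ℂ} (hβ : β' ≠ 0) :
    (fun z : ℂ => (α + β * z) / (α' + β' * z)) =O[Bornology.cobounded ℂ] fun _ => (1 : ℂ) := by
  have h := (isBigO_affine α β).mul (isBigO_inv_affine α' hβ)
  refine (h.congr_left fun z => (div_eq_mul_inv _ _).symm).trans ?_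
  refine Asymptotics.IsBigO.of_bound 1 ?_
  filter_upwards [eventually_one_le_norm] with z hz
  have : z ≠ 0 := by rw [← norm_pos_iff]; linarith
  simp [this]

variable {N l : ℕ} {p q : ℝ}

/-- Numerator and denominator are affine in `z`, and the denominator has leading coefficient `q * c
- 1`. -/
theorem isBigO_pairWeight_left (a b : ℕ) {c : ℂ} (hc : q * c - 1 ≠ 0) :
    (fun z : ℂ => pairWeight p q l a b z c) =O[Bornology.cobounded ℂ] fun _ => (1 : ℂ) := by
  unfold pairWeight
  split_ifs
  · exact isBigO_const_one _
  · exact isBigO_const_one _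
  · exact isBigO_const_one _
  · refine (isBigO_affine_div (-(p - c)) (-(q * c)) p hc).congr_left fun z => ?_
    unfold f; congr 1 <;> ring
  · refine (isBigO_affine_div (p * c) (-p) p hc).congr_left fun z => ?_
    unfold f; congr 1 <;> ring

theorem isBigO_pairWeight_right (hq : (q : ℂ) ≠ 0) (a b : ℕ) {c : ℂ} (hc : c ≠ 0) :
    (fun z : ℂ => pairWeight p q l a b c z) =O[Bornology.cobounded ℂ] fun _ => (1 : ℂ) := by
  unfold pairWeight
  split_ifs
  · exact isBigO_const_one _
  · exact isBigO_const_one _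
  · exact isBigO_const_one _
  · refine (isBigO_affine_div (-p) (1 - q * c) (p - c) (mul_ne_zero hq hc)).congr_left fun z => ?_
    unfold f; congr 1 <;> ring
  · refine (isBigO_affine_div (-(p * c)) p (p - c) (mul_ne_zero hq hc)).congr_left fun z => ?_
    unfold f; congr 1 <;> ring

theorem siteWeight_zero (X : ℕ → ℤ) {a : ℕ} (ha : a ≤ l) (ξ : ℂ) (y : ℤ) :
    siteWeight p q l X a ξ y 0 = ξ ^ (X a - y) * (if a = l then (1 - ξ)⁻¹ else 1) := by
  rw [siteWeight, if_neg ha.not_gt]; simp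

/-- The factor `(1 - z)⁻¹` of rank `l` gains one power. This is the gain that replaces strict
monotonicity of `X` when two indices both have rank `l`. -/
theorem isBigO_siteWeight (X : ℕ → ℤ) {a : ℕ} (ha : a ≤ l) (y m : ℤ)
    (hm : (if a = l then X a - 1 else X a) - y ≤ m) :
    (fun z => siteWeight p q l X a z y 0) =O[Bornology.cobounded ℂ] fun z => z ^ m := by
  simp only [siteWeight_zero X ha]
  refine Asymptotics.IsBigO.trans ?_ (isBigO_zpow hm)
  split_ifs with h
  · have h1 : (fun z : ℂ => (1 - z)⁻¹) =O[Bornology.cobounded ℂ] fun z => z⁻¹ :=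
      (isBigO_inv_affine 1 (neg_ne_zero.2 one_ne_zero)).congr_left fun z => by ring
    refine ((Asymptotics.isBigO_refl (fun z : ℂ => z ^ (X a - y)) _).mul h1).trans_eventuallyEq ?_
    filter_upwards [eventually_one_le_norm] with z hz
    have : z ≠ 0 := by rw [← norm_pos_iff]; linarith
    rw [show X a - 1 - y = X a - y - 1 by ring, zpow_sub_one₀ this]
  · simp only [mul_one]
    exact Asymptotics.isBigO_refl _ _

/-- All pair weights stay bounded when one variable tends to infinity, so only its own site weight
matters. -/
theorem isBigO_partialTerm (hq : (q : ℂ) ≠ 0) (X : ℕ → ℤ) (κ : Fin N → Fin (l + 2))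
    (y : Fin N → ℤ) {T : Finset (Fin N)} {b : Fin N} (hb : b ∈ T) {ξ : Fin N → ℂ}
    (hξ : ∀ i ∈ T, ξ i ≠ 0) (hξq : ∀ i ∈ T, q * ξ i - 1 ≠ 0) :
    (fun z => partialTerm p q X κ y 0 T (Function.update ξ b z)) =O[Bornology.cobounded ℂ]
      fun z => siteWeight p q l X (κ b) z (y b) 0 := by
  have h1 : (fun z => pairProd T (edgeWeight p q κ (Function.update ξ b z)))
      =O[Bornology.cobounded ℂ] fun _ => (1 : ℂ) := by
    have : (fun _ : ℂ => (1 : ℂ)) = fun _ => ∏ i ∈ T, ∏ j ∈ T with i < j, (1 : ℂ) := by simp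
    rw [this]
    unfold pairProd
    refine Asymptotics.IsBigO.finsetProd fun i hi => Asymptotics.IsBigO.finsetProd fun j hj => ?_
    have hj := mem_filter.1 hj
    simp only [edgeWeight, if_pos hj.2]
    by_cases hib : i = b
    · subst hib
      simp only [Function.update_self, Function.update_of_ne hj.2.ne']
      exact isBigO_pairWeight_left _ _ (hξq j hj.1)
    · by_cases hjb : j = b
      · subst hjb
        simp only [Function.update_self, Function.update_of_ne hib]
        exact isBigO_pairWeight_right hq _ _ (hξ i hi)
      · simp only [Function.update_of_ne hib, Function.update_of_ne hjb]
        exact isBigO_const_one _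
  have h2 : (fun z => ∏ i ∈ T, siteWeight p q l X (κ i) (Function.update ξ b z i) (y i) 0)
      =O[Bornology.cobounded ℂ] fun z => siteWeight p q l X (κ b) z (y b) 0 := by
    have : ∀ z, ∏ i ∈ T, siteWeight p q l X (κ i) (Function.update ξ b z i) (y i) 0 =
        (∏ i ∈ T.erase b, siteWeight p q l X (κ i) (ξ i) (y i) 0) *
          siteWeight p q l X (κ b) z (y b) 0 := by
      intro z
      rw [← prod_erase_mul _ _ hb, Function.update_self]
      congr 1
      exact prod_congr rfl fun i hi => by rw [Function.update_of_ne (ne_of_mem_erase hi)]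
    simp only [this]
    exact Asymptotics.isBigO_const_mul_self _ _ _
  exact (h1.mul h2).congr_right fun z => one_mul _

end growth

/-! ### Terms with the residue at `1` removed -/

section residual

variable {N l : ℕ} {p q r : ℝ}

/-- The numerators of the weights of the pairs `{o, b}`, `b ∈ B`, where `o` has rank `a`. -/
def crossNum (p q : ℝ) (a : ℕ) (κ : Fin N → Fin (l + 2)) (o : Fin N) (B : Finset (Fin N))
    (ξ : Fin N → ℂ) : ℂ :=
  ∏ b ∈ B, if (κ b : ℕ) < a then -f p q (ξ b) (ξ o) else p * (ξ b - ξ o)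

/-- A multiple of `crossNum`, modified so that it vanishes at `ξ o = 1`. -/
def crossFactor (p q : ℝ) (a : ℕ) (κ : Fin N → Fin (l + 2)) (o : Fin N) (B : Finset (Fin N))
    (ξ : Fin N → ℂ) : ℂ :=
  if a < l then (1 - ξ o) * crossNum p q a κ o B ξ
  else crossNum p q a κ o B ξ - (p / q : ℂ) ^ #B * ∏ b ∈ B, f p q (ξ o) (ξ b)

/-- The numerator of `residual`. -/
def residualNum (p q : ℝ) (X : ℕ → ℤ) (a : ℕ) (κ : Fin N → Fin (l + 2)) (y : Fin N → ℤ) (o : Fin N)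
    (B : Finset (Fin N)) (ξ : Fin N → ℂ) : ℂ :=
  ξ o ^ (X a - y o) * crossFactor p q a κ o B ξ * partialTerm p q X κ y 0 (univ.erase o) ξ

/-- What is left of a term in which `o` has rank `a` after removing the residue at `ξ o = 1`. -/
def residual (p q : ℝ) (X : ℕ → ℤ) (a : ℕ) (κ : Fin N → Fin (l + 2)) (y : Fin N → ℤ) (o : Fin N)
    (B : Finset (Fin N)) (ξ : Fin N → ℂ) : ℂ :=
  residualNum p q X a κ y o B ξ / ((1 - ξ o) * ∏ b ∈ B, f p q (ξ o) (ξ b))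

/-- The indices whose rank is between `j` and `a`, other than `o`. -/
def crossSet (j a : ℕ) (κ : Fin N → Fin (l + 2)) (o : Fin N) : Finset (Fin N) :=
  {i | i ≠ o ∧ j ≤ (κ i : ℕ) ∧ (κ i : ℕ) ≤ a}

theorem mem_crossSet {j a : ℕ} {κ : Fin N → Fin (l + 2)} {o i : Fin N} :
    i ∈ crossSet j a κ o ↔ i ≠ o ∧ j ≤ (κ i : ℕ) ∧ (κ i : ℕ) ≤ a := by
  simp [crossSet]

theorem crossNum_swap {a : ℕ} {κ : Fin N → Fin (l + 2)} {o b c : Fin N} {B : Finset (Fin N)}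
    (hb : b ∈ B) (hc : c ∈ B) {ξ : Fin N → ℂ} (h : ξ b = ξ c) :
    crossNum p q a (κ ∘ Equiv.swap b c) o B ξ = crossNum p q a κ o B ξ := by
  have hξ : ∀ i, ξ (Equiv.swap b c i) = ξ i := by
    intro i
    by_cases hib : i = b
    · rw [hib, Equiv.swap_apply_left, h]
    · by_cases hic : i = c
      · rw [hic, Equiv.swap_apply_right, h]
      · rw [Equiv.swap_apply_of_ne_of_ne hib hic]
  unfold crossNum
  refine prod_equiv (Equiv.swap b c) (fun i => ?_) fun i _ => ?_
  · by_cases hib : i = b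
    · rw [hib, Equiv.swap_apply_left]; exact iff_of_true hb hc
    · by_cases hic : i = c
      · rw [hic, Equiv.swap_apply_right]; exact iff_of_true hc hb
      · rw [Equiv.swap_apply_of_ne_of_ne hib hic]
  · rw [Function.comp_apply, hξ]

theorem siteWeight_mul_swap (X : ℕ → ℤ) (a b : ℕ) (ha : a ≤ l) (hb : b ≤ l) {ζ : ℂ} (hζ : ζ ≠ 0)
    (y y' : ℤ) (t : ℝ) :
    siteWeight p q l X b ζ y t * siteWeight p q l X a ζ y' t =
      siteWeight p q l X a ζ y t * siteWeight p q l X b ζ y' t := by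
  simp only [siteWeight, ha.not_gt, hb.not_gt, if_false]
  have : ζ ^ (X b - y) * ζ ^ (X a - y') = ζ ^ (X a - y) * ζ ^ (X b - y') := by
    rw [← zpow_add₀ hζ, ← zpow_add₀ hζ]; congr 1; ring
  linear_combination (if b = l then (1 - ζ)⁻¹ else 1) * (if a = l then (1 - ζ)⁻¹ else 1) *
    Complex.exp (ε p q ζ * t) ^ 2 * this

theorem partialTerm_swap (X : ℕ → ℤ) {κ : Fin N → Fin (l + 2)} (y : Fin N → ℤ) (t : ℝ)
    {T : Finset (Fin N)} {ξ : Fin N → ℂ} {b c : Fin N} (hbc : b ≠ c) (hb : (κ b : ℕ) ≤ l)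
    (hc : (κ c : ℕ) ≤ l) (hξ : ξ b = ξ c) (hbT : b ∈ T) (hcT : c ∈ T)
    (hf : ∀ i ∈ T, ∀ j ∈ T, f p q (ξ i) (ξ j) ≠ 0) (h0 : ξ b ≠ 0) :
    partialTerm p q X (κ ∘ Equiv.swap b c) y t T ξ = -partialTerm p q X κ y t T ξ := by
  unfold partialTerm
  rw [pairProd_edgeWeight_swap hbc hb hc hξ hbT hcT hf, neg_mul]
  congr 2
  have hcT' : c ∈ T.erase b := mem_erase.2 ⟨hbc.symm, hcT⟩
  rw [← mul_prod_erase _ _ hbT, ← mul_prod_erase _ _ hcT', ← mul_prod_erase _ _ hbT,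
    ← mul_prod_erase _ _ hcT', ← mul_assoc, ← mul_assoc]
  congr 1
  · simp only [Function.comp_apply, Equiv.swap_apply_left, Equiv.swap_apply_right]
    rw [← hξ]
    exact siteWeight_mul_swap X _ _ hb hc h0 _ _ t
  · refine prod_congr rfl fun d hd => ?_
    simp only [mem_erase] at hd
    rw [Function.comp_apply, Equiv.swap_apply_of_ne_of_ne hd.2.1 hd.1]

/-- At `ξ o = 1` one has `-f p q (ξ b) 1 = p * (ξ b - 1)` and `f p q 1 (ξ b) = q * (ξ b - 1)`. Hence
every factor of `crossNum`, whatever the rank of `b`, is `p / q` times the corresponding `f`. -/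
theorem crossFactor_eq_zero (hq : (q : ℂ) ≠ 0) (hpq : (p : ℂ) + q = 1) (a : ℕ)
    (κ : Fin N → Fin (l + 2)) (o : Fin N) (B : Finset (Fin N)) {ξ : Fin N → ℂ} (h : ξ o = 1) :
    crossFactor p q a κ o B ξ = 0 := by
  unfold crossFactor
  split_ifs
  · rw [h, sub_self, zero_mul]
  · rw [crossNum, ← prod_const, ← prod_mul_distrib, sub_eq_zero]
    refine prod_congr rfl fun b _ => ?_
    have hp : (p : ℂ) = 1 - q := by rw [← hpq]; ring
    unfold f
    rw [h, hp]
    split_ifs <;> field_simp <;> ring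

/-- Only the factor of `b` grows: `f p q z (s / z) = p + q * s - z`, while for the other indices `ξ
o = s / z` tends to zero. -/
theorem isBigO_crossNum (a : ℕ) (κ : Fin N → Fin (l + 2)) {o b : Fin N} {B : Finset (Fin N)}
    (hoB : o ∉ B) (hb : b ∈ B) (ξ : Fin N → ℂ) {s : ℂ} :
    (fun z => crossNum p q a κ o B (Function.update (Function.update ξ b z) o (s / z)))
      =O[Bornology.cobounded ℂ] fun z => z := by
  have hob : o ≠ b := fun h => hoB (h ▸ hb)
  have h1 := isBigO_div_one s
  have h1' : (fun z : ℂ => s / z) =O[Bornology.cobounded ℂ] fun z => z := by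
    refine h1.trans ?_
    exact isBigO_const_id 1
  unfold crossNum
  simp only [← mul_prod_erase _ _ hb]
  have hone : (fun z : ℂ => z) = fun z => z * ∏ _c ∈ B.erase b, (1 : ℂ) := by simp
  rw [hone]
  refine Asymptotics.IsBigO.mul ?_ (Asymptotics.IsBigO.finsetProd fun c hc => ?_)
  · simp only [Function.update_self, Function.update_of_ne hob.symm]
    split_ifs
    · refine Asymptotics.IsBigO.neg_left ?_
      have : (fun z : ℂ => f p q z (s / z)) =ᶠ[Bornology.cobounded ℂ]
          fun z => (p + q * s) + (-1) * z := by
        filter_upwards [eventually_one_le_norm] with z hz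
        have : z ≠ 0 := by rw [← norm_pos_iff]; linarith
        unfold f; field_simp; ring
      exact this.trans_isBigO (isBigO_affine _ _)
    · exact ((Asymptotics.isBigO_refl _ _).sub h1').const_mul_left _
  · have hco : c ≠ o := fun h => hoB (h ▸ mem_of_mem_erase hc)
    have hcb := ne_of_mem_erase hc
    simp only [Function.update_self, Function.update_of_ne hco, Function.update_of_ne hcb]
    split_ifs
    · unfold f
      exact (((isBigO_const_one _).add (h1.const_mul_left _)).sub (isBigO_const_one _)).neg_left
    · exact ((isBigO_const_one _).sub h1).const_mul_left _

theorem isBigO_crossFactor (a : ℕ) (κ : Fin N → Fin (l + 2)) {o b : Fin N} {B : Finset (Fin N)}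
    (hoB : o ∉ B) (hb : b ∈ B) (ξ : Fin N → ℂ) {s : ℂ} :
    (fun z => crossFactor p q a κ o B (Function.update (Function.update ξ b z) o (s / z)))
      =O[Bornology.cobounded ℂ] fun z => z := by
  have hob : o ≠ b := fun h => hoB (h ▸ hb)
  have h1 := isBigO_div_one s
  have hN := isBigO_crossNum (p := p) (q := q) a κ hoB hb ξ (s := s)
  unfold crossFactor
  split_ifs
  · refine (Asymptotics.IsBigO.mul ?_ hN).congr_right fun z => one_mul z
    simp only [Function.update_self]
    exact (isBigO_const_one 1).sub h1
  · refine hN.sub (Asymptotics.IsBigO.const_mul_left (Asymptotics.IsBigO.trans ?_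
      (isBigO_const_id 1)) _)
    have : (fun _ : ℂ => (1 : ℂ)) = fun _ => ∏ c ∈ B, (1 : ℂ) := by simp
    rw [this]
    refine Asymptotics.IsBigO.finsetProd fun c hc => ?_
    have hco : c ≠ o := fun h => hoB (h ▸ hc)
    simp only [Function.update_self, Function.update_of_ne hco]
    by_cases hcb : c = b
    · subst hcb
      simp only [Function.update_self]
      have : (fun z : ℂ => f p q (s / z) z) =ᶠ[Bornology.cobounded ℂ]
          fun z => (p + q * s) - s / z := by
        filter_upwards [eventually_one_le_norm] with z hz
        have : z ≠ 0 := by rw [← norm_pos_iff]; linarith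
        unfold f; field_simp
      exact this.trans_isBigO ((isBigO_const_one _).sub h1)
    · simp only [Function.update_of_ne hcb]
      unfold f
      refine ((isBigO_const_one _).add ?_).sub h1
      exact ((h1.const_mul_left _).mul (isBigO_const_one (ξ c))).congr_right fun z => one_mul _

variable (hp : 0 ≤ p) (hq : 0 < q) (hpq : p + q = 1) (hr0 : 0 < r) (hr : p + r < q * r ^ 2)

include hp hq hpq hr0 hr

/-- The variable `ξ o` need only be nonzero, because the denominators containing it are kept out of
the numerator. This is needed because `ξ o = s / z` moves inward as the contour of `ξ b` moves
outward. -/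
theorem differentiableOn_residualNum (X : ℕ → ℤ) (a : ℕ) (κ : Fin N → Fin (l + 2)) (y : Fin N → ℤ)
    (o : Fin N) (B : Finset (Fin N)) :
    DifferentiableOn ℂ (residualNum p q X a κ y o B) {ξ | ξ o ≠ 0 ∧ ∀ i, i ≠ o → r < ‖ξ i‖} := by
  unfold residualNum
  refine (DifferentiableOn.mul ?_ ?_).mul
    ((differentiableOn_partialTerm hp hq hpq hr0 hr X κ y 0 (univ.erase o)).mono
      fun ξ hξ i hi => hξ.2 i (ne_of_mem_erase hi))
  · intro ξ hξ
    exact (DifferentiableAt.comp (g := fun w : ℂ => w ^ (X a - y o)) ξ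
      (differentiableAt_zpow.2 (Or.inl hξ.1)) (differentiableAt_apply o ξ)).differentiableWithinAt
  · have hN : DifferentiableOn ℂ (crossNum p q a κ o B)
        {ξ | ξ o ≠ 0 ∧ ∀ i, i ≠ o → r < ‖ξ i‖} := by
      unfold crossNum
      refine differentiableOn_prod fun b _ => ?_
      split_ifs
      · exact (differentiable_f b o).neg.differentiableOn
      · fun_prop
    unfold crossFactor
    split_ifs
    · exact DifferentiableOn.mul (by fun_prop) hN
    · exact hN.sub ((differentiableOn_const _).mul
        (differentiableOn_prod fun b _ => (differentiable_f o b).differentiableOn))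

theorem continuousOn_residual (X : ℕ → ℤ) (a : ℕ) (κ : Fin N → Fin (l + 2)) (y : Fin N → ℤ)
    (o : Fin N) (B : Finset (Fin N)) :
    ContinuousOn (residual p q X a κ y o B) (outer N r) := by
  have hr1 := one_lt_of_radius hp hpq hr0 hr
  refine ContinuousOn.div ((differentiableOn_residualNum hp hq hpq hr0 hr X a κ y o
    B).continuousOn.mono fun ξ hξ => ⟨?_, fun i _ => hξ i⟩) ?_ fun ξ hξ => mul_ne_zero ?_
      (prod_ne_zero_iff.2 fun b _ => f_ne_zero hp hq hr0 hr (hξ o).le (hξ b).le)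
  · rw [← norm_pos_iff]; exact hr0.trans (hξ o)
  · exact ContinuousOn.mul (by fun_prop)
      (continuousOn_finsetProd _ fun b _ => (differentiable_f o b).continuous.continuousOn)
  · intro h'
    have := hξ o
    rw [← sub_eq_zero.1 h', norm_one] at this
    linarith

-- The cross factor depends only on the pairs of rank and variable occurring in `B`, so exchanging
-- the ranks of `b` and `c` at `ξ b = ξ c` leaves it alone; the sign comes from `partialTerm_swap`.
omit hpq in
theorem residualNum_swap (X : ℕ → ℤ) (a : ℕ) {κ : Fin N → Fin (l + 2)} (y : Fin N → ℤ)
    {o : Fin N} {B : Finset (Fin N)} (hoB : o ∉ B) {b c : Fin N} (hb : b ∈ B) (hc : c ∈ B)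
    (hbc : b ≠ c) (hbl : (κ b : ℕ) ≤ l) (hcl : (κ c : ℕ) ≤ l) {ξ : Fin N → ℂ}
    (hξ : ∀ i, i ≠ o → r < ‖ξ i‖) (h : ξ b = ξ c) :
    residualNum p q X a (κ ∘ Equiv.swap b c) y o B ξ = -residualNum p q X a κ y o B ξ := by
  have hbo : b ≠ o := fun h => hoB (h ▸ hb)
  have hco : c ≠ o := fun h => hoB (h ▸ hc)
  unfold residualNum crossFactor
  rw [crossNum_swap hb hc h, partialTerm_swap X y 0 hbc hbl hcl h (mem_erase.2 ⟨hbo, mem_univ _⟩)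
    (mem_erase.2 ⟨hco, mem_univ _⟩) (fun i hi j hj => f_ne_zero hp hq hr0 hr
      (hξ i (ne_of_mem_erase hi)).le (hξ j (ne_of_mem_erase hj)).le)
    (by rw [← norm_pos_iff]; exact hr0.trans (hξ b hbo))]
  ring

-- This is where the order of the initial positions enters. The rank of `b` is below `a`, or both
-- ranks are `l`; either way the site weight of `b` is of order at most `X a - 1 - y b`.
omit hpq in
theorem isBigO_residualNum (X : ℕ → ℤ) {a : ℕ} (ha : a ≤ l) (hX : ∀ m n, m < n → n ≤ l → X m < X n)
    {κ : Fin N → Fin (l + 2)} {y : Fin N → ℤ} {o b : Fin N} {B : Finset (Fin N)} (hoB : o ∉ B)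
    (hb : b ∈ B) (hκb : (κ b : ℕ) < a ∨ (κ b : ℕ) = a ∧ a = l) (hy : y o < y b) {ξ : Fin N → ℂ}
    (hξ : ξ ∈ outer N r) (s : ℂ) :
    (fun z => residualNum p q X a κ y o B (Function.update (Function.update ξ b z) o (s / z)))
      =O[Bornology.cobounded ℂ] fun z => z⁻¹ := by
  have hob : o ≠ b := fun h => hoB (h ▸ hb)
  have hq' : (q : ℂ) ≠ 0 := by exact_mod_cast hq.ne'
  have hκl : (κ b : ℕ) ≤ l := by omega
  have h1 : (fun z : ℂ => (s / z) ^ (X a - y o)) =O[Bornology.cobounded ℂ]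
      fun z => z ^ (-(X a - y o)) := by
    refine ((Asymptotics.isBigO_refl (fun z : ℂ => z ^ (-(X a - y o))) _).const_mul_left
      (s ^ (X a - y o))).congr_left fun z => ?_
    rw [div_zpow, zpow_neg, div_eq_mul_inv]
  have h2 := isBigO_crossFactor (p := p) (q := q) a κ hoB hb ξ (s := s)
  have h3 : (fun z => partialTerm p q X κ y 0 (univ.erase o)
      (Function.update (Function.update ξ b z) o (s / z))) =O[Bornology.cobounded ℂ]
        fun z => z ^ (X a - 1 - y b) := by
    have e : ∀ z, partialTerm p q X κ y 0 (univ.erase o)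
        (Function.update (Function.update ξ b z) o (s / z)) =
        partialTerm p q X κ y 0 (univ.erase o) (Function.update ξ b z) := fun z =>
      partialTerm_congr p q X y 0 (fun _ _ => rfl) fun i hi => by
        rw [Function.update_of_ne (ne_of_mem_erase hi)]
    simp only [e]
    refine (isBigO_partialTerm hq' X κ y (mem_erase.2 ⟨hob.symm, mem_univ _⟩) (fun i _ => ?_)
      fun i _ h => ?_).trans (isBigO_siteWeight X hκl _ _ ?_)
    · rw [← norm_pos_iff]; exact hr0.trans (hξ i)
    · have h5 := hξ i
      have h6 : (q : ℂ) * ξ i = 1 := by linear_combination h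
      have h7 := congrArg norm h6
      rw [norm_mul, Complex.norm_real, Real.norm_eq_abs, abs_of_pos hq, norm_one] at h7
      have h8 := one_lt_mul_radius hp hr0 hr
      nlinarith
    · rcases hκb with h | ⟨h, h'⟩
      · rw [if_neg (by omega)]
        have := hX _ _ h ha
        omega
      · rw [if_pos (h.trans h'), h]
  unfold residualNum
  simp only [Function.update_self]
  refine ((h1.mul h2).mul h3).trans ?_
  -- The three orders add up to `y o - y b`, which is at most `-1`.
  have h9 := isBigO_zpow (show -(X a - y o) + 1 + (X a - 1 - y b) ≤ -1 by omega)
  refine Asymptotics.IsBigO.congr' h9 ?_ ?_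
  · filter_upwards [eventually_one_le_norm] with z hz
    have : z ≠ 0 := by rw [← norm_pos_iff]; linarith
    rw [zpow_add₀ this, zpow_add₀ this, zpow_one]
  · exact Eventually.of_forall fun z => zpow_neg_one z

end residual

/-! ### Rankings whose first indices are settled -/

theorem IsRanking.update {N l : ℕ} {κ : Fin N → Fin (l + 2)} (h : IsRanking κ) {o : Fin N}
    (ho : l ≤ (κ o : ℕ)) {v : Fin (l + 2)} (hv : l ≤ (v : ℕ)) :
    IsRanking (Function.update κ o v) := by
  intro a ha
  obtain ⟨i, hi, hu⟩ := h a ha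
  have hio : i ≠ o := by rintro rfl; rw [hi] at ho; omega
  refine ⟨i, by simp only [Function.update_of_ne hio, hi], fun j hj => hu j ?_⟩
  by_cases hjo : j = o
  · subst hjo
    simp only [Function.update_self] at hj
    rw [hj] at hv; omega
  · simpa only [Function.update_of_ne hjo] using hj

open Classical in
/-- The rankings that give every index `i < j` the rank `i`. -/
def stageSet (N l j : ℕ) : Finset (Fin N → Fin (l + 2)) :=
  {κ | IsRanking κ ∧ ∀ i : Fin N, (i : ℕ) < j → (κ i : ℕ) = i}

theorem mem_stageSet {N l j : ℕ} {κ : Fin N → Fin (l + 2)} :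
    κ ∈ stageSet N l j ↔ IsRanking κ ∧ ∀ i : Fin N, (i : ℕ) < j → (κ i : ℕ) = i := by
  simp [stageSet]

theorem le_rank_of_mem_stageSet {N l j : ℕ} (hjl : j ≤ l) {κ : Fin N → Fin (l + 2)}
    (hκ : κ ∈ stageSet N l j) {d : Fin N} (hd : j ≤ (d : ℕ)) : j ≤ (κ d : ℕ) := by
  by_contra! h
  obtain ⟨hr, hs⟩ := mem_stageSet.1 hκ
  have h1 := hs ⟨κ d, by omega⟩ h
  have h2 := hr.injOn (i := d) (j := ⟨κ d, by omega⟩) (by omega) (Fin.ext h1.symm)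
  have := congrArg Fin.val h2
  simp only at this
  omega

/-! ### Terms at time zero, by the rank of the first unsettled index -/

section initial

variable {N l : ℕ} {p q r : ℝ}

/-- Pairs whose ranks are in the same order as their positions have weight `1`. The settled indices
precede `o` in both respects, and an index of rank above `a` follows it in both, so only `crossSet`
contributes. -/
theorem prod_edgeWeight_eq {j : ℕ} (hjl : j ≤ l) {κ : Fin N → Fin (l + 2)}
    (hκ : κ ∈ stageSet N l j) {o : Fin N} (ho : (o : ℕ) = j) {a : ℕ} (ha : a ≤ l) (hja : j ≤ a)
    (hκo : (κ o : ℕ) = a) (ξ : Fin N → ℂ) :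
    ∏ d ∈ univ.erase o, edgeWeight p q κ ξ o d =
      crossNum p q a κ o (crossSet j a κ o) ξ / ∏ b ∈ crossSet j a κ o, f p q (ξ o) (ξ b) := by
  rw [crossNum, ← prod_div_distrib]
  have hsub : crossSet j a κ o ⊆ univ.erase o := fun i hi =>
    mem_erase.2 ⟨(mem_crossSet.1 hi).1, mem_univ _⟩
  have hlt : ∀ d, d ≠ o → ¬ o < d → (κ d : ℕ) < j := by
    intro d hd h
    have hd' : (d : ℕ) < j := by
      have := Fin.val_ne_of_ne hd
      rw [Fin.lt_def] at h; omega
    rw [(mem_stageSet.1 hκ).2 d hd']; exact hd'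
  symm
  refine (prod_congr rfl fun b hb => ?_).trans (prod_subset hsub fun d hd hdB => ?_)
  · obtain ⟨hbo, h1, h2⟩ := mem_crossSet.1 hb
    have hob : o < b := by
      by_contra h
      have := hlt b hbo h; omega
    rw [edgeWeight, if_pos hob, pairWeight, hκo]
    split_ifs <;> first | rfl | omega
  · have hdo := ne_of_mem_erase hd
    unfold edgeWeight
    split_ifs with h
    · have h1 : j ≤ (κ d : ℕ) := le_rank_of_mem_stageSet hjl hκ (by rw [Fin.lt_def] at h; omega)
      have h2 : a < (κ d : ℕ) := by
        by_contra h2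
        exact hdB (mem_crossSet.2 ⟨hdo, h1, by omega⟩)
      rw [pairWeight, hκo]
      split_ifs <;> first | rfl | omega
    · have := hlt d hdo h
      rw [pairWeight, hκo, if_neg (by omega), if_neg (by omega), if_pos (by omega)]

/-- An absent index costs `p / q` for every present index to its right; the present indices to the
right of `o` form `crossSet j l κ o`. -/
theorem prod_edgeWeight_absent {j : ℕ} (hjl : j ≤ l) {κ : Fin N → Fin (l + 2)}
    (hκ : κ ∈ stageSet N l j) {o : Fin N} (ho : (o : ℕ) = j) (hκo : (κ o : ℕ) = l + 1)
    (ξ : Fin N → ℂ) :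
    ∏ d ∈ univ.erase o, edgeWeight p q κ ξ o d = (p / q : ℂ) ^ #(crossSet j l κ o) := by
  rw [← prod_const]
  have hsub : crossSet j l κ o ⊆ univ.erase o := fun i hi =>
    mem_erase.2 ⟨(mem_crossSet.1 hi).1, mem_univ _⟩
  have hlt : ∀ d, d ≠ o → ¬ o < d → (κ d : ℕ) < j := by
    intro d hd h
    have hd' : (d : ℕ) < j := by
      have := Fin.val_ne_of_ne hd
      rw [Fin.lt_def] at h; omega
    rw [(mem_stageSet.1 hκ).2 d hd']; exact hd'
  symm
  refine (prod_congr rfl fun b hb => ?_).trans (prod_subset hsub fun d hd hdB => ?_)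
  · obtain ⟨hbo, h1, h2⟩ := mem_crossSet.1 hb
    have hob : o < b := by
      by_contra h
      have := hlt b hbo h; omega
    rw [edgeWeight, if_pos hob, pairWeight, hκo, if_neg (by omega), if_pos (by omega)]
  · have hdo := ne_of_mem_erase hd
    unfold edgeWeight
    split_ifs with h
    · have h1 : j ≤ (κ d : ℕ) := le_rank_of_mem_stageSet hjl hκ (by rw [Fin.lt_def] at h; omega)
      have h2 : l < (κ d : ℕ) := by
        by_contra h2
        exact hdB (mem_crossSet.2 ⟨hdo, h1, by omega⟩)
      rw [pairWeight, if_pos h2]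
    · rw [pairWeight, hκo, if_pos (by omega)]

/-- For a positive exponent there is no pole at zero, so only the residue at `1` counts. -/
theorem circleAverage_zpow_div {ρ : ℝ} (hρ : 1 < ρ) {n : ℤ} (hn : 1 ≤ n) :
    Real.circleAverage (fun z : ℂ => z ^ n / (1 - z)) 0 ρ = -1 := by
  obtain ⟨k, rfl⟩ : ∃ k : ℕ, n = k + 1 := ⟨(n - 1).toNat, by omega⟩
  have hρ0 : 0 < ρ := by linarith
  rw [Real.circleAverage_eq_circleIntegral hρ0.ne']
  have h := (Differentiable.diffContOnCl (𝕜 := ℂ) (f := fun z : ℂ => -z ^ k) (by fun_prop)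
    (s := Metric.ball 0 ρ)).circleIntegral_sub_inv_smul (w := 1) (by simpa using hρ)
  have e : ∮ z in C(0, ρ), (z - 0)⁻¹ • (z ^ ((k : ℤ) + 1) / (1 - z)) =
      ∮ z in C(0, ρ), (z - 1)⁻¹ • (-z ^ k) := by
    refine circleIntegral.integral_congr hρ0.le fun z hz => ?_
    have hz' : ‖z‖ = ρ := by simpa using hz
    have h0 : z ≠ 0 := by rw [← norm_pos_iff, hz']; exact hρ0
    have h1 : z - 1 ≠ 0 := by
      rw [sub_ne_zero]; rintro rfl; rw [norm_one] at hz'; linarith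
    have h2 : 1 - z ≠ 0 := by rwa [← neg_sub, neg_ne_zero]
    simp only [sub_zero, smul_eq_mul]
    rw [zpow_add_one₀ h0, zpow_natCast]
    field_simp
    ring
  rw [e, h, smul_smul, inv_mul_cancel₀ Complex.two_pi_I_ne_zero]
  simp

theorem circleAverage_zpow {ρ : ℝ} (hρ : 0 < ρ) {n : ℤ} (hn : 1 ≤ n) :
    Real.circleAverage (fun z : ℂ => z ^ n) 0 ρ = 0 := by
  obtain ⟨k, rfl⟩ : ∃ k : ℕ, n = k + 1 := ⟨(n - 1).toNat, by omega⟩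
  rw [Real.circleAverage_eq_circleIntegral hρ.ne']
  have h := (Differentiable.diffContOnCl (𝕜 := ℂ) (f := fun z : ℂ => z ^ (k + 1)) (by fun_prop)
    (s := Metric.ball 0 ρ)).circleIntegral_sub_inv_smul (w := 0) (by simpa using hρ)
  have e : ∀ z : ℂ, z ^ ((k : ℤ) + 1) = z ^ (k + 1) := fun z => by exact_mod_cast rfl
  simp only [e]
  rw [h]
  simp

variable (hp : 0 ≤ p) (hq : 0 < q) (hpq : p + q = 1) (hr0 : 0 < r) (hr : p + r < q * r ^ 2)
  {ρ : Fin N → ℝ} (hρ : ∀ i, r < ρ i)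

include hp hq hpq hr0 hr hρ

/-- The hypothesis makes the integrand decay in the variable of `b`, and that contour can be pushed
to infinity. -/
theorem torusAvg_term_eq_zero (X : ℕ → ℤ) (κ : Fin N → Fin (l + 2)) (y : Fin N → ℤ) {b : Fin N}
    (hb : (κ b : ℕ) ≤ l) (hy : (if (κ b : ℕ) = l then X (κ b) - 1 else X (κ b)) < y b) :
    torusAvg ρ (term p q X κ y 0) = 0 := by
  have hq' : (q : ℂ) ≠ 0 := by exact_mod_cast hq.ne'
  have hd := differentiableOn_term hp hq hpq hr0 hr X κ y 0
  refine torusAvg_eq_zero hρ hd.continuousOn b fun ξ hξ => ?_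
  refine tendsto_circleAverage_zero hr0.le (hρ b) (differentiableOn_update hd fun j _ => hξ j) ?_
  have h1 := isBigO_partialTerm (p := p) hq' X κ y (mem_univ b) (ξ := ξ)
    (fun i _ => by rw [← norm_pos_iff]; exact hr0.trans (hξ i)) (fun i _ h => by
      have h5 := hξ i
      have h6 : (q : ℂ) * ξ i = 1 := by linear_combination h
      have h7 := congrArg norm h6
      rw [norm_mul, Complex.norm_real, Real.norm_eq_abs, abs_of_pos hq, norm_one] at h7
      have h8 := one_lt_mul_radius hp hr0 hr
      nlinarith)
  refine (h1.trans (isBigO_siteWeight X hb (y b) (-1) (by omega))).trans_tendsto ?_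
  simp only [zpow_neg_one]
  exact tendsto_inv₀_cobounded

omit hq in
theorem term_eq_residual {j : ℕ} (hjl : j ≤ l) (X : ℕ → ℤ) {κ : Fin N → Fin (l + 2)}
    (hκ : κ ∈ stageSet N l j) (y : Fin N → ℤ) {o : Fin N} (ho : (o : ℕ) = j) {a : ℕ} (ha : a < l)
    (hja : j ≤ a) (hκo : (κ o : ℕ) = a) :
    torusAvg ρ (term p q X κ y 0) = torusAvg ρ (residual p q X a κ y o (crossSet j a κ o)) := by
  have hr1 := one_lt_of_radius hp hpq hr0 hr
  refine torusAvg_congr hρ fun ξ hξ _ => ?_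
  have h1 : 1 - ξ o ≠ 0 := by
    intro h'
    have := hξ o
    rw [← sub_eq_zero.1 h', norm_one] at this
    linarith
  rw [term_eq_mul_partialTerm p q X κ y 0 o, prod_edgeWeight_eq hjl hκ ho ha.le hja hκo, hκo,
    siteWeight_zero X ha.le, if_neg ha.ne, residual, residualNum, crossFactor, if_pos ha]
  field_simp

/-- The term with `o` absent does not contain `ξ o`. Since `ξ o ^ (X l - y o) / (1 - ξ o)` has
average `-1`, it may be replaced by minus its product with this function, and this is the
subtraction in `crossFactor`. The condition `y o < X l` makes the exponent positive. -/
theorem term_add_absent_eq_residual {j : ℕ} (hjl : j ≤ l) (X : ℕ → ℤ) {κ : Fin N → Fin (l + 2)}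
    (hκ : κ ∈ stageSet N l j) (y : Fin N → ℤ) {o : Fin N} (ho : (o : ℕ) = j)
    (hκo : (κ o : ℕ) = l) (hy : y o < X l) :
    torusAvg ρ (term p q X κ y 0) +
      torusAvg ρ (term p q X (Function.update κ o (Fin.last (l + 1))) y 0) =
      torusAvg ρ (residual p q X l κ y o (crossSet j l κ o)) := by
  have hr1 := one_lt_of_radius hp hpq hr0 hr
  set κ' := Function.update κ o (Fin.last (l + 1)) with hκ'
  have hne1 : ∀ ξ ∈ outer N r, 1 - ξ o ≠ 0 := by
    intro ξ hξ h'
    have := hξ o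
    rw [← sub_eq_zero.1 h', norm_one] at this
    linarith
  have hκ'o : (κ' o : ℕ) = l + 1 := by simp [hκ']
  have hκ'd : ∀ d, d ≠ o → κ' d = κ d := fun d hd => by simp [hκ', Function.update_of_ne hd]
  have hκ's : κ' ∈ stageSet N l j := by
    rw [mem_stageSet] at hκ ⊢
    refine ⟨hκ.1.update hκo.ge (by simp), fun i hi => ?_⟩
    rw [hκ'd i (by rintro rfl; omega), hκ.2 i hi]
  have hcs : crossSet j l κ' o = crossSet j l κ o := by
    ext i
    simp only [mem_crossSet]
    by_cases h : i = o
    · simp [h]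
    · rw [hκ'd i h]
  have hterm' : ∀ ξ, term p q X κ' y 0 ξ =
      (p / q : ℂ) ^ #(crossSet j l κ o) * partialTerm p q X κ y 0 (univ.erase o) ξ := by
    intro ξ
    rw [term_eq_mul_partialTerm p q X κ' y 0 o, prod_edgeWeight_absent hjl hκ's ho hκ'o, hcs,
      siteWeight, hκ'o, if_pos (Nat.lt_succ_self l), mul_one]
    congr 1
    exact partialTerm_congr p q X y 0 (fun i hi => hκ'd i (ne_of_mem_erase hi)) fun _ _ => rfl
  have hc : ContinuousOn (fun ξ : Fin N → ℂ => ξ o ^ (X l - y o) / (1 - ξ o)) (outer N r) := by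
    refine ContinuousOn.div (ContinuousOn.zpow₀ (by fun_prop) _ fun ξ hξ => Or.inl ?_)
      (by fun_prop) hne1
    rw [← norm_pos_iff]; exact hr0.trans (hξ o)
  have hct' := (differentiableOn_term hp hq hpq hr0 hr X κ' y 0).continuousOn
  have hct := (differentiableOn_term hp hq hpq hr0 hr X κ y 0).continuousOn
  -- A function of average zero, subtracted below from the sum of the two terms.
  have hzero : torusAvg ρ (fun ξ => (ξ o ^ (X l - y o) / (1 - ξ o)) * term p q X κ' y 0 ξ +
      term p q X κ' y 0 ξ) = 0 := by
    refine torusAvg_eq_zero hρ ((hc.mul hct').add hct') o fun ξ hξ => ?_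
    have : ∀ z, term p q X κ' y 0 (Function.update ξ o z) = term p q X κ' y 0 ξ := by
      intro z
      rw [hterm', hterm']
      congr 1
      exact partialTerm_congr p q X y 0 (fun _ _ => rfl) fun i hi => by
        rw [Function.update_of_ne (ne_of_mem_erase hi)]
    simp only [this, Function.update_self]
    have hci : CircleIntegrable (fun z : ℂ => z ^ (X l - y o) / (1 - z)) 0 (ρ o) := by
      refine ContinuousOn.circleIntegrable (hr0.trans (hρ o)).le fun z hz => ?_
      have hz' : ‖z‖ = ρ o := by simpa using hz
      have h0 : z ≠ 0 := by rw [← norm_pos_iff, hz']; exact hr0.trans (hρ o)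
      have h1 : 1 - z ≠ 0 := by
        intro h'
        rw [← sub_eq_zero.1 h', norm_one] at hz'
        linarith [hρ o]
      exact (ContinuousAt.div (continuousAt_zpow₀ _ _ (Or.inl h0)) (by fun_prop)
        h1).continuousWithinAt
    have hfun : (fun z : ℂ => z ^ (X l - y o) / (1 - z) * term p q X κ' y 0 ξ +
        term p q X κ' y 0 ξ) =
        (term p q X κ' y 0 ξ) • ((fun z : ℂ => z ^ (X l - y o) / (1 - z)) + fun _ => (1 : ℂ)) := by
      ext z; simp; ring
    rw [hfun, Real.circleAverage_smul, Real.circleAverage_add hci (circleIntegrable_const _ _ _),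
      circleAverage_zpow_div (hr1.trans (hρ o)) (by omega), Real.circleAverage_const]
    simp
  have hadd := torusAvg_add (continuous_comp_torusPoint hρ hct)
    (continuous_comp_torusPoint hρ hct')
  have hsub := torusAvg_sub (continuous_comp_torusPoint hρ (hct.add hct'))
    (continuous_comp_torusPoint hρ ((hc.mul hct').add hct'))
  rw [← hadd]
  have hzero' : torusAvg ρ ((fun ξ : Fin N → ℂ => ξ o ^ (X l - y o) / (1 - ξ o)) *
    term p q X κ' y 0 + term p q X κ' y 0) = 0 := hzero
  rw [hzero', sub_zero] at hsub
  refine hsub.symm.trans (torusAvg_congr hρ fun ξ hξ _ => ?_)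
  have h1 := hne1 ξ hξ
  have hf : ∏ b ∈ crossSet j l κ o, f p q (ξ o) (ξ b) ≠ 0 :=
    prod_ne_zero_iff.2 fun b _ => f_ne_zero hp hq hr0 hr (hξ o).le (hξ b).le
  simp only [Pi.add_apply, Pi.mul_apply]
  rw [hterm', term_eq_mul_partialTerm p q X κ y 0 o, prod_edgeWeight_eq hjl hκ ho le_rfl hjl hκo,
    hκo, siteWeight_zero X le_rfl, if_pos rfl, residual, residualNum, crossFactor,
    if_neg (lt_irrefl l)]
  field_simp
  ring

end initial

/-! ### Cancellation, and the initial condition -/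

/-- The rankings in `stageSet N l j` that give `o` the rank `a`. -/
def rankSet (N l j : ℕ) (o : Fin N) (a : ℕ) : Finset (Fin N → Fin (l + 2)) :=
  {κ ∈ stageSet N l j | (κ o : ℕ) = a}

theorem mem_rankSet {N l j : ℕ} {o : Fin N} {a : ℕ} {κ : Fin N → Fin (l + 2)} :
    κ ∈ rankSet N l j o a ↔ κ ∈ stageSet N l j ∧ (κ o : ℕ) = a := by
  simp [rankSet]

/-- Forget the differences between ranks in the interval from `j` to `a`. -/
def collapse {N l : ℕ} (j a : ℕ) (o : Fin N) (κ : Fin N → Fin (l + 2)) (i : Fin N) : ℕ :=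
  if i ≠ o ∧ j ≤ (κ i : ℕ) ∧ (κ i : ℕ) ≤ a then j else κ i

/-- Ranks outside the interval are kept by `collapse` and those inside become `j`, so the collapsed
values still reveal who was inside. -/
theorem crossSet_eq_of_collapse_eq {N l j a : ℕ} (hja : j ≤ a) {o : Fin N}
    {κ κ' : Fin N → Fin (l + 2)} (h : collapse j a o κ = collapse j a o κ') :
    crossSet j a κ o = crossSet j a κ' o := by
  ext i
  rw [mem_crossSet, mem_crossSet]
  have := congrFun h i
  unfold collapse at this
  split_ifs at this <;> omega

theorem collapse_swap {N l j a : ℕ} {o : Fin N} {κ : Fin N → Fin (l + 2)} {b c : Fin N}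
    (hb : b ∈ crossSet j a κ o) (hc : c ∈ crossSet j a κ o) :
    collapse j a o (κ ∘ Equiv.swap b c) = collapse j a o κ := by
  rw [mem_crossSet] at hb hc
  ext i
  unfold collapse
  by_cases hib : i = b
  · rw [hib, Function.comp_apply, Equiv.swap_apply_left, if_pos hb, if_pos ⟨hb.1, hc.2⟩]
  · by_cases hic : i = c
    · rw [hic, Function.comp_apply, Equiv.swap_apply_right, if_pos hc, if_pos ⟨hc.1, hb.2⟩]
    · rw [Function.comp_apply, Equiv.swap_apply_of_ne_of_ne hib hic]

section initial

variable {N l : ℕ} {p q r : ℝ}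

theorem lt_of_mem_crossSet {j a : ℕ} {κ : Fin N → Fin (l + 2)} (hκ : κ ∈ stageSet N l j)
    {o b : Fin N} (ho : (o : ℕ) = j) (hb : b ∈ crossSet j a κ o) : o < b := by
  obtain ⟨hbo, h1, -⟩ := mem_crossSet.1 hb
  by_contra h
  have := Fin.val_ne_of_ne hbo
  rw [Fin.lt_def] at h
  have := (mem_stageSet.1 hκ).2 b (by omega)
  omega

theorem swap_mem_rankSet {j a : ℕ} {κ : Fin N → Fin (l + 2)} {o : Fin N} (ho : (o : ℕ) = j)
    (hκ : κ ∈ rankSet N l j o a) {b c : Fin N} (hb : b ∈ crossSet j a κ o)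
    (hc : c ∈ crossSet j a κ o) : κ ∘ Equiv.swap b c ∈ rankSet N l j o a := by
  obtain ⟨hκs, hκo⟩ := mem_rankSet.1 hκ
  have hbo := (mem_crossSet.1 hb).1
  have hco := (mem_crossSet.1 hc).1
  have hob := lt_of_mem_crossSet hκs ho hb
  have hoc := lt_of_mem_crossSet hκs ho hc
  rw [mem_rankSet, mem_stageSet]
  refine ⟨⟨(mem_stageSet.1 hκs).1.comp_perm _, fun i hi => ?_⟩, ?_⟩
  · rw [Fin.lt_def] at hob hoc
    rw [Function.comp_apply, Equiv.swap_apply_of_ne_of_ne (by rintro rfl; omega)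
      (by rintro rfl; omega), (mem_stageSet.1 hκs).2 i hi]
  · rw [Function.comp_apply, Equiv.swap_apply_of_ne_of_ne hbo.symm hco.symm, hκo]

variable (hp : 0 ≤ p) (hq : 0 < q) (hpq : p + q = 1) (hr0 : 0 < r) (hr : p + r < q * r ^ 2)
  {ρ : Fin N → ℝ} (hρ : ∀ i, r < ρ i)

include hp hq hpq hr0 hr hρ

/-- Rankings with the same `collapse` share the set `B`, hence the denominator, and each such class
is closed under exchanging ranks within `B`. The numerator summed over a class is therefore
antisymmetric in the sense required by `torusAvg_div_prod_f_eq_zero`. -/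
theorem sum_torusAvg_residual_eq_zero (hinj : Function.Injective ρ)
    (hρ2 : ∀ i j k, ρ i * ρ j ≠ ρ k) {j a : ℕ} (ha : a ≤ l) (hja : j ≤ a)
    (hja' : a < l → j < a) (X : ℕ → ℤ) (hX : ∀ m n, m < n → n ≤ l → X m < X n) {y : Fin N → ℤ}
    (hy : StrictMono y) {o : Fin N} (ho : (o : ℕ) = j) :
    ∑ κ ∈ rankSet N l j o a, torusAvg ρ (residual p q X a κ y o (crossSet j a κ o)) = 0 := by
  classical
  have hq' : (q : ℂ) ≠ 0 := by exact_mod_cast hq.ne'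
  have hpq' : (p : ℂ) + q = 1 := by exact_mod_cast hpq
  rw [← sum_fiberwise_of_maps_to (g := collapse j a o)
    (t := (rankSet N l j o a).image (collapse j a o)) fun κ hκ => mem_image_of_mem _ hκ]
  refine sum_eq_zero fun v hv => ?_
  obtain ⟨κ₀, hκ₀, rfl⟩ := mem_image.1 hv
  set F := {κ ∈ rankSet N l j o a | collapse j a o κ = collapse j a o κ₀} with hF
  set B := crossSet j a κ₀ o with hB
  have hFB : ∀ κ ∈ F, crossSet j a κ o = B := fun κ hκ =>
    crossSet_eq_of_collapse_eq hja (mem_filter.1 hκ).2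
  have hFr : ∀ κ ∈ F, κ ∈ rankSet N l j o a := fun κ hκ => (mem_filter.1 hκ).1
  rw [sum_congr rfl fun κ hκ => by rw [hFB κ hκ]]
  have hoB : o ∉ B := fun h => (mem_crossSet.1 h).1 rfl
  rcases B.eq_empty_or_nonempty with hBe | hBne
  · refine sum_eq_zero fun κ hκ => ?_
    obtain ⟨hs, hκo⟩ := mem_rankSet.1 (hFr κ hκ)
    -- For `a < l` the set `B` cannot be empty, because some index other than `o` must have rank
    -- `j`. For `a = l` an empty `B` leaves nothing after the subtraction, as `crossFactor` is then
    -- `1 - 1`.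
    by_cases hal : a < l
    · obtain ⟨i, hi, -⟩ := (mem_stageSet.1 hs).1 ⟨j, by omega⟩ (by have := hja' hal; simp; omega)
      have hij : (κ i : ℕ) = j := by rw [hi]
      have : i ∈ B := by
        rw [← hFB κ hκ, mem_crossSet]
        refine ⟨?_, by omega, by omega⟩
        rintro rfl
        have := hja' hal
        omega
      rw [hBe] at this
      exact absurd this (notMem_empty i)
    · have : ∀ ξ, residual p q X a κ y o B ξ = 0 := fun ξ => by
        simp [residual, residualNum, crossFactor, hal, hBe, crossNum]
      simp [torusAvg, this]
  rw [← torusAvg_sum F fun κ _ => continuous_comp_torusPoint hρ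
    (continuousOn_residual hp hq hpq hr0 hr X a κ y o B)]
  have hrw : ∀ ξ, ∑ κ ∈ F, residual p q X a κ y o B ξ =
      (∑ κ ∈ F, residualNum p q X a κ y o B ξ) / ((1 - ξ o) * ∏ b ∈ B, f p q (ξ o) (ξ b)) :=
    fun ξ => by simp only [residual, sum_div]
  simp only [hrw]
  refine torusAvg_div_prod_f_eq_zero (Θ := fun ξ => ∑ κ ∈ F, residualNum p q X a κ y o B ξ)
    hp hq hpq hr0 hr hρ hinj hρ2 hoB hBne ?_ ?_ ?_ ?_
  · exact DifferentiableOn.fun_sum fun κ _ =>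
      differentiableOn_residualNum hp hq hpq hr0 hr X a κ y o B
  · intro ξ _ h1
    refine sum_eq_zero fun κ _ => ?_
    rw [residualNum, crossFactor_eq_zero hq' hpq' a κ o B h1, mul_zero, zero_mul]
  · intro ξ hξ b hb c hc hbc h
    have hneg : ∑ κ ∈ F, residualNum p q X a κ y o B ξ =
        ∑ κ ∈ F, -residualNum p q X a κ y o B ξ := by
      refine sum_nbij' (fun κ => κ ∘ Equiv.swap b c) (fun κ => κ ∘ Equiv.swap b c) ?_ ?_ ?_ ?_ ?_
      · intro κ hκ
        rw [← hFB κ hκ] at hb hc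
        exact mem_filter.2 ⟨swap_mem_rankSet ho (hFr κ hκ) hb hc,
          (collapse_swap hb hc).trans (mem_filter.1 hκ).2⟩
      · intro κ hκ
        rw [← hFB κ hκ] at hb hc
        exact mem_filter.2 ⟨swap_mem_rankSet ho (hFr κ hκ) hb hc,
          (collapse_swap hb hc).trans (mem_filter.1 hκ).2⟩
      · intro κ _
        ext i; simp
      · intro κ _
        ext i; simp
      · intro κ hκ
        have hb' := hb
        have hc' := hc
        rw [← hFB κ hκ, mem_crossSet] at hb' hc'
        rw [residualNum_swap hp hq hr0 hr X a y hoB hb hc hbc (hb'.2.2.trans ha)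
          (hc'.2.2.trans ha) hξ h, neg_neg]
    rw [sum_neg_distrib] at hneg
    exact self_eq_neg.1 hneg
  · intro ξ hξ b hb s _
    refine Asymptotics.IsBigO.fun_sum fun κ hκ => ?_
    have hb' := hb
    rw [← hFB κ hκ] at hb'
    obtain ⟨hbo, h1, h2⟩ := mem_crossSet.1 hb'
    obtain ⟨hs, hκo⟩ := mem_rankSet.1 (hFr κ hκ)
    refine isBigO_residualNum hp hq hr0 hr X ha hX hoB hb ?_
      (hy (lt_of_mem_crossSet hs ho hb')) hξ s
    rcases h2.lt_or_eq with h | h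
    · exact Or.inl h
    · refine Or.inr ⟨h, ?_⟩
      by_contra hal
      exact hbo ((mem_stageSet.1 hs).1.injOn (by omega) (Fin.ext (h.trans hκo.symm)))

/-- Ranks of `o` below `j` are already used up, intermediate ones cancel among themselves, and `l`
cancels against `l + 1`. The rank `j` is left, unless `j = l`, when it belongs to the cancelling
pair. -/
theorem sum_stageSet_of_lt (hinj : Function.Injective ρ)
    (hρ2 : ∀ i j k, ρ i * ρ j ≠ ρ k) {j : ℕ} (hjl : j ≤ l) (X : ℕ → ℤ)
    (hX : ∀ m n, m < n → n ≤ l → X m < X n) {y : Fin N → ℤ}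
    (hy : StrictMono y) {o : Fin N} (ho : (o : ℕ) = j) (hyo : y o < X l) :
    ∑ κ ∈ stageSet N l j, torusAvg ρ (term p q X κ y 0) =
      if j < l then ∑ κ ∈ stageSet N l (j + 1), torusAvg ρ (term p q X κ y 0) else 0 := by
  classical
  have hfib : ∑ κ ∈ stageSet N l j, torusAvg ρ (term p q X κ y 0) =
      ∑ a ∈ range (l + 2), ∑ κ ∈ rankSet N l j o a, torusAvg ρ (term p q X κ y 0) := by
    rw [← sum_fiberwise_of_maps_to (g := fun κ : Fin N → Fin (l + 2) => (κ o : ℕ))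
      (t := range (l + 2)) fun κ _ => mem_range.2 (κ o).2]
    rfl
  have hsmall : ∀ a < j, ∑ κ ∈ rankSet N l j o a, torusAvg ρ (term p q X κ y 0) = 0 := by
    intro a ha
    refine sum_eq_zero fun κ hκ => ?_
    obtain ⟨hs, hκo⟩ := mem_rankSet.1 hκ
    have := le_rank_of_mem_stageSet hjl hs ho.ge
    omega
  have hmid : ∀ a, j < a → a < l →
      ∑ κ ∈ rankSet N l j o a, torusAvg ρ (term p q X κ y 0) = 0 := by
    intro a hja hal
    rw [← sum_torusAvg_residual_eq_zero hp hq hpq hr0 hr hρ hinj hρ2 hal.le hja.le (fun _ => hja) X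
      hX hy ho]
    refine sum_congr rfl fun κ hκ => ?_
    obtain ⟨hs, hκo⟩ := mem_rankSet.1 hκ
    exact term_eq_residual hp hpq hr0 hr hρ hjl X hs y ho hal hja.le hκo
  have htop : ∑ κ ∈ rankSet N l j o l, torusAvg ρ (term p q X κ y 0) +
      ∑ κ ∈ rankSet N l j o (l + 1), torusAvg ρ (term p q X κ y 0) = 0 := by
    rw [← sum_torusAvg_residual_eq_zero hp hq hpq hr0 hr hρ hinj hρ2 le_rfl hjl
      (fun h => absurd h (lt_irrefl l)) X hX hy ho]
    -- Moving `o` out of the set of rank `l` is a bijection, since the ranks `l` and `l + 1` carry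
    -- no uniqueness condition.
    have hbij : ∑ κ ∈ rankSet N l j o (l + 1), torusAvg ρ (term p q X κ y 0) =
        ∑ κ ∈ rankSet N l j o l,
          torusAvg ρ (term p q X (Function.update κ o (Fin.last (l + 1))) y 0) := by
      symm
      have hstage : ∀ κ ∈ stageSet N l j, l ≤ (κ o : ℕ) → ∀ v : Fin (l + 2), l ≤ (v : ℕ) →
          Function.update κ o v ∈ rankSet N l j o v := by
        intro κ hκ hκo v hv
        rw [mem_rankSet, mem_stageSet]
        rw [mem_stageSet] at hκ
        refine ⟨⟨hκ.1.update hκo hv, fun i hi => ?_⟩, by simp⟩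
        rw [Function.update_of_ne (by rintro rfl; omega), hκ.2 i hi]
      refine sum_nbij' (fun κ => Function.update κ o (Fin.last (l + 1)))
        (fun κ => Function.update κ o ⟨l, by omega⟩) ?_ ?_ ?_ ?_ ?_
      · intro κ hκ
        obtain ⟨hs, hκo⟩ := mem_rankSet.1 hκ
        exact hstage κ hs hκo.ge (Fin.last (l + 1)) (by simp)
      · intro κ hκ
        obtain ⟨hs, hκo⟩ := mem_rankSet.1 hκ
        exact hstage κ hs (by omega) ⟨l, by omega⟩ le_rfl
      · intro κ hκ
        obtain ⟨hs, hκo⟩ := mem_rankSet.1 hκ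
        simp only [Function.update_idem]
        rw [Function.update_eq_iff]
        exact ⟨Fin.ext hκo.symm, fun _ _ => rfl⟩
      · intro κ hκ
        obtain ⟨hs, hκo⟩ := mem_rankSet.1 hκ
        simp only [Function.update_idem]
        rw [Function.update_eq_iff]
        exact ⟨Fin.ext (by simp [hκo]), fun _ _ => rfl⟩
      · intro κ _
        rfl
    rw [hbij, ← sum_add_distrib]
    refine sum_congr rfl fun κ hκ => ?_
    obtain ⟨hs, hκo⟩ := mem_rankSet.1 hκ
    exact term_add_absent_eq_residual hp hq hpq hr0 hr hρ hjl X hs y ho hκo hyo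
  rw [hfib, sum_range_succ, sum_range_succ, add_assoc, htop, add_zero]
  split_ifs with h
  · rw [sum_eq_single j]
    · congr 1
      ext κ
      simp only [mem_rankSet, mem_stageSet]
      constructor
      · rintro ⟨⟨h1, h2⟩, h3⟩
        refine ⟨h1, fun i hi => ?_⟩
        rcases Nat.lt_succ_iff_lt_or_eq.1 hi with h4 | h4
        · exact h2 i h4
        · have : i = o := Fin.ext (by omega)
          rw [this, h3, ho]
      · rintro ⟨h1, h2⟩
        exact ⟨⟨h1, fun i hi => h2 i (by omega)⟩, by rw [h2 o (by omega), ho]⟩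
    · intro a ha hne
      rcases lt_or_gt_of_ne hne with h1 | h1
      · exact hsmall a h1
      · exact hmid a h1 (mem_range.1 ha)
    · intro h1
      exact absurd (mem_range.2 h) h1
  · refine sum_eq_zero fun a ha => hsmall a ?_
    have := mem_range.1 ha
    omega

theorem torusAvg_term_rank (X : ℕ → ℤ) {κ : Fin N → Fin (l + 2)}
    (hκ1 : ∀ i : Fin N, (i : ℕ) < l → (κ i : ℕ) = i)
    (hκ2 : ∀ i : Fin N, l ≤ (i : ℕ) → (κ i : ℕ) = l + 1) {y : Fin N → ℤ}
    (hy : ∀ i : Fin N, (i : ℕ) < l → y i ≤ X i) :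
    torusAvg ρ (term p q X κ y 0) = if ∀ i : Fin N, (i : ℕ) < l → y i = X i then 1 else 0 := by
  have hterm : ∀ ξ, term p q X κ y 0 ξ =
      ∏ i : Fin N, if (i : ℕ) < l then ξ i ^ (X i - y i) else 1 := by
    intro ξ
    have h1 : pairProd univ (edgeWeight p q κ ξ) = 1 := by
      refine prod_eq_one fun i _ => prod_eq_one fun k hk => ?_
      have hik := (mem_filter.1 hk).2
      rw [edgeWeight, if_pos hik, pairWeight]
      rw [Fin.lt_def] at hik
      by_cases hk' : (k : ℕ) < l
      · rw [hκ1 k hk', hκ1 i (by omega), if_neg (by omega), if_neg (by omega), if_pos hik]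
      · rw [hκ2 k (by omega), if_pos (by omega)]
    rw [term, h1, one_mul]
    refine prod_congr rfl fun i _ => ?_
    split_ifs with h
    · rw [hκ1 i h, siteWeight_zero X h.le, if_neg h.ne, mul_one]
    · rw [siteWeight, hκ2 i (by omega), if_pos (by omega)]
  have hd := differentiableOn_term hp hq hpq hr0 hr X κ y 0
  split_ifs with h
  · have : ∀ ξ, term p q X κ y 0 ξ = 1 := fun ξ => by
      rw [hterm]
      refine prod_eq_one fun i _ => ?_
      split_ifs with hi
      · rw [h i hi, sub_self, zpow_zero]
      · rfl
    simp [torusAvg, this]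
  · push Not at h
    obtain ⟨i, hi, hne⟩ := h
    refine torusAvg_eq_zero hρ hd.continuousOn i fun ξ hξ => ?_
    have : (fun z => term p q X κ y 0 (Function.update ξ i z)) =
        (∏ k ∈ univ.erase i, if (k : ℕ) < l then ξ k ^ (X k - y k) else 1) •
          fun z : ℂ => z ^ (X i - y i) := by
      ext z
      rw [hterm, ← prod_erase_mul _ _ (mem_univ i), Function.update_self, if_pos hi,
        Pi.smul_apply, smul_eq_mul]
      congr 1
      exact prod_congr rfl fun k hk => by rw [Function.update_of_ne (ne_of_mem_erase hk)]
    have hyi := hy i hi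
    rw [this, Real.circleAverage_smul, circleAverage_zpow (hr0.trans (hρ i)) (by omega), smul_zero]

/-- As long as `y i ≤ X i`, the next index can be settled, because then `y i < X l`. If some `j < l`
has `y j > X j`, the first such `j` stops this: the holder `b` of rank `j` satisfies `j ≤ b`, so its
variable decays and every term vanishes. Otherwise the stage `l` is reached, and the position of `y
l` relative to `X l` decides. -/
theorem sum_term_initial_of_injective (hinj : Function.Injective ρ)
    (hρ2 : ∀ i j k, ρ i * ρ j ≠ ρ k) (hlN : l + 1 ≤ N) (X : ℕ → ℤ)
    (hX : ∀ m n, m < n → n ≤ l → X m < X n) {y : Fin N → ℤ} (hy : StrictMono y) :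
    ∑ κ ∈ stageSet N l 0, torusAvg ρ (term p q X κ y 0) =
      if (∀ i : Fin N, (i : ℕ) < l → y i = X i) ∧ X l ≤ y ⟨l, by omega⟩ then 1 else 0 := by
  have hstep : ∀ j, j ≤ l → (∀ i : Fin N, (i : ℕ) < j → y i ≤ X i) →
      ∑ κ ∈ stageSet N l 0, torusAvg ρ (term p q X κ y 0) =
        ∑ κ ∈ stageSet N l j, torusAvg ρ (term p q X κ y 0) := by
    intro j
    induction j with
    | zero => intro _ _; rfl
    | succ j ih =>
      intro hj h
      rw [ih (by omega) fun i hi => h i (by omega)]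
      have h1 := h ⟨j, by omega⟩ (by simp)
      have h2 := hX j l (by omega) le_rfl
      have hjN : j < N := by omega
      rw [sum_stageSet_of_lt hp hq hpq hr0 hr hρ hinj hρ2 (j := j) (by omega) X hX hy
        (o := (⟨j, hjN⟩ : Fin N)) rfl (h1.trans_lt h2), if_pos (by omega)]
  by_cases hall : ∀ i : Fin N, (i : ℕ) < l → y i ≤ X i
  · rw [hstep l le_rfl hall]
    by_cases hl : X l ≤ y ⟨l, by omega⟩
    · set κs : Fin N → Fin (l + 2) := fun i =>
        if h : (i : ℕ) < l then ⟨i, by omega⟩ else Fin.last (l + 1) with hκs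
      have hs1 : ∀ i : Fin N, (i : ℕ) < l → (κs i : ℕ) = i := fun i hi => by simp [hκs, hi]
      have hs2 : ∀ i : Fin N, l ≤ (i : ℕ) → (κs i : ℕ) = l + 1 := fun i hi => by
        simp [hκs, hi.not_gt]
      have hmem : κs ∈ stageSet N l l := by
        rw [mem_stageSet]
        refine ⟨fun a ha => ⟨⟨a, by omega⟩, Fin.ext (hs1 _ ha), fun i hi => Fin.ext ?_⟩, hs1⟩
        have h1 : (κs i : ℕ) = a := by rw [hi]
        by_cases h2 : (i : ℕ) < l
        · rw [hs1 i h2] at h1; exact h1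
        · rw [hs2 i (by omega)] at h1; omega
      rw [sum_eq_single κs]
      · rw [torusAvg_term_rank hp hq hpq hr0 hr hρ X hs1 hs2 hall]
        simp only [hl, and_true]
      · intro κ hκ hne
        -- Any other ranking has an index `b` of rank `l`; as `y b ≥ X l`, the additional decay from
        -- `(1 - ξ b)⁻¹` makes the term vanish.
        have hb : ∃ b : Fin N, l ≤ (b : ℕ) ∧ (κ b : ℕ) ≠ l + 1 := by
          by_contra! h
          refine hne (funext fun i => Fin.ext ?_)
          by_cases hi : (i : ℕ) < l
          · rw [(mem_stageSet.1 hκ).2 i hi, hs1 i hi]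
          · rw [h i (by omega), hs2 i (by omega)]
        obtain ⟨b, hb1, hb2⟩ := hb
        have hb3 := le_rank_of_mem_stageSet le_rfl hκ hb1
        have hb4 : (κ b : ℕ) = l := by have := (κ b).2; omega
        refine torusAvg_term_eq_zero hp hq hpq hr0 hr hρ X κ y (b := b) hb4.le ?_
        rw [if_pos hb4, hb4]
        have : y ⟨l, by omega⟩ ≤ y b := hy.monotone (Fin.le_def.2 hb1)
        omega
      · intro h
        exact absurd hmem h
    · rw [sum_stageSet_of_lt hp hq hpq hr0 hr hρ hinj hρ2 le_rfl X hX hy (o := ⟨l, by omega⟩) rfl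
        (by omega), if_neg (lt_irrefl l), if_neg (fun h => hl h.2)]
  · have hall' := hall
    push Not at hall
    have hex : ∃ j : ℕ, ∃ h : j < l, X j < y ⟨j, by omega⟩ := by
      obtain ⟨i, hi, h⟩ := hall
      exact ⟨i, hi, h⟩
    classical
    obtain ⟨hj, hyj⟩ := Nat.find_spec hex
    set j := Nat.find hex with hjdef
    have hmin : ∀ i : Fin N, (i : ℕ) < j → y i ≤ X i := by
      intro i hi
      by_contra! h
      exact Nat.find_min hex hi ⟨by omega, h⟩
    rw [hstep j hj.le hmin, if_neg fun h => hall' fun i hi => (h.1 i hi).le]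
    refine sum_eq_zero fun κ hκ => ?_
    obtain ⟨b, hb, -⟩ := (mem_stageSet.1 hκ).1 ⟨j, by omega⟩ hj
    have hb' : (κ b : ℕ) = j := by rw [hb]
    have hjb : j ≤ (b : ℕ) := by
      by_contra! h
      have := (mem_stageSet.1 hκ).2 b h
      omega
    refine torusAvg_term_eq_zero hp hq hpq hr0 hr hρ X κ y (b := b) (by omega) ?_
    rw [if_neg (by omega), hb']
    exact hyj.trans_le (hy.monotone (Fin.le_def.2 hjb))

end initial

/-- The initial condition. -/
theorem sum_term_initial {N l : ℕ} {p q r : ℝ} (hp : 0 ≤ p) (hq : 0 < q) (hpq : p + q = 1)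
    (hr0 : 0 < r) (hr : p + r < q * r ^ 2) {R : ℝ} (hR : r < R) (hlN : l + 1 ≤ N) (X : ℕ → ℤ)
    (hX : ∀ m n, m < n → n ≤ l → X m < X n) {y : Fin N → ℤ} (hy : StrictMono y) :
    ∑ κ ∈ stageSet N l 0, torusAvg (fun _ => R) (term p q X κ y 0) =
      if (∀ i : Fin N, (i : ℕ) < l → y i = X i) ∧ X l ≤ y ⟨l, by omega⟩ then 1 else 0 := by
  have hr1 := one_lt_of_radius hp hpq hr0 hr
  have hR1 : 1 < R := hr1.trans hR
  have hN : (0 : ℝ) < N := by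
    have : 0 < N := by omega
    exact_mod_cast this
  -- Distinct radii in the interval from `R` to `R ^ 2`, the right end excluded: a product of two of
  -- them is at least `R ^ 2` and so never a third. Holomorphy allows the change from equal radii.
  set ρ : Fin N → ℝ := fun i => R + (R ^ 2 - R) * ((i : ℝ) / N) with hρdef
  have hδ : 0 < R ^ 2 - R := by nlinarith
  have hge : ∀ i, R ≤ ρ i := fun i => by
    have : (0 : ℝ) ≤ (i : ℝ) / N := by positivity
    simp only [hρdef]
    nlinarith
  have hlt : ∀ i, ρ i < R ^ 2 := fun i => by
    have : ((i : ℕ) : ℝ) / N < 1 := by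
      rw [div_lt_one hN]
      exact_mod_cast i.2
    simp only [hρdef]
    nlinarith
  have hρ : ∀ i, r < ρ i := fun i => hR.trans_le (hge i)
  have hinj : Function.Injective ρ := by
    intro i j h
    simp only [hρdef, add_right_inj, mul_eq_mul_left_iff, hδ.ne', or_false] at h
    rw [div_left_inj' hN.ne'] at h
    exact Fin.ext (by exact_mod_cast h)
  have hρ2 : ∀ i j k, ρ i * ρ j ≠ ρ k := fun i j k h => by
    have h1 := hlt k
    have h2 : R * R ≤ ρ i * ρ j := mul_le_mul (hge i) (hge j) (by linarith) (by linarith [hge i])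
    nlinarith
  rw [← sum_term_initial_of_injective hp hq hpq hr0 hr hρ hinj hρ2 hlN X hX hy]
  refine sum_congr rfl fun κ _ => ?_
  exact torusAvg_eq_of_differentiableOn hr0.le (fun _ => hR) hρ
    (differentiableOn_term hp hq hpq hr0 hr X κ y 0)

/-! ### Evolution in time, boundary condition and growth -/

section evolution

variable {N l : ℕ} {p q r : ℝ}

/-- The sum of `ε (ξ i)` over the particles that are present. -/
def energy (p q : ℝ) (κ : Fin N → Fin (l + 2)) (ξ : Fin N → ℂ) : ℂ :=
  ∑ i, if l < (κ i : ℕ) then 0 else ε p q (ξ i)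

/-- Separates the dependence on position and on time, so that `term` is a plane wave in `y`. -/
theorem siteWeight_eq (X : ℕ → ℤ) (a : ℕ) {ξ : ℂ} (hξ : ξ ≠ 0) (y : ℤ) (t : ℝ) :
    siteWeight p q l X a ξ y t = siteWeight p q l X a ξ 0 0 *
      (if l < a then 1 else ξ ^ (-y)) * Complex.exp ((if l < a then 0 else ε p q ξ) * t) := by
  unfold siteWeight
  split_ifs <;> (simp [sub_eq_add_neg, zpow_add₀ hξ]; try ring)

theorem term_eq (X : ℕ → ℤ) (κ : Fin N → Fin (l + 2)) {ξ : Fin N → ℂ} (hξ : ∀ i, ξ i ≠ 0)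
    (y : Fin N → ℤ) (t : ℝ) :
    term p q X κ y t ξ = term p q X κ 0 0 ξ *
      (∏ i, if l < (κ i : ℕ) then 1 else ξ i ^ (-y i)) * Complex.exp (energy p q κ ξ * t) := by
  unfold term energy
  rw [sum_mul, Complex.exp_sum, mul_assoc, mul_assoc, ← prod_mul_distrib, ← prod_mul_distrib]
  congr 1
  refine prod_congr rfl fun i _ => ?_
  rw [siteWeight_eq X _ (hξ i), mul_assoc]
  rfl

theorem term_add_single (X : ℕ → ℤ) (κ : Fin N → Fin (l + 2)) {ξ : Fin N → ℂ}
    (hξ : ∀ i, ξ i ≠ 0) (y : Fin N → ℤ) (t : ℝ) (i : Fin N) (d : ℤ) :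
    term p q X κ (Function.update y i (y i + d)) t ξ =
      term p q X κ y t ξ * if l < (κ i : ℕ) then 1 else ξ i ^ (-d) := by
  rw [term_eq X κ hξ, term_eq X κ hξ y]
  have : (∏ k, if l < (κ k : ℕ) then (1 : ℂ)
      else ξ k ^ (-(Function.update y i (y i + d) k))) =
      (∏ k, if l < (κ k : ℕ) then (1 : ℂ) else ξ k ^ (-y k)) *
        if l < (κ i : ℕ) then 1 else ξ i ^ (-d) := by
    rw [← prod_erase_mul _ _ (mem_univ i), ← prod_erase_mul univ
      (fun k => if l < (κ k : ℕ) then (1 : ℂ) else ξ k ^ (-y k)) (mem_univ i), mul_assoc]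
    congr 1
    · exact prod_congr rfl fun k hk => by rw [Function.update_of_ne (ne_of_mem_erase hk)]
    · rw [Function.update_self]
      split_ifs
      · simp
      · rw [neg_add, zpow_add₀ (hξ i)]
  rw [this]
  ring

/-- The free generator multiplies a term by the energy. -/
theorem sum_term_add_single (hpq : p + q = 1) (X : ℕ → ℤ) (κ : Fin N → Fin (l + 2))
    {ξ : Fin N → ℂ} (hξ : ∀ i, ξ i ≠ 0) (y : Fin N → ℤ) (t : ℝ) :
    ∑ i, (p * (term p q X κ (Function.update y i (y i + 1)) t ξ - term p q X κ y t ξ) +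
      q * (term p q X κ (Function.update y i (y i - 1)) t ξ - term p q X κ y t ξ)) =
    term p q X κ y t ξ * energy p q κ ξ := by
  unfold energy
  rw [mul_sum]
  refine sum_congr rfl fun i _ => ?_
  have hpq' : (p : ℂ) = 1 - q := by rw [eq_sub_iff_add_eq]; exact_mod_cast hpq
  rw [sub_eq_add_neg (y i), term_add_single X κ hξ, term_add_single X κ hξ]
  split_ifs
  · simp
  · rw [neg_neg, zpow_one, zpow_neg_one, ε, hpq']
    ring

variable (hp : 0 ≤ p) (hq : 0 < q) (hpq : p + q = 1) (hr0 : 0 < r) (hr : p + r < q * r ^ 2)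
include hp hq hpq hr0 hr

omit hp hq hpq hr in
theorem ne_zero_of_mem_outer {ξ : Fin N → ℂ} (hξ : ξ ∈ outer N r) (i : Fin N) : ξ i ≠ 0 :=
  norm_pos_iff.1 (hr0.trans (hξ i))

omit hp hq hpq hr in
theorem continuousOn_energy (κ : Fin N → Fin (l + 2)) :
    ContinuousOn (energy p q κ) (outer N r) := by
  unfold energy
  refine continuousOn_finsetSum _ fun i _ => ?_
  split_ifs
  · exact continuousOn_const
  · unfold ε
    have h : ContinuousOn (fun ξ : Fin N → ℂ => ξ i) (outer N r) := by fun_prop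
    have h' := h.inv₀ fun ξ hξ => ne_zero_of_mem_outer hr0 hξ i
    exact ((continuousOn_const.mul h').add (continuousOn_const.mul h)).sub continuousOn_const

omit hp hq hpq hr0 hr in
theorem hasDerivAt_integral_exp {A E : (Fin N → Angle) → ℂ} (hA : Continuous A)
    (hE : Continuous E) (t : ℝ) :
    HasDerivAt (fun t : ℝ => ∫ θ, A θ * Complex.exp (E θ * t) ∂angleMeasure N)
      (∫ θ, A θ * Complex.exp (E θ * t) * E θ ∂angleMeasure N) t := by
  have hcont : Continuous fun x : ℝ × (Fin N → Angle) =>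
      A x.2 * Complex.exp (E x.2 * x.1) * E x.2 := by fun_prop
  obtain ⟨C, hC⟩ := ((isCompact_Icc (a := t - 1) (b := t + 1)).prod
    (isCompact_univ (X := Fin N → Angle))).exists_bound_of_continuousOn hcont.continuousOn
  refine (hasDerivAt_integral_of_dominated_loc_of_deriv_le
    (F' := fun (t : ℝ) θ => A θ * Complex.exp (E θ * t) * E θ)
    (Icc_mem_nhds (by linarith : t - 1 < t) (by linarith : t < t + 1))
    (Eventually.of_forall fun s => Continuous.aestronglyMeasurable (by fun_prop))
    (integrable_angle (by fun_prop)) (Continuous.aestronglyMeasurable (by fun_prop))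
    (bound := fun _ => C)
    (Eventually.of_forall fun θ s hs => hC (s, θ) ⟨hs, trivial⟩) (integrable_const _)
    (Eventually.of_forall fun θ s _ => ?_)).2
  have h1 : HasDerivAt (fun s : ℝ => E θ * (s : ℂ)) (E θ) s := by
    simpa using (Complex.ofRealCLM.hasDerivAt (x := s)).const_mul (E θ)
  have := (h1.cexp).const_mul (A θ)
  rwa [← mul_assoc] at this

/-- The sum of the averages of all terms over the torus of radius `R`. -/
def rankSum (N l : ℕ) (p q R : ℝ) (X : ℕ → ℤ) (y : Fin N → ℤ) (t : ℝ) : ℂ :=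
  ∑ κ ∈ stageSet N l 0, torusAvg (fun _ => R) (term p q X κ y t)

theorem continuous_term {R : ℝ} (hR : r < R) (X : ℕ → ℤ) (κ : Fin N → Fin (l + 2))
    (y : Fin N → ℤ) (t : ℝ) :
    Continuous fun θ => term p q X κ y t (torusPoint (fun _ => R) θ) :=
  continuous_comp_torusPoint (fun _ => hR)
    (differentiableOn_term hp hq hpq hr0 hr X κ y t).continuousOn

theorem hasDerivAt_torusAvg_term {R : ℝ} (hR : r < R) (X : ℕ → ℤ) (κ : Fin N → Fin (l + 2))
    (y : Fin N → ℤ) (t : ℝ) :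
    HasDerivAt (fun t => torusAvg (fun _ => R) (term p q X κ y t))
      (∑ i, (p * (torusAvg (fun _ => R) (term p q X κ (Function.update y i (y i + 1)) t) -
          torusAvg (fun _ => R) (term p q X κ y t)) +
        q * (torusAvg (fun _ => R) (term p q X κ (Function.update y i (y i - 1)) t) -
          torusAvg (fun _ => R) (term p q X κ y t)))) t := by
  have hmem := fun θ => torusPoint_mem_outer (ρ := fun _ : Fin N => R) (fun _ => hR) θ
  have hne := fun θ i => ne_zero_of_mem_outer hr0 (hmem θ) i
  have hexp : ∀ t θ, term p q X κ y t (torusPoint (fun _ => R) θ) =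
      term p q X κ y 0 (torusPoint (fun _ => R) θ) *
        Complex.exp (energy p q κ (torusPoint (fun _ => R) θ) * (t : ℝ)) := fun t θ => by
    rw [term_eq X κ (hne θ) y t, term_eq X κ (hne θ) y 0]
    simp
  have hc := fun y t => continuous_term hp hq hpq hr0 hr hR X κ y t
  have h := hasDerivAt_integral_exp (hc y 0)
    (continuous_comp_torusPoint (ρ := fun _ : Fin N => R) (fun _ => hR)
      (continuousOn_energy (p := p) (q := q) hr0 κ)) t
  simp only [← hexp] at h
  refine h.congr_deriv ?_
  calc _ = torusAvg (fun _ => R) fun ξ => ∑ i,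
        (p * (term p q X κ (Function.update y i (y i + 1)) t ξ - term p q X κ y t ξ) +
          q * (term p q X κ (Function.update y i (y i - 1)) t ξ - term p q X κ y t ξ)) :=
        integral_congr_ae (Eventually.of_forall fun θ =>
          (sum_term_add_single hpq X κ (hne θ) y t).symm)
    _ = _ := by
        have h1 := fun i => hc (Function.update y i (y i + 1)) t
        have h2 := fun i => hc (Function.update y i (y i - 1)) t
        have h3 := hc y t
        rw [torusAvg_sum _ fun i _ => by have := h1 i; have := h2 i; fun_prop]
        refine sum_congr rfl fun i _ => ?_
        have := h1 i
        have := h2 i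
        rw [torusAvg_add (by fun_prop) (by fun_prop), torusAvg_const_mul, torusAvg_const_mul,
          torusAvg_sub (by fun_prop) (by fun_prop), torusAvg_sub (by fun_prop) (by fun_prop)]

theorem hasDerivAt_rankSum {R : ℝ} (hR : r < R) (X : ℕ → ℤ) (y : Fin N → ℤ) (t : ℝ) :
    HasDerivAt (rankSum N l p q R X y)
      (∑ i, (p * (rankSum N l p q R X (Function.update y i (y i + 1)) t -
          rankSum N l p q R X y t) +
        q * (rankSum N l p q R X (Function.update y i (y i - 1)) t -
          rankSum N l p q R X y t))) t := by
  have := HasDerivAt.fun_sum fun κ (_ : κ ∈ stageSet N l 0) =>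
    hasDerivAt_torusAvg_term hp hq hpq hr0 hr hR X κ y t
  refine this.congr_deriv ?_
  rw [sum_comm]
  refine sum_congr rfl fun i _ => ?_
  simp only [rankSum, sum_add_distrib, ← mul_sum, sum_sub_distrib]

/-- All radii are equal, so the variables may be permuted along with the ranks. By `term_boundary`
the sum of the boundary expressions over all rankings is then its own negative. -/
theorem rankSum_boundary {R : ℝ} (hR : r < R) (X : ℕ → ℤ) {i i' : Fin N}
    (hi : (i' : ℕ) = i + 1) (y : Fin N → ℤ) (hy : y i' = y i + 1) (t : ℝ) :
    p * rankSum N l p q R X (Function.update y i (y i + 1)) t +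
      q * rankSum N l p q R X (Function.update y i' (y i' - 1)) t = rankSum N l p q R X y t := by
  set s := Equiv.swap i i' with hs
  set H : (Fin N → Fin (l + 2)) → (Fin N → ℂ) → ℂ := fun κ ξ =>
    p * term p q X κ (Function.update y i (y i + 1)) t ξ +
      q * term p q X κ (Function.update y i' (y i' - 1)) t ξ - term p q X κ y t ξ with hH
  have hc := fun (κ : Fin N → Fin (l + 2)) y => continuous_term hp hq hpq hr0 hr hR X κ y t
  have hsum : ∑ κ ∈ stageSet N l 0, torusAvg (fun _ => R) (H κ) =
      p * rankSum N l p q R X (Function.update y i (y i + 1)) t +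
      q * rankSum N l p q R X (Function.update y i' (y i' - 1)) t - rankSum N l p q R X y t := by
    unfold rankSum
    rw [mul_sum, mul_sum, ← sum_add_distrib, ← sum_sub_distrib]
    refine sum_congr rfl fun κ _ => ?_
    have h1 := hc κ (Function.update y i (y i + 1))
    have h2 := hc κ (Function.update y i' (y i' - 1))
    have h3 := hc κ y
    rw [hH, torusAvg_sub (by fun_prop) (by fun_prop), torusAvg_add (by fun_prop) (by fun_prop),
      torusAvg_const_mul, torusAvg_const_mul]
  have hanti : ∀ κ, torusAvg (fun _ => R) (H (κ ∘ s)) = -torusAvg (fun _ => R) (H κ) := fun κ => by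
    rw [← torusAvg_comp_perm R (H (κ ∘ s)) s, ← torusAvg_neg]
    refine torusAvg_congr (r := r) (fun _ => hR) fun ξ hξ _ => ?_
    exact term_boundary (by exact_mod_cast hq.ne') (by exact_mod_cast hpq) X κ hi
      (ne_zero_of_mem_outer hr0 hξ) (fun j k => f_ne_zero hp hq hr0 hr (hξ j).le (hξ k).le) y hy t
  have hre : ∑ κ ∈ stageSet N l 0, torusAvg (fun _ => R) (H (κ ∘ s)) =
      ∑ κ ∈ stageSet N l 0, torusAvg (fun _ => R) (H κ) := by
    refine sum_nbij' (fun κ => κ ∘ s) (fun κ => κ ∘ s) ?_ ?_ ?_ ?_ fun _ _ => rfl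
    · exact fun κ hκ => mem_stageSet.2 ⟨(mem_stageSet.1 hκ).1.comp_perm s, by simp⟩
    · exact fun κ hκ => mem_stageSet.2 ⟨(mem_stageSet.1 hκ).1.comp_perm s, by simp⟩
    · exact fun κ _ => by ext; simp [s]
    · exact fun κ _ => by ext; simp [s]
  simp only [hanti, sum_neg_distrib] at hre
  rw [← sub_eq_zero, ← hsum]
  exact CharZero.neg_eq_self_iff.1 hre

theorem norm_rankSum_le {R : ℝ} (hR : r < R) (X : ℕ → ℤ) (T : ℝ) :
    ∃ C, 0 ≤ C ∧ ∀ t ∈ Set.Icc 0 T, ∀ y : Fin N → ℤ,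
      ‖rankSum N l p q R X y t‖ ≤ C * ∏ i, R ^ |y i| := by
  have hR1 : 1 < R := (one_lt_of_radius hp hpq hr0 hr).trans hR
  have hmem := fun θ => torusPoint_mem_outer (ρ := fun _ : Fin N => R) (fun _ => hR) θ
  have hne := fun θ i => ne_zero_of_mem_outer hr0 (hmem θ) i
  have key : ∀ κ : Fin N → Fin (l + 2), ∃ C, 0 ≤ C ∧ ∀ t ∈ Set.Icc 0 T, ∀ y : Fin N → ℤ,
      ‖torusAvg (fun _ => R) (term p q X κ y t)‖ ≤ C * ∏ i, R ^ |y i| := by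
    intro κ
    have hcont : Continuous fun x : ℝ × (Fin N → Angle) =>
        term p q X κ 0 0 (torusPoint (fun _ => R) x.2) *
          Complex.exp (energy p q κ (torusPoint (fun _ => R) x.2) * x.1) := by
      have h1 := continuous_term hp hq hpq hr0 hr hR X κ 0 0
      have h2 := continuous_comp_torusPoint (ρ := fun _ : Fin N => R) (fun _ => hR)
        (continuousOn_energy (p := p) (q := q) hr0 κ)
      have h3 := h1.comp (continuous_snd (X := ℝ))
      have h4 := h2.comp (continuous_snd (X := ℝ))
      simp only [Function.comp_def] at h3 h4
      fun_prop
    obtain ⟨C, hC⟩ := ((isCompact_Icc (a := (0 : ℝ)) (b := T)).prod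
      (isCompact_univ (X := Fin N → Angle))).exists_bound_of_continuousOn hcont.continuousOn
    refine ⟨max C 0, le_max_right _ _, fun t ht y => ?_⟩
    have hb : ∀ θ, ‖term p q X κ y t (torusPoint (fun _ => R) θ)‖ ≤
        max C 0 * ∏ i, R ^ |y i| := fun θ => by
      rw [term_eq X κ (hne θ) y t, mul_right_comm, norm_mul]
      refine mul_le_mul ((hC (t, θ) ⟨ht, trivial⟩).trans (le_max_left _ _)) ?_ (norm_nonneg _)
        (le_max_right _ _)
      rw [norm_prod]
      refine prod_le_prod (fun _ _ => norm_nonneg _) fun i _ => ?_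
      split_ifs
      · rw [norm_one]
        exact one_le_zpow₀ hR1.le (abs_nonneg _)
      · rw [norm_zpow, norm_torusPoint, abs_of_pos (by linarith)]
        exact zpow_le_zpow_right₀ hR1.le (neg_le_abs _)
    refine (norm_integral_le_of_norm_le_const (Eventually.of_forall hb)).trans_eq ?_
    simp
  choose C hC0 hC using key
  refine ⟨∑ κ ∈ stageSet N l 0, C κ, sum_nonneg fun κ _ => hC0 κ, fun t ht y => ?_⟩
  rw [sum_mul]
  exact (norm_sum_le _ _).trans (sum_le_sum fun κ _ => hC κ t ht y)

end evolution

/-! ### The exclusion rule as a boundary condition, and uniqueness -/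

section generator

variable {N : ℕ}

/-- The generator of the exclusion process acting on arbitrary functions. -/
def generatorFun (p q : ℝ) (u : Config N → ℂ) (Y : Config N) : ℂ :=
  ∑ i, (p * (u (jump i 1 Y) - u Y) + q * (u (jump i (-1) Y) - u Y))

theorem jump_val (i : Fin N) (d : ℤˣ) (Y : Config N) (h : ∀ j, Y.1 j ≠ Y.1 i + d) :
    (jump i d Y).1 = Function.update Y.1 i (Y.1 i + d) := by
  rw [jump, dif_pos h]

theorem jump_of_occupied {i j : Fin N} {d : ℤˣ} {Y : Config N} (h : Y.1 j = Y.1 i + d) :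
    jump i d Y = Y := by
  rw [jump, dif_neg fun h' => h' j h]

theorem jump_right_val {i : Fin N} {Y : Config N}
    (h : ∀ i' : Fin N, (i' : ℕ) = i + 1 → Y.1 i' ≠ Y.1 i + 1) :
    (jump i 1 Y).1 = Function.update Y.1 i (Y.1 i + 1) := by
  refine jump_val i 1 Y fun j hj => ?_
  simp only [Units.val_one] at hj
  have hij : i < j := Y.2.lt_iff_lt.1 (by omega)
  have hi := j.2
  have h1 := h ⟨i + 1, by omega⟩ rfl
  have h2 : Y.1 i < Y.1 ⟨i + 1, by omega⟩ := Y.2 (Fin.lt_def.2 (by simp))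
  have h3 : Y.1 ⟨i + 1, by omega⟩ ≤ Y.1 j := Y.2.monotone (Fin.le_def.2 hij)
  omega

theorem jump_left_val {i : Fin N} {Y : Config N}
    (h : ∀ i' : Fin N, (i : ℕ) = i' + 1 → Y.1 i ≠ Y.1 i' + 1) :
    (jump i (-1) Y).1 = Function.update Y.1 i (Y.1 i - 1) := by
  refine (jump_val i (-1) Y fun j hj => ?_).trans (by simp [sub_eq_add_neg])
  simp only [Units.val_neg, Units.val_one] at hj
  have hij : j < i := Y.2.lt_iff_lt.1 (by omega)
  have hij' := Fin.lt_def.1 hij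
  have hi := i.2
  have h1 := h ⟨i - 1, by omega⟩ (by simp only; omega)
  have h2 : Y.1 ⟨i - 1, by omega⟩ < Y.1 i := Y.2 (Fin.lt_def.2 (by simp only; omega))
  have h3 : Y.1 j ≤ Y.1 ⟨i - 1, by omega⟩ := Y.2.monotone (Fin.le_def.2 (by simp only; omega))
  omega

/-- A function satisfying the boundary conditions does not feel the exclusion rule. -/
theorem generatorFun_eq_free {n : ℕ} {p q : ℂ} (hpq : p + q = 1) (u : (Fin (n + 1) → ℤ) → ℂ)
    (hu : ∀ (i i' : Fin (n + 1)) (y : Fin (n + 1) → ℤ), (i' : ℕ) = i + 1 → y i' = y i + 1 →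
      p * u (Function.update y i (y i + 1)) + q * u (Function.update y i' (y i' - 1)) = u y)
    (Y : Config (n + 1)) :
    ∑ i, (p * (u (Function.update Y.1 i (Y.1 i + 1)) - u Y.1) +
        q * (u (Function.update Y.1 i (Y.1 i - 1)) - u Y.1)) =
      ∑ i, (p * (u (jump i 1 Y).1 - u Y.1) + q * (u (jump i (-1) Y).1 - u Y.1)) := by
  set a : Fin (n + 1) → ℂ := fun i =>
    p * (u (Function.update Y.1 i (Y.1 i + 1)) - u (jump i 1 Y).1) with ha
  set b : Fin (n + 1) → ℂ := fun i =>
    q * (u (Function.update Y.1 i (Y.1 i - 1)) - u (jump i (-1) Y).1) with hb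
  have hlast : a (Fin.last n) = 0 := by
    simp only [ha]
    rw [jump_right_val fun i' hi' => absurd i'.2 (by simp at hi'; omega), sub_self, mul_zero]
  have hzero : b 0 = 0 := by
    simp only [hb]
    rw [jump_left_val fun i' hi' => absurd hi' (by simp), sub_self, mul_zero]
  -- The errors made by ignoring exclusion cancel in pairs: the blocked right jump of a particle
  -- against the blocked left jump of its right neighbour.
  have hpair : ∀ i : Fin n, a i.castSucc + b i.succ = 0 := fun i => by
    simp only [ha, hb]
    by_cases h : Y.1 i.succ = Y.1 i.castSucc + 1
    · rw [jump_of_occupied (i := i.castSucc) (j := i.succ) (by simpa using h),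
        jump_of_occupied (i := i.succ) (j := i.castSucc) (by simp [h])]
      have := hu i.castSucc i.succ Y.1 (by simp) h
      linear_combination this - u Y.1 * hpq
    · rw [jump_right_val, jump_left_val, sub_self, sub_self, mul_zero, mul_zero, add_zero]
      · intro i' hi'
        have : i' = i.castSucc := Fin.ext (by simp at hi' ⊢; omega)
        rwa [this]
      · intro i' hi'
        have : i' = i.succ := Fin.ext (by simp at hi' ⊢; omega)
        rwa [this]
  have hsum : ∑ i, (a i + b i) = 0 := by
    rw [sum_add_distrib, Fin.sum_univ_castSucc, Fin.sum_univ_succ (f := b), hlast, hzero, add_zero,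
      zero_add, ← sum_add_distrib]
    exact sum_eq_zero fun i _ => hpair i
  rw [← sub_eq_zero, ← sum_sub_distrib, ← hsum]
  refine sum_congr rfl fun i _ => ?_
  simp only [ha, hb]
  ring

/-- The weight of a configuration grows by at most a bounded factor in a jump. -/
theorem prod_zpow_jump_le {R : ℝ} (hR : 1 ≤ R) (i : Fin N) (d : ℤˣ) (Y : Config N) :
    ∏ k, R ^ |(jump i d Y).1 k| ≤ R * ∏ k, R ^ |Y.1 k| := by
  have hR0 : 0 < R := by linarith
  have hpos : 0 ≤ ∏ k, R ^ |Y.1 k| := prod_nonneg fun k _ => by positivity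
  by_cases h : ∀ j, Y.1 j ≠ Y.1 i + d
  · rw [jump_val i d Y h, ← mul_prod_erase _ _ (mem_univ i),
      ← mul_prod_erase univ (fun k => R ^ |Y.1 k|) (mem_univ i), Function.update_self, ← mul_assoc]
    have h1 : ∏ k ∈ univ.erase i, R ^ |Function.update Y.1 i (Y.1 i + d) k| =
        ∏ k ∈ univ.erase i, R ^ |Y.1 k| :=
      prod_congr rfl fun k hk => by rw [Function.update_of_ne (ne_of_mem_erase hk)]
    rw [h1]
    refine mul_le_mul_of_nonneg_right ?_ (prod_nonneg fun k _ => by positivity)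
    rw [← zpow_one_add₀ hR0.ne']
    refine zpow_le_zpow_right₀ hR ?_
    have := abs_add_le (Y.1 i) (d : ℤ)
    have hd : |(d : ℤ)| = 1 := by rcases Int.units_eq_one_or d with rfl | rfl <;> simp
    omega
  · rw [jump, dif_neg h]
    nlinarith

/-- Uniqueness for the backward equation in the class of functions of exponential growth. -/
theorem eq_zero_of_hasDerivAt_generatorFun {p q : ℝ} (hp : 0 ≤ p) (hq : 0 ≤ q) (hpq : p + q = 1)
    {D : ℝ → Config N → ℂ} (hD : ∀ t Y, HasDerivAt (fun t => D t Y) (generatorFun p q (D t) Y) t)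
    (h0 : ∀ Y, D 0 Y = 0) {R C T : ℝ} (hR : 1 ≤ R)
    (hb : ∀ t ∈ Set.Icc 0 T, ∀ Y, ‖D t Y‖ ≤ C * ∏ i, R ^ |Y.1 i|) :
    ∀ t ∈ Set.Icc 0 T, ∀ Y, D t Y = 0 := by
  set w : Config N → ℝ := fun Y => ∏ i, R ^ |Y.1 i| with hw
  -- A bound of the generator in the norm weighted by `w`: a jump multiplies `w` by at most `R`, and
  -- `p + q = 1`.
  set M : ℝ := N * (R + 1) with hM
  have hR0 : 0 < R := by linarith
  have hw0 : ∀ Y, 0 ≤ w Y := fun Y => prod_nonneg fun k _ => by positivity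
  have hgen : ∀ (u : Config N → ℂ) (c : ℝ), 0 ≤ c → (∀ Y, ‖u Y‖ ≤ c * w Y) →
      ∀ Y, ‖generatorFun p q u Y‖ ≤ c * M * w Y := fun u c hc hu Y => by
    have hjump : ∀ i d, ‖u (jump i d Y) - u Y‖ ≤ c * (R + 1) * w Y := fun i d => by
      have h1 := hu (jump i d Y)
      have h2 := mul_le_mul_of_nonneg_left (prod_zpow_jump_le hR i d Y) hc
      have h3 := norm_sub_le (u (jump i d Y)) (u Y)
      have h4 := hu Y
      simp only [hw] at *
      linarith
    calc ‖generatorFun p q u Y‖ ≤ ∑ _i : Fin N, c * (R + 1) * w Y := by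
          refine norm_sum_le_of_le _ fun i _ => ?_
          refine (norm_add_le _ _).trans ?_
          rw [norm_mul, norm_mul, Complex.norm_of_nonneg hp, Complex.norm_of_nonneg hq]
          have h1 := mul_le_mul_of_nonneg_left (hjump i 1) hp
          have h2 := mul_le_mul_of_nonneg_left (hjump i (-1)) hq
          calc _ ≤ (p + q) * (c * (R + 1) * w Y) := by linarith
            _ = _ := by rw [hpq, one_mul]
      _ = c * M * w Y := by
          rw [sum_const, card_univ, Fintype.card_fin, nsmul_eq_mul, hM]
          ring
  rcases lt_or_ge T 0 with hT | hT
  · intro t ht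
    exact absurd (ht.1.trans ht.2) (not_le.2 hT)
  rcases lt_or_ge C 0 with hC | hC
  · intro t ht Y
    have h1 := hb t ht Y
    have h2 := hw0 Y
    rw [← norm_le_zero_iff]
    exact h1.trans (mul_nonpos_of_nonpos_of_nonneg hC.le h2)
  have hM0 : 0 ≤ M := by positivity
  -- Iterated Grönwall estimate: each integration in time improves the bound by a factor `M * t / (n
  -- + 1)`.
  have key : ∀ n : ℕ, ∀ t ∈ Set.Icc 0 T, ∀ Y, ‖D t Y‖ ≤ C * (M * t) ^ n / n.factorial * w Y := by
    intro n
    induction n with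
    | zero => intro t ht Y; simpa using hb t ht Y
    | succ n ih =>
      intro t ht Y
      refine image_norm_le_of_norm_deriv_right_le_deriv_boundary (a := 0) (b := T)
        (f := fun t => D t Y) (f' := fun t => generatorFun p q (D t) Y)
        (B := fun t => C * (M * t) ^ (n + 1) / (n + 1).factorial * w Y)
        (B' := fun t => C * (M * t) ^ n / n.factorial * M * w Y)
        (fun t _ => (hD t Y).continuousAt.continuousWithinAt)
        (fun t _ => (hD t Y).hasDerivWithinAt) (by simp [h0]) (fun t => ?_) (fun t ht' => ?_) ht
      · have h1 : HasDerivAt (fun t : ℝ => (M * t) ^ (n + 1)) ((n + 1 : ℕ) * (M * t) ^ n * M) t := by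
          simpa using ((hasDerivAt_id t).const_mul M).fun_pow (n + 1)
        refine (((h1.const_mul C).div_const _).mul_const _).congr_deriv ?_
        rw [Nat.factorial_succ]
        push_cast
        have : (n.factorial : ℝ) ≠ 0 := by positivity
        field_simp
      · refine hgen (D t) _ ?_ (fun Y => ih t ⟨ht'.1, ht'.2.le⟩ Y) Y
        have := ht'.1
        positivity
  intro t ht Y
  have hlim : Tendsto (fun n : ℕ => C * (M * t) ^ n / n.factorial * w Y) atTop (𝓝 0) := by
    have := ((FloorSemiring.tendsto_pow_div_factorial_atTop (M * t)).const_mul C).mul_const (w Y)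
    simpa [mul_div_assoc] using this
  rw [← norm_le_zero_iff]
  exact ge_of_tendsto' hlim fun n => key n t ht Y

end generator

/-! ### The semigroup and the law of the process -/

section markov

variable {N : ℕ} {p q : ℝ}

theorem hasDerivAt_operatorExp_smul (g : Config N →ᵇ ℝ) (t : ℝ) :
    HasDerivAt (fun t : ℝ => operatorExp (t • generator N p q) g)
      (generator N p q (operatorExp (t • generator N p q) g)) t := by
  have h1 : HasDerivAt (fun t : ℝ => operatorExp (t • generator N p q))
      (generator N p q * operatorExp (t • generator N p q)) t :=
    hasDerivAt_exp_smul_const' (generator N p q) t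
  refine (h1.clm_apply (hasDerivAt_const t g)).congr_deriv ?_
  rw [map_zero, add_zero]
  rfl

theorem hasDerivAt_operatorExp_apply (g : Config N →ᵇ ℝ) (t : ℝ) (Y : Config N) :
    HasDerivAt (fun t : ℝ => ((operatorExp (t • generator N p q) g Y : ℝ) : ℂ))
      (generatorFun p q (fun Y => ((operatorExp (t • generator N p q) g Y : ℝ) : ℂ)) Y) t := by
  have h2 := ((BoundedContinuousFunction.evalCLM ℝ Y).hasFDerivAt.comp_hasDerivAt t
    (hasDerivAt_operatorExp_smul (p := p) (q := q) g t))
  refine h2.ofReal_comp.congr_deriv ?_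
  simp [generatorFun, generator_apply]

theorem norm_operatorExp_apply_le (g : Config N →ᵇ ℝ) (T : ℝ) :
    ∃ C, 0 ≤ C ∧ ∀ t ∈ Set.Icc 0 T, ∀ Y, |operatorExp (t • generator N p q) g Y| ≤ C := by
  have hc : Continuous fun t : ℝ => operatorExp (t • generator N p q) g :=
    continuous_iff_continuousAt.2 fun t => (hasDerivAt_operatorExp_smul g t).continuousAt
  obtain ⟨C, hC⟩ := (isCompact_Icc (a := (0 : ℝ)) (b := T)).exists_bound_of_continuousOn
    hc.continuousOn
  exact ⟨max C 0, le_max_right _ _, fun t ht Y =>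
    ((BoundedContinuousFunction.norm_coe_le_norm _ Y).trans (hC t ht)).trans (le_max_left _ _)⟩

/-- The law of the process at time `t` is given by the semigroup. -/
theorem IsASEP.integral_eq {Ω : Type*} [MeasurableSpace Ω] {μ : Measure Ω} [IsProbabilityMeasure μ]
    {Y : Config N} {X : ℝ≥0 → Ω → Config N} (hX : IsASEP μ p q Y X) (t : ℝ≥0)
    (g : Config N →ᵇ ℝ) : ∫ ω, g (X t ω) ∂μ = semigroup N p q t g Y := by
  have hm : (⨆ u : Set.Iic (0 : ℝ≥0), MeasurableSpace.comap (X u) inferInstance) ≤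
      ‹MeasurableSpace Ω› := iSup_le fun u => (hX.measurable u).comap_le
  have h1 := hX.markov 0 t g
  rw [zero_add] at h1
  rw [← integral_condExp hm, integral_congr_ae h1]
  have h2 : (fun ω => semigroup N p q t g (X 0 ω)) =ᵐ[μ] fun _ => semigroup N p q t g Y := by
    filter_upwards [hX.start] with ω hω
    rw [hω]
  rw [integral_congr_ae h2]
  simp

end markov

/-! ### Identifying the sum over rankings with a probability -/

section identification

variable {N l : ℕ} {p q r : ℝ}

open Classical in
/-- The indicator function of a set of configurations. -/
def indicatorBCF (s : Set (Config N)) : Config N →ᵇ ℝ :=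
  BoundedContinuousFunction.ofNormedAddCommGroupDiscrete (s.indicator fun _ => (1 : ℝ)) 1 fun Y => by
    by_cases h : Y ∈ s <;> simp [h]

theorem indicatorBCF_apply (s : Set (Config N)) (Y : Config N) :
    indicatorBCF s Y = s.indicator (fun _ => (1 : ℝ)) Y := rfl

/-- The configurations whose first `l` particles are at `X 0, …, X (l - 1)` and whose next particle
is at `X l` or to the right of it. -/
def tailEvent (hlN : l + 1 ≤ N) (X : ℕ → ℤ) : Set (Config N) :=
  {Y | (∀ i : Fin N, (i : ℕ) < l → Y.1 i = X i) ∧ X l ≤ Y.1 ⟨l, hlN⟩}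

/-- Both sides solve the backward equation with the indicator of `tailEvent` as initial value. One
is bounded and the other grows at most exponentially, so uniqueness applies to the difference. -/
theorem rankSum_eq_semigroup (hp : 0 ≤ p) (hq : 0 < q) (hpq : p + q = 1) (hr0 : 0 < r)
    (hr : p + r < q * r ^ 2) {R : ℝ} (hR : r < R) (hlN : l + 1 ≤ N) (X : ℕ → ℤ)
    (hX : ∀ m n, m < n → n ≤ l → X m < X n) (Y : Config N) (t : ℝ≥0) :
    ((semigroup N p q t (indicatorBCF (tailEvent hlN X)) Y : ℝ) : ℂ) =
      rankSum N l p q R X Y.1 t := by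
  have hR1 : 1 < R := (one_lt_of_radius hp hpq hr0 hr).trans hR
  set g := indicatorBCF (tailEvent hlN X) with hg
  set D : ℝ → Config N → ℂ := fun t Y =>
    ((operatorExp (t • generator N p q) g Y : ℝ) : ℂ) - rankSum N l p q R X Y.1 t with hDdef
  obtain ⟨C₁, hC₁, h₁⟩ := norm_operatorExp_apply_le (p := p) (q := q) g t
  obtain ⟨C₂, hC₂, h₂⟩ := norm_rankSum_le (N := N) (l := l) hp hq hpq hr0 hr hR X t
  have hfree : ∀ (t : ℝ) (Y : Config N), HasDerivAt (fun t => rankSum N l p q R X Y.1 t)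
      (generatorFun p q (fun Y => rankSum N l p q R X Y.1 t) Y) t := by
    obtain ⟨n, rfl⟩ : ∃ n, N = n + 1 := ⟨N - 1, by omega⟩
    intro t Y
    refine (hasDerivAt_rankSum hp hq hpq hr0 hr hR X Y.1 t).congr_deriv ?_
    exact generatorFun_eq_free (by exact_mod_cast hpq) (fun y => rankSum (n + 1) l p q R X y t)
      (fun i i' y hi hy => rankSum_boundary hp hq hpq hr0 hr hR X hi y hy t) Y
  have hD : D t Y = 0 := by
    refine eq_zero_of_hasDerivAt_generatorFun hp hq.le hpq (D := D) (fun t Y => ?_) (fun Y => ?_)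
      hR1.le (C := C₁ + C₂) (T := t) (fun s hs Y => ?_) t ⟨t.2, le_rfl⟩ Y
    · refine ((hasDerivAt_operatorExp_apply g t Y).sub (hfree t Y)).congr_deriv ?_
      unfold generatorFun
      rw [← sum_sub_distrib]
      exact sum_congr rfl fun i _ => by simp only [hDdef]; ring
    · have h := sum_term_initial hp hq hpq hr0 hr hR hlN X hX Y.2
      simp only [hDdef, rankSum, h, hg, operatorExp]
      simp [indicatorBCF_apply, Set.indicator_apply, tailEvent]
      split_ifs <;> simp
    · have hw : 1 ≤ ∏ i, R ^ |Y.1 i| := by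
        have := prod_le_prod (s := (univ : Finset (Fin N))) (f := fun _ => (1 : ℝ))
          (g := fun i => R ^ |Y.1 i|) (fun _ _ => zero_le_one)
          (fun i _ => one_le_zpow₀ hR1.le (abs_nonneg _))
        simpa using this
      refine (norm_sub_le _ _).trans ?_
      rw [Complex.norm_real, Real.norm_eq_abs, add_mul]
      exact add_le_add ((h₁ s hs Y).trans (le_mul_of_one_le_right hC₁ hw)) (h₂ s hs Y.1)
  exact sub_eq_zero.1 hD

/-- The probability that the first `l + 1` particles are at given sites, as a difference of two sums
over rankings. -/
theorem IsASEP.measureReal_eq {Ω : Type*} [MeasurableSpace Ω] {μ : Measure Ω}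
    [IsProbabilityMeasure μ] {Y : Config N} {X : ℝ≥0 → Ω → Config N} (hX : IsASEP μ p q Y X)
    (hp : 0 ≤ p) (hq : 0 < q) (hpq : p + q = 1) (hr0 : 0 < r)
    (hr : p + r < q * r ^ 2) {R : ℝ} (hR : r < R) (hlN : l + 1 ≤ N) (t : ℝ≥0) (x : ℕ → ℤ)
    (hx : ∀ m n, m < n → n ≤ l → x m < x n) :
    ((μ.real {ω | ∀ i : Fin (l + 1), (X t ω).1 (Fin.castLE hlN i) = x i} : ℝ) : ℂ) =
      rankSum N l p q R x Y.1 t - rankSum N l p q R (Function.update x l (x l + 1)) Y.1 t := by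
  classical
  set x' := Function.update x l (x l + 1) with hx'
  have hx'_lt : ∀ m, m < l → x' m = x m := fun m hm => Function.update_of_ne hm.ne _ _
  have hx'_l : x' l = x l + 1 := Function.update_self ..
  have hx'_mono : ∀ m n, m < n → n ≤ l → x' m < x' n := fun m n hmn hn => by
    have := hx m n hmn hn
    rw [hx'_lt m (by omega)]
    rcases hn.lt_or_eq with h | rfl
    · rwa [hx'_lt n h]
    · rw [hx'_l]; omega
  set s : Set (Config N) := {Z | ∀ i : Fin (l + 1), Z.1 (Fin.castLE hlN i) = x i} with hs
  have hind : indicatorBCF s =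
      indicatorBCF (tailEvent hlN x) - indicatorBCF (tailEvent hlN x') := by
    ext Z
    simp only [BoundedContinuousFunction.coe_sub, Pi.sub_apply, indicatorBCF_apply,
      Set.indicator_apply]
    have e1 : Z ∈ s ↔ (∀ i : Fin N, (i : ℕ) < l → Z.1 i = x i) ∧ Z.1 ⟨l, hlN⟩ = x l := by
      refine ⟨fun h => ⟨fun i hi => h ⟨i, by omega⟩, h (Fin.last l)⟩, fun h i => ?_⟩
      rcases (Nat.lt_succ_iff.1 i.2).lt_or_eq with hi | hi
      · exact h.1 (Fin.castLE hlN i) hi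
      · have : i = Fin.last l := Fin.ext hi
        subst this
        exact h.2
    have e2 : Z ∈ tailEvent hlN x' ↔
        (∀ i : Fin N, (i : ℕ) < l → Z.1 i = x i) ∧ x l + 1 ≤ Z.1 ⟨l, hlN⟩ := by
      unfold tailEvent
      rw [Set.mem_ofPred_eq, hx'_l]
      refine and_congr_left fun _ => forall₂_congr fun i hi => by rw [hx'_lt _ hi]
    have e3 : Z ∈ tailEvent hlN x ↔
        (∀ i : Fin N, (i : ℕ) < l → Z.1 i = x i) ∧ x l ≤ Z.1 ⟨l, hlN⟩ := Iff.rfl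
    simp only [e1, e2, e3]
    by_cases h : ∀ i : Fin N, (i : ℕ) < l → Z.1 i = x i
    · rcases lt_trichotomy (Z.1 ⟨l, hlN⟩) (x l) with h' | h' | h'
      · simp [h'.ne, h'.not_ge, (h'.trans (lt_add_one _)).not_ge]
      · simp [h']
      · simp [h'.ne', h'.le, Int.add_one_le_iff.2 h']
    · simp only [h, false_and, if_false, sub_self]
  have hset : {ω | ∀ i : Fin (l + 1), (X t ω).1 (Fin.castLE hlN i) = x i} = X t ⁻¹' s := rfl
  have hmeas : MeasurableSet s := by
    have : s = ⋂ i : Fin (l + 1), {Z | Z.1 (Fin.castLE hlN i) = x i} := by ext; simp [hs]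
    rw [this]
    refine MeasurableSet.iInter fun i => ?_
    exact measurableSet_eq_fun ((measurable_pi_apply _).comp measurable_subtype_coe)
      measurable_const
  have hint : μ.real (X t ⁻¹' s) = ∫ ω, indicatorBCF s (X t ω) ∂μ := by
    have : (fun ω => indicatorBCF s (X t ω)) = (X t ⁻¹' s).indicator 1 := by
      ext ω
      simp [indicatorBCF_apply, Set.indicator_apply]
    rw [this, integral_indicator_one (hX.measurable t hmeas)]
  rw [hset, hint, hX.integral_eq, hind, map_sub, BoundedContinuousFunction.coe_sub, Pi.sub_apply,
    Complex.ofReal_sub, rankSum_eq_semigroup hp hq hpq hr0 hr hR hlN x hx,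
    rankSum_eq_semigroup hp hq hpq hr0 hr hR hlN x' hx'_mono]

end identification

/-! ### Contour integrals as averages -/

/-- Restricting angles to the indices in the range of an embedding preserves the uniform measure. -/
theorem measurePreserving_angle_comp {k N : ℕ} {e : Fin k → Fin N} (he : Function.Injective e) :
    MeasurePreserving (fun θ : Fin N → Angle => θ ∘ e) (angleMeasure N) (angleMeasure k) := by
  have hm : Measurable fun θ : Fin N → Angle => θ ∘ e :=
    measurable_pi_lambda _ fun j => measurable_pi_apply (e j)
  refine ⟨hm, (Measure.pi_eq fun s hs => ?_).symm⟩
  rw [Measure.map_apply hm (MeasurableSet.univ_pi hs)]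
  classical
  have : (fun θ : Fin N → Angle => θ ∘ e) ⁻¹' Set.univ.pi s =
      Set.univ.pi fun i => if h : ∃ j, e j = i then s h.choose else Set.univ := by
    ext θ
    simp only [Set.mem_preimage, Set.mem_univ_pi, Function.comp_apply]
    constructor
    · intro h i
      by_cases hi : ∃ j, e j = i
      · rw [dif_pos hi]
        have := h hi.choose
        rwa [hi.choose_spec] at this
      · rw [dif_neg hi]
        trivial
    · intro h j
      have hj : ∃ j', e j' = e j := ⟨j, rfl⟩
      have := h (e j)
      rwa [dif_pos hj, he hj.choose_spec] at this
  rw [this, Measure.pi_pi, ← prod_subset (subset_univ (univ.map ⟨e, he⟩)), prod_map]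
  · refine prod_congr rfl fun j _ => ?_
    have hj : ∃ j', e j' = e j := ⟨j, rfl⟩
    rw [Function.Embedding.coeFn_mk, dif_pos hj, he hj.choose_spec]
  · intro i _ hi
    have : ¬∃ j, e j = i := by simpa using hi
    rw [dif_neg this, measure_univ]

theorem pi_volume_angle (k : ℕ) :
    Measure.pi (fun _ : Fin k => (volume : Measure Angle)) =
      ENNReal.ofReal (2 * Real.pi) ^ k • angleMeasure k := by
  refine Measure.pi_eq fun s _ => ?_
  rw [Measure.smul_apply, Measure.pi_pi]
  simp [AddCircle.volume_eq_smul_haarAddCircle, prod_mul_distrib]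

/-- A torus integral around the origin as an average. -/
theorem torusIntegral_eq_torusAvg {k : ℕ} {R : ℝ} {F : (Fin k → ℂ) → ℂ}
    (hF : Continuous fun θ => F (torusPoint (fun _ => R) θ)) :
    ((2 * Real.pi * Complex.I)⁻¹) ^ k * torusIntegral F 0 (fun _ => R) =
      torusAvg (fun _ => R) fun z => F z * ∏ j, z j := by
  have hpt : ∀ θ : Fin k → ℝ, torusMap 0 (fun _ => R) θ =
      torusPoint (fun _ => R) fun j => (θ j : Angle) := fun θ => by
    ext j
    simp [torusMap, torusPoint, coe_toCircle_mk]
  have hcont : Continuous fun θ : Fin k → Angle =>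
      F (torusPoint (fun _ => R) θ) * ∏ j, torusPoint (fun _ => R) θ j := by
    have := continuous_torusPoint (N := k) fun _ => R
    refine hF.mul (continuous_finsetProd _ fun j _ => ?_)
    exact (continuous_apply j).comp this
  have hmp := measurePreserving_pi
    (fun _ : Fin k => (volume : Measure ℝ).restrict (Set.Ioc 0 (0 + 2 * Real.pi)))
    (fun _ : Fin k => (volume : Measure Angle))
    (fun _ => AddCircle.measurePreserving_mk (2 * Real.pi) 0)
  have h1 : torusIntegral F 0 (fun _ => R) = Complex.I ^ k *
      ∫ θ, F (torusPoint (fun _ => R) θ) * ∏ j, torusPoint (fun _ => R) θ j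
        ∂Measure.pi (fun _ : Fin k => (volume : Measure Angle)) := by
    rw [← hmp.map_eq, integral_map hmp.aemeasurable (by
      rw [hmp.map_eq]; exact hcont.aestronglyMeasurable), ← Measure.restrict_pi_pi,
      setIntegral_congr_set Measure.univ_pi_Ioc_ae_eq_Icc, ← integral_const_mul, torusIntegral,
      volume_pi]
    simp only [zero_add]
    refine integral_congr_ae (Eventually.of_forall fun θ => ?_)
    simp only [hpt, smul_eq_mul]
    rw [prod_mul_distrib, prod_const, card_univ, Fintype.card_fin]
    have : ∏ j, (R : ℂ) * Complex.exp (θ j * Complex.I) =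
        ∏ j, torusPoint (fun _ => R) (fun j => (θ j : Angle)) j := by
      simp only [← hpt]
      simp [torusMap]
    rw [this]
    ring
  rw [h1, pi_volume_angle, integral_smul_measure, ENNReal.toReal_pow,
    ENNReal.toReal_ofReal Real.two_pi_pos.le, torusAvg, Complex.real_smul, ← mul_assoc, ← mul_assoc]
  have : ((2 * Real.pi * Complex.I)⁻¹) ^ k * Complex.I ^ k * ((2 * Real.pi : ℝ) ^ k : ℝ) = 1 := by
    push_cast
    rw [← mul_pow, ← mul_pow]
    have : (Real.pi : ℂ) ≠ 0 := by exact_mod_cast Real.pi_ne_zero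
    rw [show (2 * Real.pi * Complex.I)⁻¹ * Complex.I * (2 * Real.pi : ℂ) = 1 by
      field_simp, one_pow]
  rw [this, one_mul]

/-- The average runs over all `N` variables, those outside `U` being idle, so that integrals over
different sets `U` live on one torus and can be added. -/
theorem contourIntegral_eq_torusAvg {N : ℕ} (U : Finset (Fin N)) {R : ℝ} {F : (Fin N → ℂ) → ℂ}
    (hFU : ∀ ξ ξ', (∀ i ∈ U, ξ i = ξ' i) → F ξ = F ξ')
    (hF : Continuous fun θ => F (torusPoint (fun _ => R) θ)) :
    contourIntegral U R F = torusAvg (fun _ => R) fun ξ => F ξ * ∏ i ∈ U, ξ i := by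
  set e : Fin #U → Fin N := fun j => U.orderIsoOfFin rfl j with he
  have hinj : Function.Injective e := fun a b h =>
    (U.orderIsoOfFin rfl).injective (Subtype.ext h)
  have hext : ∀ ξ : Fin N → ℂ, ∀ i ∈ U, extendVars U (ξ ∘ e) i = ξ i := fun ξ i hi => by
    have h : e ((U.orderIsoOfFin rfl).symm ⟨i, hi⟩) = i := by
      simp only [e, OrderIso.apply_symm_apply]
    rw [extendVars, dif_pos hi, Function.comp_apply, h]
  have hcont : Continuous fun φ : Fin #U → Angle =>
      F (extendVars U (torusPoint (fun _ => R) φ)) := by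
    set E : (Fin #U → Angle) → Fin N → Angle := fun φ i =>
      if h : i ∈ U then φ ((U.orderIsoOfFin rfl).symm ⟨i, h⟩) else 0 with hE
    have hEc : Continuous E := by
      refine continuous_pi fun i => ?_
      simp only [hE]
      split_ifs
      · exact continuous_apply _
      · exact continuous_const
    refine (hF.comp hEc).congr fun φ => hFU _ _ fun i hi => ?_
    simp [extendVars, hi, torusPoint, hE]
  rw [contourIntegral, torusIntegral_eq_torusAvg hcont, torusAvg, torusAvg,
    ← (measurePreserving_angle_comp hinj).map_eq, integral_map
      (measurePreserving_angle_comp hinj).aemeasurable]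
  · refine integral_congr_ae (Eventually.of_forall fun θ => ?_)
    have h1 : torusPoint (fun _ => R) (θ ∘ e) = torusPoint (fun _ => R) θ ∘ e := rfl
    simp only [h1]
    congr 1
    · exact hFU _ _ (hext _)
    · rw [← prod_coe_sort U, ← (U.orderIsoOfFin rfl).toEquiv.prod_comp]
      rfl
  · rw [(measurePreserving_angle_comp hinj).map_eq]
    refine (hcont.mul (continuous_finsetProd _ fun j _ => ?_)).aestronglyMeasurable
    have := continuous_torusPoint (N := #U) fun _ => R
    exact (continuous_apply j).comp this

/-! ### Rankings as pairs of a tuple and a set -/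

section ranks

variable {N l : ℕ}

open Classical in
/-- The assignment of ranks that belongs to a tuple `Λ` and a set `S`. -/
def rankOf (Λ : Fin l ↪ Fin N) (S : Finset (Fin N)) (i : Fin N) : Fin (l + 2) :=
  if h : ∃ a, Λ a = i then ⟨h.choose, by omega⟩
  else if i ∈ S then ⟨l, by omega⟩ else Fin.last (l + 1)

theorem mem_entries {Λ : Fin l ↪ Fin N} {i : Fin N} : i ∈ entries Λ ↔ ∃ a, Λ a = i := by
  simp [entries]

theorem rankOf_apply (Λ : Fin l ↪ Fin N) (S : Finset (Fin N)) (a : Fin l) :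
    (rankOf Λ S (Λ a) : ℕ) = a := by
  have h : ∃ b, Λ b = Λ a := ⟨a, rfl⟩
  rw [rankOf, dif_pos h]
  exact congrArg Fin.val (Λ.injective h.choose_spec)

theorem rankOf_of_mem {Λ : Fin l ↪ Fin N} {S : Finset (Fin N)} (hS : Disjoint S (entries Λ))
    {i : Fin N} (hi : i ∈ S) : (rankOf Λ S i : ℕ) = l := by
  have h : ¬∃ a, Λ a = i := fun h => disjoint_left.1 hS hi (mem_entries.2 h)
  rw [rankOf, dif_neg h, if_pos hi]

theorem rankOf_of_notMem {Λ : Fin l ↪ Fin N} {S : Finset (Fin N)} {i : Fin N}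
    (hi : i ∉ S ∪ entries Λ) : (rankOf Λ S i : ℕ) = l + 1 := by
  rw [mem_union, not_or, mem_entries] at hi
  rw [rankOf, dif_neg hi.2, if_neg hi.1, Fin.val_last]

theorem mem_entries_iff_rankOf {Λ : Fin l ↪ Fin N} {S : Finset (Fin N)}
    (hS : Disjoint S (entries Λ)) {i : Fin N} : i ∈ entries Λ ↔ (rankOf Λ S i : ℕ) < l := by
  refine ⟨fun h => ?_, fun h => ?_⟩
  · obtain ⟨a, rfl⟩ := mem_entries.1 h
    rw [rankOf_apply]
    exact a.2
  · by_contra h'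
    by_cases hi : i ∈ S
    · rw [rankOf_of_mem hS hi] at h; omega
    · rw [rankOf_of_notMem (by simp [hi, h'])] at h; omega

theorem mem_iff_rankOf {Λ : Fin l ↪ Fin N} {S : Finset (Fin N)}
    (hS : Disjoint S (entries Λ)) {i : Fin N} : i ∈ S ↔ (rankOf Λ S i : ℕ) = l := by
  refine ⟨fun h => rankOf_of_mem hS h, fun h => ?_⟩
  by_contra hi
  by_cases h' : i ∈ entries Λ
  · have := (mem_entries_iff_rankOf hS).1 h'; omega
  · rw [rankOf_of_notMem (by simp [hi, h'])] at h; omega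

theorem sum_rankOf {M : Type*} [AddCommMonoid M] (F : (Fin N → Fin (l + 2)) → M) :
    ∑ Λ : Fin l ↪ Fin N, ∑ S ∈ ((entries Λ)ᶜ).powerset, F (rankOf Λ S) =
      ∑ κ ∈ stageSet N l 0, F κ := by
  have hdisj : ∀ {Λ : Fin l ↪ Fin N} {S}, S ∈ ((entries Λ)ᶜ).powerset → Disjoint S (entries Λ) :=
    fun h => (subset_compl_iff_disjoint_right.1 (mem_powerset.1 h))
  rw [sum_sigma']
  refine sum_bij (fun x _ => rankOf x.1 x.2) ?_ ?_ ?_ fun _ _ => rfl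
  · rintro ⟨Λ, S⟩ h
    have hS := hdisj (mem_sigma.1 h).2
    refine mem_stageSet.2 ⟨fun a ha => ⟨Λ ⟨a, ha⟩, Fin.ext (rankOf_apply Λ S ⟨a, ha⟩),
      fun i hi => ?_⟩, by simp⟩
    obtain ⟨b, rfl⟩ := mem_entries.1 ((mem_entries_iff_rankOf (i := i) hS).2 (by rw [hi]; exact ha))
    rw [Fin.ext_iff, rankOf_apply] at hi
    congr 1
    exact Fin.ext hi
  · rintro ⟨Λ, S⟩ h ⟨Λ', S'⟩ h' heq
    have hS := hdisj (mem_sigma.1 h).2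
    have hS' := hdisj (mem_sigma.1 h').2
    simp only at heq hS hS'
    have hSS : S = S' := by
      ext i
      rw [mem_iff_rankOf hS, mem_iff_rankOf hS', heq]
    have hΛ : Λ = Λ' := by
      ext a
      have h1 := rankOf_apply Λ S a
      rw [heq] at h1
      obtain ⟨b, hb⟩ := mem_entries.1 ((mem_entries_iff_rankOf hS').2 (by rw [h1]; exact a.2))
      rw [← hb, rankOf_apply] at h1
      rw [← hb, Fin.ext h1]
    rw [hSS, hΛ]
  · intro κ hκ
    have hr := (mem_stageSet.1 hκ).1
    choose Λ hΛ hu using fun a : Fin l => hr ⟨a, by omega⟩ a.2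
    have hinj : Function.Injective Λ := fun a b hab => by
      have h1 := hΛ a
      rw [hab, hΛ b] at h1
      exact Fin.ext (Fin.mk.inj h1).symm
    set Λ' : Fin l ↪ Fin N := ⟨Λ, hinj⟩ with hΛ'
    have hmem : ∀ i, i ∈ entries Λ' ↔ (κ i : ℕ) < l := fun i => by
      rw [mem_entries]
      refine ⟨?_, fun h => ⟨⟨κ i, h⟩, (hu ⟨κ i, h⟩ i rfl).symm⟩⟩
      rintro ⟨a, rfl⟩
      simp only [hΛ', Function.Embedding.coeFn_mk, hΛ]
      exact a.2
    set S : Finset (Fin N) := {i | (κ i : ℕ) = l} with hS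
    have hSmem : ∀ i, i ∈ S ↔ (κ i : ℕ) = l := fun i => by simp [hS]
    have hd : Disjoint S (entries Λ') := disjoint_left.2 fun i h1 h2 => by
      rw [hSmem] at h1
      rw [hmem] at h2
      omega
    refine ⟨⟨Λ', S⟩, mem_sigma.2 ⟨mem_univ _, mem_powerset.2
      (subset_compl_iff_disjoint_right.2 hd)⟩, funext fun i => Fin.ext ?_⟩
    simp only
    rcases lt_trichotomy (κ i : ℕ) l with h | h | h
    · have h1 : Λ' ⟨κ i, h⟩ = i := (hu ⟨κ i, h⟩ i rfl).symm
      conv_lhs => rw [← h1]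
      rw [rankOf_apply]
    · rw [rankOf_of_mem hd ((hSmem i).2 h), h]
    · rw [rankOf_of_notMem]
      · have := (κ i).2
        omega
      · rw [mem_union, hSmem, hmem]
        omega

end ranks

/-! ### The exponents in the coefficient -/

section coefficients

variable {N l : ℕ}

theorem pairProd_const {ι : Type*} [LinearOrder ι] (s : Finset ι) (c : ℂ) :
    pairProd s (fun _ _ => c) = c ^ (#s * (#s - 1) / 2) := by
  rw [← Nat.choose_two_right]
  induction s using Finset.induction_on with
  | empty => simp [pairProd]
  | insert b s hb ih =>
    rw [pairProd_insert hb fun _ _ => rfl, ih, prod_const, ← pow_add, card_insert_of_notMem hb,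
      Nat.choose_succ_succ' _ 1, Nat.choose_one_right]

/-- Compares the exponents of `2` in `pairProd_const`. -/
theorem card_pairs {ι : Type*} [LinearOrder ι] (s : Finset ι) :
    ∑ i ∈ s, #{j ∈ s | i < j} = (#s).choose 2 := by
  have h := pairProd_const s 2
  rw [← Nat.choose_two_right] at h
  simp only [pairProd, prod_const, prod_pow_eq_pow_sum] at h
  exact Nat.pow_right_injective le_rfl (by exact_mod_cast h)

theorem choose_two_add (m n : ℕ) :
    (m + n).choose 2 = m.choose 2 + n.choose 2 + m * n := by
  induction n with
  | zero => simp
  | succ n ih =>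
    rw [← add_assoc, Nat.choose_succ_succ' _ 1, Nat.choose_succ_succ' n 1, ih, Nat.choose_one_right,
      Nat.choose_one_right]
    ring

/-- The exponent of `τ` counts the absent indices to the left of present ones and the pairs of
elements of `S`. -/
theorem tau_exponent (Λ : Fin l ↪ Fin N) {S : Finset (Fin N)} (hS : Disjoint S (entries Λ)) :
    ∑ i : Fin l, (((Λ i : ℕ) : ℤ) - ((i : ℕ) : ℤ)) + (σ S univ : ℤ) - (l + 1) * #S =
      ((∑ i ∈ S ∪ entries Λ, #{j ∈ (S ∪ entries Λ)ᶜ | j < i} + (#S).choose 2 : ℕ) : ℤ) := by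
  have hE : #(entries Λ) = l := by simp [entries]
  set P := S ∪ entries Λ with hP
  have hPc : #P = #S + l := by rw [hP, card_union_of_disjoint hS, hE]
  -- Indices start at `0`, so the value of `i` is the number of indices below it, present or absent.
  have h1 : ∑ i ∈ P, (i : ℕ) = ∑ i ∈ P, #{j ∈ Pᶜ | j < i} + (#P).choose 2 := by
    have h2 : ∑ i ∈ P, #{j ∈ P | j < i} = (#P).choose 2 := by
      rw [← card_pairs P]
      simp only [card_filter]
      rw [sum_comm]
    rw [← h2, ← sum_add_distrib]
    refine sum_congr rfl fun i _ => ?_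
    have h3 : #{j : Fin N | j < i} = i := by
      rw [show ({j : Fin N | j < i} : Finset (Fin N)) = Iio i by ext; simp, Fin.card_Iio]
    rw [← card_union_of_disjoint (disjoint_filter_filter (disjoint_compl_left (a := P))),
      ← filter_union, union_comm, union_compl, h3]
  have h4 : σ S univ = ∑ i ∈ S, (i : ℕ) + #S := by
    have : σ S univ = ∑ i ∈ S, #{j : Fin N | j ≤ i} := by
      unfold σ
      rw [card_filter, sum_product]
      simp only [card_filter]
    rw [this, card_eq_sum_ones S, ← sum_add_distrib]
    refine sum_congr rfl fun i _ => ?_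
    rw [show ({j : Fin N | j ≤ i} : Finset (Fin N)) = Iic i by ext; simp, Fin.card_Iic]
  have h5 : ∑ i ∈ P, (i : ℕ) = ∑ i ∈ S, (i : ℕ) + ∑ a : Fin l, (Λ a : ℕ) := by
    rw [hP, sum_union hS, entries, sum_map]
  have h6 : ∑ a : Fin l, (a : ℕ) = l.choose 2 := by
    rw [Fin.sum_univ_eq_sum_range (fun i => i) l, sum_range_id, Nat.choose_two_right]
  have h7 : (#P).choose 2 = (#S).choose 2 + l.choose 2 + #S * l := by
    rw [hPc]
    exact choose_two_add _ _
  rw [sum_sub_distrib]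
  have h6' : ∑ a : Fin l, ((a : ℕ) : ℤ) = l.choose 2 := by exact_mod_cast h6
  rw [h6', h4]
  have h8 : (∑ i ∈ S, (i : ℕ) + ∑ a : Fin l, (Λ a : ℕ) : ℤ) =
      (∑ i ∈ P, #{j ∈ Pᶜ | j < i} : ℕ) + ((#S).choose 2 + l.choose 2 + #S * l) := by
    have := h5.symm.trans (h1.trans (congrArg _ h7))
    exact_mod_cast this
  push_cast at h8 ⊢
  linarith

/-- The exponent of the sign. -/
theorem sign_exponent (Λ : Fin l ↪ Fin N) (S : Finset (Fin N)) :
    (-1 : ℂ) ^ ((σ S (entries Λ) : ℤ) - l * #S) =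
      (-1) ^ ∑ i ∈ S, #{j ∈ entries Λ | i < j} := by
  have hE : #(entries Λ) = l := by simp [entries]
  -- The sign thus counts the pairs in which an element of `S` stands to the left of an entry of
  -- `Λ`, the pairs whose order disagrees with their ranks.
  have h : σ S (entries Λ) + ∑ i ∈ S, #{j ∈ entries Λ | i < j} = l * #S := by
    have h1 : σ S (entries Λ) = ∑ i ∈ S, #{j ∈ entries Λ | j ≤ i} := by
      unfold σ
      rw [card_filter, sum_product]
      simp only [card_filter]
    rw [h1, ← sum_add_distrib, mul_comm, ← smul_eq_mul, ← sum_const]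
    refine sum_congr rfl fun i _ => ?_
    have h2 := card_filter_add_card_filter_not (s := entries Λ) fun j => j ≤ i
    simp only [not_le, hE] at h2
    exact h2
  have h' : (σ S (entries Λ) : ℤ) - l * #S = -((∑ i ∈ S, #{j ∈ entries Λ | i < j} : ℕ) : ℤ) := by
    have : ((σ S (entries Λ) + ∑ i ∈ S, #{j ∈ entries Λ | i < j} : ℕ) : ℤ) = l * #S := by
      rw [h]; push_cast; ring
    rw [← this]
    push_cast
    ring
  rw [h', zpow_neg, zpow_natCast, ← inv_pow]
  norm_num

theorem sgn_eq (Λ : Fin l ↪ Fin N) :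
    sgn Λ = pairProd univ fun a b => if Λ a < Λ b then 1 else -1 := by
  unfold sgn inversions pairProd
  have h : #{x : Fin l × Fin l | x.1 < x.2 ∧ Λ x.2 < Λ x.1} =
      ∑ a : Fin l, #{b : Fin l | a < b ∧ Λ b < Λ a} := by
    rw [card_filter, ← univ_product_univ, sum_product]
    simp only [card_filter]
  rw [h, ← prod_pow_eq_pow_sum]
  refine prod_congr rfl fun a _ => ?_
  rw [← prod_const, ← filter_filter, prod_filter]
  refine prod_congr rfl fun b hb => ?_
  have hab : a ≠ b := ((mem_filter.1 hb).2).ne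
  rcases lt_or_gt_of_ne (Λ.injective.ne hab) with h1 | h1
  · simp only [if_pos h1, if_neg h1.not_gt]
  · simp only [if_neg h1.not_gt, if_pos h1]

end coefficients

/-! ### Factoring the integrand into weights -/

section integrand

variable {N l : ℕ} {p q : ℝ} {Λ : Fin l ↪ Fin N} {S : Finset (Fin N)} {ξ : Fin N → ℂ}

/-- The factor `f` of an unordered pair of indices, the smaller index first. -/
def orderedF (p q : ℝ) (ξ : Fin N → ℂ) (i j : Fin N) : ℂ :=
  if i < j then f p q (ξ i) (ξ j) else f p q (ξ j) (ξ i)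

theorem orderedF_comm (i j : Fin N) : orderedF p q ξ i j = orderedF p q ξ j i := by
  unfold orderedF
  rcases lt_trichotomy i j with h | rfl | h
  · rw [if_pos h, if_neg h.not_gt]
  · rfl
  · rw [if_neg h.not_gt, if_pos h]

theorem edgeWeight_entries (hf : ∀ j k, f p q (ξ j) (ξ k) ≠ 0) {a b : Fin l} (hab : a < b) :
    edgeWeight p q (rankOf Λ S) ξ (Λ a) (Λ b) =
      (if Λ a < Λ b then 1 else -1) * f p q (ξ (Λ a)) (ξ (Λ b)) / orderedF p q ξ (Λ a) (Λ b) := by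
  have hab' := Fin.lt_def.1 hab
  unfold edgeWeight orderedF pairWeight
  rw [rankOf_apply, rankOf_apply]
  by_cases h : Λ a < Λ b
  · rw [if_pos h, if_pos h, if_pos h, if_neg (by omega), if_neg (by omega), if_pos hab', one_mul,
      div_self (hf _ _)]
  · rw [if_neg h, if_neg h, if_neg h, if_neg (by omega), if_neg (by omega), if_neg hab'.not_gt,
      if_pos hab', neg_one_mul]

theorem edgeWeight_mem_entries (hS : Disjoint S (entries Λ))
    (hf : ∀ j k, f p q (ξ j) (ξ k) ≠ 0) {i j : Fin N} (hi : i ∈ S) (hj : j ∈ entries Λ) :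
    edgeWeight p q (rankOf Λ S) ξ i j =
      (if i < j then -1 else 1) * f p q (ξ j) (ξ i) / orderedF p q ξ i j := by
  have hi' := (mem_iff_rankOf hS).1 hi
  have hj' := (mem_entries_iff_rankOf hS).1 hj
  unfold edgeWeight orderedF pairWeight
  rw [hi']
  by_cases h : i < j
  · rw [if_pos h, if_pos h, if_pos h, if_neg (by omega), if_neg (by omega), if_neg (by omega),
      if_pos hj', neg_one_mul]
  · rw [if_neg h, if_neg h, if_neg h, if_neg (by omega), if_neg (by omega), if_pos hj', one_mul,
      div_self (hf _ _)]

theorem edgeWeight_mem_mem (hS : Disjoint S (entries Λ)) {i j : Fin N} (hi : i ∈ S) (hj : j ∈ S)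
    (hij : i < j) :
    edgeWeight p q (rankOf Λ S) ξ i j = p * (ξ j - ξ i) / orderedF p q ξ i j := by
  unfold edgeWeight orderedF pairWeight
  rw [rankOf_of_mem hS hi, rankOf_of_mem hS hj]
  simp [hij]

theorem edgeWeight_present_absent (hS : Disjoint S (entries Λ)) {i j : Fin N}
    (hi : i ∈ S ∪ entries Λ) (hj : j ∈ (S ∪ entries Λ)ᶜ) :
    edgeWeight p q (rankOf Λ S) ξ i j = if j < i then ((p / q : ℝ) : ℂ) else 1 := by
  have hi' : (rankOf Λ S i : ℕ) ≤ l := by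
    rcases mem_union.1 hi with h | h
    · exact ((mem_iff_rankOf hS).1 h).le
    · exact ((mem_entries_iff_rankOf hS).1 h).le
  have hj' := rankOf_of_notMem (mem_compl.1 hj)
  have hne : i ≠ j := fun h => mem_compl.1 hj (h ▸ hi)
  unfold edgeWeight pairWeight
  rw [hj']
  rcases lt_or_gt_of_ne hne with h | h
  · rw [if_pos h, if_pos (by omega), if_neg h.not_gt]
  · rw [if_neg h.not_gt, if_neg (by omega), if_pos (by omega), if_pos h]
    push_cast
    rfl

theorem edgeWeight_absent {i j : Fin N} (hi : i ∈ (S ∪ entries Λ)ᶜ) (hj : j ∈ (S ∪ entries Λ)ᶜ) :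
    edgeWeight p q (rankOf Λ S) ξ i j = 1 := by
  unfold edgeWeight pairWeight
  rw [rankOf_of_notMem (mem_compl.1 hi), rankOf_of_notMem (mem_compl.1 hj)]
  simp

/-- The coefficient and the rational factors of the integrand, as a product of pair weights. -/
theorem pairProd_edgeWeight_rankOf (hq : q ≠ 0) (hS : Disjoint S (entries Λ))
    (hf : ∀ j k, f p q (ξ j) (ξ k) ≠ 0) :
    pairProd univ (edgeWeight p q (rankOf Λ S) ξ) =
      coeff p q Λ S * ((∏ i ∈ entries Λ, ∏ j ∈ S, f p q (ξ i) (ξ j)) *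
        (∏ i : Fin l, ∏ j ∈ Ioi i, f p q (ξ (Λ i)) (ξ (Λ j))) /
        ∏ i ∈ S ∪ entries Λ, ∏ j ∈ S ∪ entries Λ with i < j, f p q (ξ i) (ξ j)) *
      ∏ i ∈ S, ∏ j ∈ S with i < j, (ξ j - ξ i) := by
  set g := edgeWeight p q (rankOf Λ S) ξ with hg
  have hgc : ∀ i j, g i j = g j i := edgeWeight_comm p q _ ξ
  have hτ : ∏ i ∈ S ∪ entries Λ, ∏ j ∈ (S ∪ entries Λ)ᶜ, g i j =
      ((p / q : ℝ) : ℂ) ^ ∑ i ∈ S ∪ entries Λ, #{j ∈ (S ∪ entries Λ)ᶜ | j < i} := by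
    rw [← prod_pow_eq_pow_sum]
    refine prod_congr rfl fun i hi => ?_
    rw [prod_congr rfl fun j hj => edgeWeight_present_absent hS hi hj, ← prod_filter, prod_const]
  have hA : pairProd (S ∪ entries Λ)ᶜ g = 1 := by
    rw [pairProd_congr (h := fun _ _ => (1 : ℂ)) fun i hi j hj _ => edgeWeight_absent hi hj,
      pairProd_const, one_pow]
  have hSS : pairProd S g = (p : ℂ) ^ (#S).choose 2 * (∏ i ∈ S, ∏ j ∈ S with i < j, (ξ j - ξ i)) /
      pairProd S (orderedF p q ξ) := by
    rw [pairProd_congr (h := fun i j => p * (ξ j - ξ i) / orderedF p q ξ i j)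
      fun i hi j hj hij => edgeWeight_mem_mem hS hi hj hij, pairProd_div, pairProd_mul,
      pairProd_const, Nat.choose_two_right]
    rfl
  have hEE : pairProd (entries Λ) g =
      sgn Λ * (∏ i : Fin l, ∏ j ∈ Ioi i, f p q (ξ (Λ i)) (ξ (Λ j))) /
        pairProd (entries Λ) (orderedF p q ξ) := by
    rw [entries, pairProd_map Λ _ hgc, pairProd_map Λ _ orderedF_comm,
      pairProd_congr (h := fun a b => (if Λ a < Λ b then 1 else -1) *
        f p q (ξ (Λ a)) (ξ (Λ b)) / orderedF p q ξ (Λ a) (Λ b))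
        fun a _ b _ hab => edgeWeight_entries hf hab, pairProd_div, pairProd_mul, ← sgn_eq]
    congr 2
    unfold pairProd
    exact prod_congr rfl fun a _ => prod_congr (by ext; simp) fun _ _ => rfl
  have hSE : ∏ i ∈ S, ∏ j ∈ entries Λ, g i j =
      (-1) ^ (∑ i ∈ S, #{j ∈ entries Λ | i < j}) *
        (∏ i ∈ entries Λ, ∏ j ∈ S, f p q (ξ i) (ξ j)) /
        ∏ i ∈ S, ∏ j ∈ entries Λ, orderedF p q ξ i j := by
    rw [prod_congr rfl fun i hi => prod_congr rfl fun j hj => edgeWeight_mem_entries hS hf hi hj,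
      prod_comm (s := entries Λ)]
    simp only [prod_div_distrib, prod_mul_distrib]
    congr 2
    rw [← prod_pow_eq_pow_sum]
    exact prod_congr rfl fun i _ => by rw [← prod_filter, prod_const]
  have hden : ∏ i ∈ S ∪ entries Λ, ∏ j ∈ S ∪ entries Λ with i < j, f p q (ξ i) (ξ j) =
      pairProd (S ∪ entries Λ) (orderedF p q ξ) := by
    refine prod_congr rfl fun i _ => prod_congr rfl fun j hj => ?_
    rw [orderedF, if_pos (mem_filter.1 hj).2]
  -- The pairs within `S` have weights with a factor `p` each; this splits into the power of `q` in
  -- `coeff` and the part of the `τ` exponent not due to absent indices.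
  have hpow : ((p / q : ℝ) : ℂ) ^ (#S).choose 2 * (q : ℂ) ^ (#S * (#S - 1) / 2) =
      (p : ℂ) ^ (#S).choose 2 := by
    rw [← Nat.choose_two_right, ← mul_pow]
    congr 1
    push_cast
    exact div_mul_cancel₀ _ (by exact_mod_cast hq)
  rw [coeff, sign_exponent, tau_exponent Λ hS, zpow_natCast, pow_add, hden, pairProd_union hS
    orderedF_comm, ← union_compl (S ∪ entries Λ), pairProd_union disjoint_compl_right hgc,
    pairProd_union hS hgc, hτ, hA, hSS, hEE, hSE, ← hpow]
  simp only [div_eq_mul_inv, mul_inv]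
  ring

theorem prod_siteWeight_rankOf (hS : Disjoint S (entries Λ)) (hξ : ∀ i, ξ i ≠ 0) (X : ℕ → ℤ)
    (y : Fin N → ℤ) (t : ℝ) :
    ∏ i, siteWeight p q l X (rankOf Λ S i) (ξ i) (y i) t =
      (∏ a : Fin l, ξ (Λ a) ^ X a) * (∏ j ∈ S, ξ j ^ X l) * (∏ i ∈ S ∪ entries Λ, ξ i ^ (-y i)) *
        Complex.exp (∑ i ∈ S ∪ entries Λ, ε p q (ξ i) * t) / ∏ j ∈ S, (1 - ξ j) := by
  have hA : ∏ i ∈ (S ∪ entries Λ)ᶜ, siteWeight p q l X (rankOf Λ S i) (ξ i) (y i) t = 1 :=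
    prod_eq_one fun i hi => by
      rw [siteWeight, rankOf_of_notMem (mem_compl.1 hi), if_pos (by omega)]
  have hS' : ∀ i ∈ S, siteWeight p q l X (rankOf Λ S i) (ξ i) (y i) t =
      ξ i ^ X l * ξ i ^ (-y i) * Complex.exp (ε p q (ξ i) * t) * (1 - ξ i)⁻¹ := fun i hi => by
    rw [siteWeight, rankOf_of_mem hS hi, if_neg (lt_irrefl l), if_pos rfl, sub_eq_add_neg,
      zpow_add₀ (hξ i)]
    ring
  have hE : ∀ a : Fin l, siteWeight p q l X (rankOf Λ S (Λ a)) (ξ (Λ a)) (y (Λ a)) t =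
      ξ (Λ a) ^ X a * ξ (Λ a) ^ (-y (Λ a)) * Complex.exp (ε p q (ξ (Λ a)) * t) := fun a => by
    have := a.2
    rw [siteWeight, rankOf_apply, if_neg (by omega), if_neg (by omega), sub_eq_add_neg,
      zpow_add₀ (hξ _), mul_one]
  have hsplit : ∀ G : Fin N → ℂ, ∏ i ∈ S ∪ entries Λ, G i = (∏ i ∈ S, G i) * ∏ a, G (Λ a) :=
    fun G => by rw [prod_union hS, entries, prod_map]
  rw [← prod_mul_prod_compl (S ∪ entries Λ), hA, mul_one, Complex.exp_sum, hsplit, hsplit, hsplit,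
    prod_congr rfl hS', prod_congr rfl fun a _ => hE a]
  simp only [prod_mul_distrib, prod_inv_distrib]
  rw [div_eq_mul_inv]
  ring

/-- Raising `X l` by one multiplies the term by the product of the variables in `S`, which accounts
for the factor `1 - ∏ j ∈ S, ξ j`. The extra product of all present variables turns the contour
integral into an average. -/
theorem coeff_mul_integrand (hq : q ≠ 0) (hS : Disjoint S (entries Λ)) (hξ : ∀ i, ξ i ≠ 0)
    (hf : ∀ j k, f p q (ξ j) (ξ k) ≠ 0) (X : ℕ → ℤ) {x : Fin (l + 1) → ℤ}
    (hx : ∀ i, x i = X i) (y : Fin N → ℤ) (t : ℝ) :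
    coeff p q Λ S * (integrand p q t y x Λ S ξ * ∏ i ∈ S ∪ entries Λ, ξ i) =
      term p q X (rankOf Λ S) y t ξ -
        term p q (Function.update X l (X l + 1)) (rankOf Λ S) y t ξ := by
  have h1 : (∏ i ∈ S ∪ entries Λ, ξ i ^ (-y i - 1)) * ∏ i ∈ S ∪ entries Λ, ξ i =
      ∏ i ∈ S ∪ entries Λ, ξ i ^ (-y i) := by
    rw [← prod_mul_distrib]
    exact prod_congr rfl fun i _ => by rw [zpow_sub_one₀ (hξ i), inv_mul_cancel_right₀ (hξ i)]
  have h2 : ∏ a : Fin l, ξ (Λ a) ^ Function.update X l (X l + 1) a = ∏ a : Fin l, ξ (Λ a) ^ X a :=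
    prod_congr rfl fun a _ => by rw [Function.update_of_ne a.2.ne]
  have h3 : ∏ j ∈ S, ξ j ^ Function.update X l (X l + 1) l = (∏ j ∈ S, ξ j ^ X l) * ∏ j ∈ S, ξ j := by
    rw [Function.update_self, ← prod_mul_distrib]
    exact prod_congr rfl fun i _ => zpow_add_one₀ (hξ i) _
  unfold term
  rw [pairProd_edgeWeight_rankOf hq hS hf, prod_siteWeight_rankOf hS hξ,
    prod_siteWeight_rankOf hS hξ, h2, h3, ← h1, integrand]
  simp only [hx, Fin.val_castSucc, Fin.val_last]
  ring

theorem integrand_congr {ξ' : Fin N → ℂ} (t : ℝ) (y : Fin N → ℤ) (x : Fin (l + 1) → ℤ)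
    (h : ∀ i ∈ S ∪ entries Λ, ξ i = ξ' i) :
    integrand p q t y x Λ S ξ = integrand p q t y x Λ S ξ' := by
  have hS : ∀ i ∈ S, ξ i = ξ' i := fun i hi => h i (mem_union_left _ hi)
  have hE : ∀ i ∈ entries Λ, ξ i = ξ' i := fun i hi => h i (mem_union_right _ hi)
  have hΛ : ∀ a, ξ (Λ a) = ξ' (Λ a) := fun a => hE _ (mem_entries.2 ⟨a, rfl⟩)
  have h1 : ∏ i ∈ entries Λ, ∏ j ∈ S, f p q (ξ i) (ξ j) =
      ∏ i ∈ entries Λ, ∏ j ∈ S, f p q (ξ' i) (ξ' j) :=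
    prod_congr rfl fun i hi => prod_congr rfl fun j hj => by rw [hE i hi, hS j hj]
  have h2 : ∏ i ∈ S ∪ entries Λ, ∏ j ∈ S ∪ entries Λ with i < j, f p q (ξ i) (ξ j) =
      ∏ i ∈ S ∪ entries Λ, ∏ j ∈ S ∪ entries Λ with i < j, f p q (ξ' i) (ξ' j) :=
    prod_congr rfl fun i hi => prod_congr rfl fun j hj => by rw [h i hi, h j (mem_filter.1 hj).1]
  have h3 : ∏ i ∈ S, ∏ j ∈ S with i < j, (ξ j - ξ i) = ∏ i ∈ S, ∏ j ∈ S with i < j, (ξ' j - ξ' i) :=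
    prod_congr rfl fun i hi => prod_congr rfl fun j hj => by rw [hS i hi, hS j (mem_filter.1 hj).1]
  have h4 : ∀ G : Fin N → ℂ → ℂ, ∏ i ∈ S, G i (ξ i) = ∏ i ∈ S, G i (ξ' i) :=
    fun G => prod_congr rfl fun i hi => by rw [hS i hi]
  have h5 : ∏ i ∈ S ∪ entries Λ, ξ i ^ (-y i - 1) = ∏ i ∈ S ∪ entries Λ, ξ' i ^ (-y i - 1) :=
    prod_congr rfl fun i hi => by rw [h i hi]
  have h6 : ∑ i ∈ S ∪ entries Λ, ε p q (ξ i) * t = ∑ i ∈ S ∪ entries Λ, ε p q (ξ' i) * t :=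
    sum_congr rfl fun i hi => by rw [h i hi]
  unfold integrand
  rw [h1, h2, h3, h5, h6, h4 fun _ z => z, h4 fun _ z => 1 - z, h4 fun _ z => z ^ x (Fin.last l)]
  simp only [hΛ]

theorem continuousOn_integrand {r : ℝ} (hp : 0 ≤ p) (hq : 0 < q) (hpq : p + q = 1) (hr0 : 0 < r)
    (hr : p + r < q * r ^ 2) (t : ℝ) (y : Fin N → ℤ) (x : Fin (l + 1) → ℤ) :
    ContinuousOn (integrand p q t y x Λ S) (outer N r) := by
  have hr1 := one_lt_of_radius hp hpq hr0 hr
  have hc : ∀ i, ContinuousOn (fun ξ : Fin N → ℂ => ξ i) (outer N r) := fun i => by fun_prop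
  have hne : ∀ ξ ∈ outer N r, ∀ i, ξ i ≠ 0 := fun ξ hξ => ne_zero_of_mem_outer hr0 hξ
  have hf : ∀ i j, ContinuousOn (fun ξ : Fin N → ℂ => f p q (ξ i) (ξ j)) (outer N r) :=
    fun i j => by unfold f; fun_prop
  have hz : ∀ i (n : ℤ), ContinuousOn (fun ξ : Fin N → ℂ => ξ i ^ n) (outer N r) :=
    fun i n => (hc i).zpow₀ n fun ξ hξ => Or.inl (hne ξ hξ i)
  have hε : ∀ i, ContinuousOn (fun ξ : Fin N → ℂ => ε p q (ξ i) * t) (outer N r) := fun i => by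
    unfold ε
    have h' := (hc i).inv₀ fun ξ hξ => hne ξ hξ i
    exact (((continuousOn_const.mul h').add (continuousOn_const.mul (hc i))).sub
      continuousOn_const).mul continuousOn_const
  unfold integrand
  refine ((((((ContinuousOn.div ?_ ?_ ?_).mul ?_).mul (ContinuousOn.div ?_ ?_ ?_)).mul ?_).mul
    ?_).mul ?_).mul ?_
  · exact (continuousOn_finsetProd _ fun i _ => continuousOn_finsetProd _ fun j _ => hf i j).mul
      (continuousOn_finsetProd _ fun i _ => continuousOn_finsetProd _ fun j _ => hf _ _)
  · exact continuousOn_finsetProd _ fun i _ => continuousOn_finsetProd _ fun j _ => hf i j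
  · exact fun ξ hξ => prod_ne_zero_iff.2 fun i _ => prod_ne_zero_iff.2 fun j _ =>
      f_ne_zero hp hq hr0 hr (hξ i).le (hξ j).le
  · exact continuousOn_const.sub (continuousOn_finsetProd _ fun i _ => hc i)
  · exact continuousOn_finsetProd _ fun i _ => continuousOn_finsetProd _ fun j _ =>
      (hc j).sub (hc i)
  · exact continuousOn_finsetProd _ fun i _ => continuousOn_const.sub (hc i)
  · refine fun ξ hξ => prod_ne_zero_iff.2 fun i _ => sub_ne_zero.2 fun h => ?_
    have := hξ i
    rw [← h, norm_one] at this
    linarith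
  · exact continuousOn_finsetProd _ fun i _ => hz _ _
  · exact continuousOn_finsetProd _ fun i _ => hz _ _
  · exact continuousOn_finsetProd _ fun i _ => hz _ _
  · exact (continuousOn_finsetSum _ fun i _ => hε i).cexp

theorem coeff_mul_contourIntegral {r R : ℝ} (hp : 0 ≤ p) (hq : 0 < q) (hpq : p + q = 1)
    (hr0 : 0 < r) (hr : p + r < q * r ^ 2) (hR : r < R) (hS : Disjoint S (entries Λ)) (X : ℕ → ℤ)
    {x : Fin (l + 1) → ℤ} (hx : ∀ i, x i = X i) (y : Fin N → ℤ) (t : ℝ) :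
    coeff p q Λ S * contourIntegral (S ∪ entries Λ) R (integrand p q t y x Λ S) =
      torusAvg (fun _ => R) (term p q X (rankOf Λ S) y t) -
        torusAvg (fun _ => R) (term p q (Function.update X l (X l + 1)) (rankOf Λ S) y t) := by
  rw [contourIntegral_eq_torusAvg _ (fun ξ ξ' => integrand_congr t y x)
      (continuous_comp_torusPoint (fun _ => hR) (continuousOn_integrand hp hq hpq hr0 hr t y x)),
    ← torusAvg_const_mul, ← torusAvg_sub (continuous_term hp hq hpq hr0 hr hR X _ y t)
      (continuous_term hp hq hpq hr0 hr hR _ _ y t)]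
  exact torusAvg_congr (fun _ => hR) fun ξ hξ _ => coeff_mul_integrand hq.ne' hS
    (ne_zero_of_mem_outer hr0 hξ) (fun j k => f_ne_zero hp hq hr0 hr (hξ j).le (hξ k).le) X hx y t

end integrand

/-! ### Choice of the radius and conclusion -/

/-- The condition on the radius is open. The smaller circle leaves room for an open domain of
holomorphy around the contours. -/
theorem exists_smaller_radius {p q R : ℝ} (hR : 0 < R) (hR' : p + R < q * R ^ 2) :
    ∃ r, 0 < r ∧ r < R ∧ p + r < q * r ^ 2 := by
  have hc : ContinuousAt (fun r : ℝ => q * r ^ 2 - (p + r)) R := by fun_prop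
  have h1 : ∀ᶠ r in 𝓝[<] R, 0 < q * r ^ 2 - (p + r) :=
    (hc.eventually (lt_mem_nhds (sub_pos.2 hR'))).filter_mono nhdsWithin_le_nhds
  have h2 : ∀ᶠ r in 𝓝[<] R, 0 < r := (lt_mem_nhds hR).filter_mono nhdsWithin_le_nhds
  obtain ⟨r, ⟨hr, hr0⟩, hrR⟩ := ((h1.and h2).and self_mem_nhdsWithin).exists
  exact ⟨r, hr0, hrR, sub_pos.1 hr⟩

end ASEP

end

theorem theorem2 {Ω : Type*} [MeasurableSpace Ω] (μ : Measure Ω) [IsProbabilityMeasure μ]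
    (p q : ℝ) (hp : 0 ≤ p) (hq : 0 < q) (hpq : p + q = 1)
    (N l : ℕ) (hlN : l + 1 ≤ N) (Y : ASEP.Config N)
    (X : ℝ≥0 → Ω → ASEP.Config N) (hX : ASEP.IsASEP μ p q Y X)
    (t : ℝ≥0) (x : Fin (l + 1) → ℤ) (hx : StrictMono x)
    (R : ℝ) (hR : 0 < R) (hR' : p + R < q * R ^ 2) :
    ((μ.real {ω | ∀ i : Fin (l + 1), (X t ω).1 (Fin.castLE hlN i) = x i} : ℝ) : ℂ) =
      ∑ Λ : Fin l ↪ Fin N, ∑ S ∈ ((ASEP.entries Λ)ᶜ).powerset,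
        ASEP.coeff p q Λ S *
          ASEP.contourIntegral (S ∪ ASEP.entries Λ) R
            (ASEP.integrand p q (t : ℝ) Y.1 x Λ S) := by
  obtain ⟨r, hr0, hrR, hr⟩ := ASEP.exists_smaller_radius hR hR'
  -- The default `0` is never seen: sites are evaluated only at ranks up to `l`.
  set x' : ℕ → ℤ := fun n => if h : n < l + 1 then x ⟨n, h⟩ else 0 with hx'
  have hxx' : ∀ i : Fin (l + 1), x i = x' i := fun i => by simp only [hx']; rw [dif_pos i.2]
  have hmono : ∀ m n, m < n → n ≤ l → x' m < x' n := fun m n hmn hn => by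
    simp only [hx']
    rw [dif_pos (by omega), dif_pos (by omega)]
    exact hx (Fin.lt_def.2 hmn)
  have hprob := hX.measureReal_eq hp hq hpq hr0 hr hrR hlN t x' hmono
  simp only [← hxx'] at hprob
  rw [hprob, ASEP.rankSum, ASEP.rankSum, ← sum_sub_distrib, ← ASEP.sum_rankOf]
  refine sum_congr rfl fun Λ _ => sum_congr rfl fun S hS => ?_
  exact (ASEP.coeff_mul_contourIntegral hp hq hpq hr0 hr hrR
    (subset_compl_iff_disjoint_right.1 (mem_powerset.1 hS)) x' hxx' Y.1 t).symm
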